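/- Setting. Fix $N\in\mathbb N$ and $T\ge 0$, and let $(\Omega,\mathcal F,\mathbb Q)$ be a probability space carrying two independent processes. The process $X$ is a càdlàg Markov chain with values in the standard basis $e_1,\dots,e_N$ of $\mathbb R^N$, with deterministic, locally integrable rate matrices $(A_t)_{t\ge0}$, where $[A_t]_{ij}$ is the rate of jumping from $e_j$ to $e_i$, so off-diagonal entries are $\ge 0$ and columns sum to $0$. This means that $X_t-X_0-\int_{]0,t]}A_sX_s\,ds$ is a martingale. The process $Y$ is a standard Poisson process, all of whose paths lie in the space $\mathbb D$ of right-continuous nondecreasing integer-valued paths started at $0$ with jumps at most $1$. Let $\mathcal Y_t=\sigma(Y_s;s\le t)$ and $\mathcal F_t=\sigma(X_s,Y_s;s\le t)$. Martingales are with respect to $(\mathcal F_t)$ and $\mathbb Q$. Let $\lambda:\{e_1,\dots,e_N\}\times[0,\infty)\times\mathbb D\to(0,\infty)$ be a function such that each $\lambda(e_i,\cdot,\cdot)$ is predictable for the canonical filtration of $\mathbb D$, and suppose that $\mathbb Q$-a.s. $\int_{]0,T]}\lambda(e_i,s,Y)\,ds<\infty$ for all $i$. Let $\Lambda_s$ be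 the diagonal matrix with entries $(\Lambda_s)_{ii}=\lambda(e_i,s,Y)$, write $\lambda_u=\lambda(X_{u-},u,Y)$, and assume that $$Z_t=\exp\Big(-\int_{]0,t]}(\lambda_u-1)\,du\Big)\prod_{u\in]0,t]}\lambda_u^{\Delta Y_u}$$ is a true martingale on $[0,T]$. Define the diagonal-matrix-valued process $$\Gamma_t=\exp\Big(-\int_{]0,t]}(\Lambda_s-I)\,ds\Big)\cdot\prod_{s\in]0,t]}\Lambda_s^{\Delta Y_s}.$$ The unnormalised filter is $q_t=E_{\mathbb Q}[Z_tX_t\mid\mathcal Y_t]$, $t\in[0,T]$. A family of smoothing vectors is a family $(v_t)_{t\in[0,T]}$ of $\mathcal Y_T$-measurable random vectors with $E_{\mathbb Q}[Z_TX_t\mid\mathcal Y_T]=\mathrm{diag}(v_t)\,q_t$ a.s. for each $t\in[0,T]$. The smoother equation on $[0,T]$ is $$dv_t=-(A_t^\top-\Lambda_t+I)v_{t-}\,dt+(\Lambda_t^{-1}-I)v_{t-}\,dY_t,\qquad v_T=\mathbf 1 .$$ Theorem. All statements below are $\mathbb Q$-almost sure, simultaneously for all times indicated, and all integrals converge absolutely.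 1. $q$ has a version that is càdlàg on $[0,T]$. For every such version, $\bar q_t:=\Gamma_t^{-1}q_t$ satisfies $$\bar q_t=\bar q_0+\int_{]0,t]}\Gamma_s^{-1}A_s\Gamma_s\,\bar q_s\,ds,\qquad t\in[0,T].$$ 2. There is a family of smoothing vectors that is càdlàg on $[0,T]$ and solves the smoother equation. For every càdlàg solution $v$ of the smoother equation, $\bar v_t:=\Gamma_tv_t$ satisfies, for $t\in[0,T]$, $$\bar v_t=\bar v_0-\int_{]0,t]}\Gamma_sA_s^\top\Gamma_s^{-1}\bar v_s\,ds=\Gamma_T\mathbf 1+\int_{]t,T]}\Gamma_sA_s^\top\Gamma_s^{-1}\bar v_s\,ds .$$ 3. Let $v$ be any family of smoothing vectors that is càdlàg on $[0,T]$, and set $\bar v_t=\Gamma_tv_t$. For all $r\in[0,T]$ and all $i$ with $\mathbb Q(X_r=e_i)>0$, and all $t\in[r,T]$, $$(\bar v_t)_i=(\bar v_r)_i-\int_{]r,t]}\big(\Gamma_sA_s^\top\Gamma_s^{-1}\bar v_s\big)_i\,ds=(\Gamma_T\mathbf 1)_i+\int_{]t,T]}\big(\Gamma_sA_s^\top\Gamma_s^{-1}\bar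 v_s\big)_i\,ds .$$ In the equations for $\bar q$ and $\bar v$ the observation process $Y$ appears only through $\Gamma$. -/

import Mathlib

open MeasureTheory ProbabilityTheory Filter Set Topology
open scoped NNReal Matrix

noncomputable section

namespace SelfExcitingHMM

/-- Lebesgue measure `ds` on the time axis `[0, ∞)`. -/
instance instMeasureSpaceTime : MeasureSpace ℝ≥0 :=
  ⟨Measure.comap ((↑) : ℝ≥0 → ℝ) volume⟩

/-- Right-continuous paths with left limits on `[0, ∞)`. -/
def IsCadlag {E : Type*} [TopologicalSpace E] (x : ℝ≥0 → E) : Prop :=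
  (∀ t, ContinuousWithinAt x (Ici t) t) ∧ ∀ t, ∃ l, Tendsto x (𝓝[<] t) (𝓝 l)

/-- Càdlàg on the compact interval `[0, T]`: right-continuous on `[0, T)` with left limits on
`(0, T]`. -/
def IsCadlagOn {E : Type*} [TopologicalSpace E] (T : ℝ≥0) (x : ℝ≥0 → E) : Prop :=
  (∀ t < T, ContinuousWithinAt x (Ici t) t) ∧ ∀ t ≤ T, ∃ l, Tendsto x (𝓝[<] t) (𝓝 l)

/-- Paths of the hidden chain. State `i : Fin N` stands for the `i`-th standard basis vector. -/
abbrev StatePath (N : ℕ) : Type := {x : ℝ≥0 → Fin N // IsCadlag x}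

/-- Paths of counting processes: started at `0`, nondecreasing, integer valued, right-continuous
(hence right-constant), with jumps of size at most `1`. -/
def IsCountingPath (y : ℝ≥0 → ℕ) : Prop :=
  y 0 = 0 ∧ Monotone y ∧ (∀ t, ContinuousWithinAt y (Ici t) t) ∧
    ∀ t, y t ≤ Function.leftLim y t + 1

/-- The space `𝔻` of counting paths, with the σ-algebra generated by the coordinates. -/
abbrev CountingPath : Type := {y : ℝ≥0 → ℕ // IsCountingPath y}

/-- The canonical filtration `σ(x_s; s ≤ t)` on a space of paths. -/
def pathFiltration {E : Type*} [MeasurableSpace E] (p : (ℝ≥0 → E) → Prop) :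
    Filtration ℝ≥0 (inferInstance : MeasurableSpace {x : ℝ≥0 → E // p x}) where
  seq t := ⨆ s : Iic t, MeasurableSpace.comap (fun x => x.1 s.1) inferInstance
  mono' _ t hst := iSup_le fun u =>
    le_iSup (fun u : Iic t => MeasurableSpace.comap
      (fun x : {x : ℝ≥0 → E // p x} => x.1 u.1) inferInstance) ⟨u.1, le_trans u.2 hst⟩
  le' _ := iSup_le fun u =>
    ((measurable_pi_apply u.1).comp measurable_subtype_coe).comap_le

variable {Ω : Type*} {mΩ : MeasurableSpace Ω} {N : ℕ}

/-- The observation filtration `𝒴_t = σ(Y_s; s ≤ t)`. -/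
def obsFiltration (Y : Ω → CountingPath) (hY : Measurable Y) : Filtration ℝ≥0 mΩ where
  seq t := (pathFiltration IsCountingPath t).comap Y
  mono' _ _ hst := MeasurableSpace.comap_mono ((pathFiltration IsCountingPath).mono hst)
  le' t := (MeasurableSpace.comap_mono ((pathFiltration IsCountingPath).le t)).trans hY.comap_le

/-- The full filtration `ℱ_t = σ(Y_s, X_s; s ≤ t)`. -/
def fullFiltration (X : Ω → StatePath N) (hX : Measurable X)
    (Y : Ω → CountingPath) (hY : Measurable Y) : Filtration ℝ≥0 mΩ where
  seq t := obsFiltration Y hY t ⊔ (pathFiltration IsCadlag t).comap X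
  mono' _ _ hst := sup_le_sup ((obsFiltration Y hY).mono hst)
    (MeasurableSpace.comap_mono ((pathFiltration IsCadlag).mono hst))
  le' t := sup_le ((obsFiltration Y hY).le t)
    ((MeasurableSpace.comap_mono ((pathFiltration IsCadlag).le t)).trans hX.comap_le)

/-- The standard basis vector of `ℝ^N` representing the state `i`. -/
def basisVec (i : Fin N) : Fin N → ℝ := Pi.single i 1

/-- Time dependent rate matrices, with locally integrable entries; `A t i j` is the rate of jumping
from state `j` to state `i` at time `t`. -/
structure IsRateMatrix (A : ℝ≥0 → Matrix (Fin N) (Fin N) ℝ) : Prop where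
  nonneg : ∀ t i j, i ≠ j → 0 ≤ A t i j
  sum_col : ∀ t j, ∑ i, A t i j = 0
  integrable : ∀ i j t, IntegrableOn (fun s => A s i j) (Ioc 0 t)

/-- `M_t = X_t - X_0 - ∫_{]0,t]} A_s X_s ds`. -/
def chainNoise (A : ℝ≥0 → Matrix (Fin N) (Fin N) ℝ) (X : Ω → StatePath N)
    (t : ℝ≥0) (ω : Ω) : Fin N → ℝ :=
  basisVec ((X ω).1 t) - basisVec ((X ω).1 0) -
    ∫ s in Ioc 0 t, A s *ᵥ basisVec ((X ω).1 s)

/-- `Y` is a standard (unit rate) Poisson process under `Q`. -/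
structure IsStandardPoisson (Y : Ω → CountingPath) (Q : Measure Ω) : Prop where
  indep : HasIndepIncrements (fun t ω => (((Y ω).1 t : ℕ) : ℝ)) Q
  law : ∀ s t, s ≤ t → Q.map (fun ω => (Y ω).1 t - (Y ω).1 s) = poissonMeasure (t - s)

/-- The reference model: under `Q`, the observation `Y` is a standard Poisson process, the hidden
process `X` is a Markov chain with rate matrix `A` (it solves the associated martingale problem),
and the two are independent. -/
structure IsReferenceModel (Q : Measure Ω) (A : ℝ≥0 → Matrix (Fin N) (Fin N) ℝ)
    (X : Ω → StatePath N) (hX : Measurable X) (Y : Ω → CountingPath) (hY : Measurable Y) :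
    Prop where
  poisson : IsStandardPoisson Y Q
  indep : IndepFun X Y Q
  chain : Martingale (chainNoise A X) (fullFiltration X hX Y hY) Q

/-- Intensity functions `λ : 𝒳 × [0,∞) × 𝔻 → (0,∞)`, predictable in the observations. -/
structure IsIntensity (lam : Fin N → ℝ≥0 → CountingPath → ℝ) : Prop where
  pos : ∀ i t y, 0 < lam i t y
  predictable : ∀ i, IsStronglyPredictable (pathFiltration IsCountingPath) (lam i)

/-- The jump `ΔY_s = Y_s - Y_{s-}`. -/
def jump (y : CountingPath) (s : ℝ≥0) : ℕ := y.1 s - Function.leftLim y.1 s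

/-- The likelihood process
`Z_t = exp(-∫_{]0,t]} (λ_u - 1) du) ∏_{u ∈ ]0,t]} λ_u ^ ΔY_u` with `λ_u = λ(X_{u-}, u, Y)`. -/
def likelihood (lam : Fin N → ℝ≥0 → CountingPath → ℝ) (X : Ω → StatePath N)
    (Y : Ω → CountingPath) (t : ℝ≥0) (ω : Ω) : ℝ :=
  Real.exp (-∫ u in Ioc 0 t, (lam (Function.leftLim (X ω).1 u) u (Y ω) - 1)) *
    ∏ᶠ u ∈ Ioc 0 t, lam (Function.leftLim (X ω).1 u) u (Y ω) ^ jump (Y ω) u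

/-- The diagonal matrix `Λ_s` with entries `λ(e_i, s, Y)`. -/
def Lam (lam : Fin N → ℝ≥0 → CountingPath → ℝ) (y : CountingPath) (s : ℝ≥0) :
    Matrix (Fin N) (Fin N) ℝ :=
  Matrix.diagonal fun i => lam i s y

/-- `Γ_t = exp(-∫_{]0,t]} (Λ_s - I) ds) ∏_{s ∈ ]0,t]} Λ_s ^ ΔY_s`. All matrices involved are
diagonal, so exponential, integral and product act on the diagonal entries. -/
def Gam (lam : Fin N → ℝ≥0 → CountingPath → ℝ) (y : CountingPath) (t : ℝ≥0) :
    Matrix (Fin N) (Fin N) ℝ :=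
  Matrix.diagonal fun i =>
    Real.exp (-∫ s in Ioc 0 t, (lam i s y - 1)) * ∏ᶠ s ∈ Ioc 0 t, lam i s y ^ jump y s

/-- `q` is a version on `[0,T]` of the unnormalised filter `q_t = E_Q[Z_t X_t | 𝒴_t]`. -/
def IsUnnormalisedFilter (Q : Measure Ω) (T : ℝ≥0) (lam : Fin N → ℝ≥0 → CountingPath → ℝ)
    (X : Ω → StatePath N) (Y : Ω → CountingPath) (hY : Measurable Y)
    (q : ℝ≥0 → Ω → Fin N → ℝ) : Prop :=
  ∀ t ≤ T, q t =ᵐ[Q]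
    Q[fun ω => likelihood lam X Y t ω • basisVec ((X ω).1 t) | obsFiltration Y hY t]

/-- `v` is a family of `𝒴_T`-measurable smoothing vectors on `[0,T]`:
`E_Q[Z_T X_t | 𝒴_T] = diag(v_t) q_t`, where `q_t = E_Q[Z_t X_t | 𝒴_t]`. -/
def IsSmoothingVector (Q : Measure Ω) (T : ℝ≥0) (lam : Fin N → ℝ≥0 → CountingPath → ℝ)
    (X : Ω → StatePath N) (Y : Ω → CountingPath) (hY : Measurable Y)
    (v : ℝ≥0 → Ω → Fin N → ℝ) : Prop :=
  ∀ t ≤ T, Measurable[obsFiltration Y hY T] (v t) ∧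
    Q[fun ω => likelihood lam X Y T ω • basisVec ((X ω).1 t) | obsFiltration Y hY T] =ᵐ[Q]
      fun ω => Matrix.diagonal (v t ω) *ᵥ
        (Q[fun ω => likelihood lam X Y t ω • basisVec ((X ω).1 t) | obsFiltration Y hY t]) ω

/-- The path `v` solves the smoother equation
`dv_t = -(A_tᵀ - Λ_t + I) v_{t-} dt + (Λ_t⁻¹ - I) v_{t-} dY_t`, `v_T = 𝟏`, along the observation
path `y` on `[0,T]`; the `dY`-integral is the sum over the jumps. -/
def SolvesSmootherEq (A : ℝ≥0 → Matrix (Fin N) (Fin N) ℝ) (T : ℝ≥0)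
    (lam : Fin N → ℝ≥0 → CountingPath → ℝ) (y : CountingPath) (v : ℝ≥0 → Fin N → ℝ) : Prop :=
  v T = 1 ∧ ∀ t ≤ T,
    v t = v 0 - (∫ s in Ioc 0 t, ((A s)ᵀ - Lam lam y s + 1) *ᵥ Function.leftLim v s) +
      ∑ᶠ s ∈ Ioc 0 t, (jump y s : ℝ) • (((Lam lam y s)⁻¹ - 1) *ᵥ Function.leftLim v s)

end SelfExcitingHMM

end

noncomputable section

namespace SelfExcitingHMM

/-! ### Calculus on the time axis -/

/-! Under `Q` the paths `X` and `Y` are independent, so conditioning on the observations means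
freezing the path `y` and integrating over `X` (`condExp_comap_of_indepFun`). The filter becomes
`weightedProb Q lam X t t y`, that is `E[Z_t(X, y) 1_{X_t = i}]`, and what remains is calculus along
a fixed `y` with integrable intensities.

Robust filter. The entry `Γ_t(y)_i` is the likelihood of the state path that is constantly `i`, so
the ratio of `Z_t` and `Γ_t(y)_i` does not change while `X` stays in `i`. Hence `u_t(i) = E[G Z_t
1_{X_t = i}] / Γ_t(y)_i` changes only through moves of the chain, and a move in `]s, t]` has
probability at most the integral of the total rate (`measureReal_moves_le`). So `u` is continuous,
even at the jumps of `y`. Between these jumps, freezing the ratio at `s` and applying the martingale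
problem gives the claimed increment up to an error bounded by a product of increments of two
continuous functions. Repeated halving shows that such errors add up to nothing
(`eq_of_norm_sub_le_sq`). The result is `isPrimitiveOn_robust`, for any bounded weight `G` known at
the starting time.

Smoother. The robust backward equation is linear with integrable coefficients, and its Neumann
series gives a solution `V` that is measurable in `y`. Its matrix is the transpose of the forward
one, so `∑ j, V_t(j) u_t(j)` is constant in `t`. With `G = 1_{X_r = i}`, comparing `t = r` with `t =
T` yields `weightedProb_eq_mul`, which says that `V / Γ` is a family of smoothing vectors.
Multiplying or dividing by `Γ` passes between the smoother equation, which has jumps, and the robust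
one, which has none (`isPrimitiveOn_stepExp_mul`, `isJumpPrimitive_div_stepExp`).

Arbitrary smoothing vectors. They are determined where the filter is positive, which happens exactly
where `Q (X_t = i) ≠ 0`, whatever the observation; this property persists in time. There they agree
with the vectors just constructed. A component `j` that is not determined enters the equation for
`i` with the rate from the occupied state `i` into the unoccupied state `j`, and this rate vanishes
almost everywhere (`ae_rate_eq_zero`). -/

lemma map_coe_volume :
    (volume : Measure ℝ≥0).map ((↑) : ℝ≥0 → ℝ) = (volume : Measure ℝ).restrict (Ici 0) := by
  have h : MeasurableEmbedding ((↑) : ℝ≥0 → ℝ) := MeasurableEmbedding.subtype_coe measurableSet_Ici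
  have := h.map_comap (volume : Measure ℝ)
  rw [show range ((↑) : ℝ≥0 → ℝ) = Ici 0 from NNReal.range_coe] at this
  exact this

lemma measurableEmbedding_coe : MeasurableEmbedding ((↑) : ℝ≥0 → ℝ) :=
  MeasurableEmbedding.subtype_coe measurableSet_Ici

instance instSigmaFiniteTime : SigmaFinite (volume : Measure ℝ≥0) :=
  SigmaFinite.of_map _ measurableEmbedding_coe.measurable.aemeasurable (by
    rw [map_coe_volume]; infer_instance)

instance instNullSingletonClassTime : NullSingletonClass (volume : Measure ℝ≥0) := by
  refine ⟨fun x => ?_⟩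
  change Measure.comap ((↑) : ℝ≥0 → ℝ) volume {x} = 0
  rw [measurableEmbedding_coe.comap_apply]
  simp

lemma volume_Ioc_time (s t : ℝ≥0) : volume (Ioc s t) = ENNReal.ofReal ((t : ℝ) - s) := by
  change Measure.comap ((↑) : ℝ≥0 → ℝ) volume (Ioc s t) = _
  rw [measurableEmbedding_coe.comap_apply, NNReal.image_coe_Ioc]
  simp

lemma integrableOn_const_time (c : ℝ) (s t : ℝ≥0) : IntegrableOn (fun _ => c) (Ioc s t) :=
  integrableOn_const (by rw [volume_Ioc_time]; simp) (by simp)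

lemma integrableOn_Ioc_mono {E : Type*} [NormedAddCommGroup E] {φ : ℝ≥0 → E} {a b s t : ℝ≥0}
    (h : IntegrableOn φ (Ioc a b)) (hs : a ≤ s) (ht : t ≤ b) : IntegrableOn φ (Ioc s t) :=
  h.mono_set (Ioc_subset_Ioc hs ht)

lemma setIntegral_Ioc_add {E : Type*} [NormedAddCommGroup E] [NormedSpace ℝ E]
    {φ : ℝ≥0 → E} {r s t : ℝ≥0} (hrs : r ≤ s) (hst : s ≤ t) (h : IntegrableOn φ (Ioc r t)) :
    ∫ u in Ioc r t, φ u = (∫ u in Ioc r s, φ u) + ∫ u in Ioc s t, φ u := by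
  rw [← setIntegral_union (Ioc_disjoint_Ioc_of_le le_rfl) measurableSet_Ioc
    (integrableOn_Ioc_mono h le_rfl hst) (integrableOn_Ioc_mono h hrs le_rfl),
    Ioc_union_Ioc_eq_Ioc hrs hst]

/-- The integral is carried to the real line along the coercion, with `φ` extended by `toNNReal`, so
that continuity of primitives on `ℝ` applies. -/
lemma continuousOn_setIntegral_Ioc {φ : ℝ≥0 → ℝ} {a b : ℝ≥0} (h : IntegrableOn φ (Ioc a b)) :
    ContinuousOn (fun t => ∫ s in Ioc a t, φ s) (Icc a b) := by
  have key : ∀ s : ℝ≥0, ((↑) : ℝ≥0 → ℝ) ⁻¹' (Ioc (a : ℝ) s) = Ioc a s := fun s => by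
    ext x; simp
  have e : ∀ t, ∫ s in Ioc a t, φ s =
      ∫ x in Ioc (a : ℝ) t, φ x.toNNReal ∂(volume.restrict (Ici 0)) := fun t => by
    rw [← map_coe_volume, measurableEmbedding_coe.setIntegral_map, key]
    simp
  have hi : IntegrableOn (fun x : ℝ => φ x.toNNReal) (Ioc (a : ℝ) b)
      (volume.restrict (Ici 0)) := by
    rw [← map_coe_volume, measurableEmbedding_coe.integrableOn_map_iff, key]
    simpa [Function.comp_def] using h
  have := intervalIntegral.continuousOn_primitive
    ((integrableOn_Icc_iff_integrableOn_Ioc).2 hi)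
  simp_rw [e]
  refine this.comp NNReal.continuous_coe.continuousOn ?_
  intro x hx
  exact ⟨by exact_mod_cast hx.1, by exact_mod_cast hx.2⟩

/-- A function whose increments are bounded by the squared increments of a continuous function
is constant. -/
lemma eq_of_norm_sub_le_sq {E : Type*} [NormedAddCommGroup E] {D : ℝ≥0 → E} {m : ℝ≥0 → ℝ}
    {a b : ℝ≥0} {C : ℝ} (hab : a ≤ b) (hm : ContinuousOn m (Icc a b))
    (h : ∀ s t, a ≤ s → s ≤ t → t ≤ b → ‖D t - D s‖ ≤ C * (m t - m s) ^ 2) : D b = D a := by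
  -- Splitting at a point where `m` takes the mean of its end values replaces one square by two
  -- quarters of it, which gains a factor 1/2 at each round. Monotonicity of `m` is not needed.
  have key : ∀ (n : ℕ) (s t : ℝ≥0), a ≤ s → s ≤ t → t ≤ b →
      ‖D t - D s‖ ≤ C * (m t - m s) ^ 2 * (1 / 2) ^ n := by
    intro n
    induction n with
    | zero => simpa using h
    | succ n ih =>
      intro s t has hst htb
      have hmst : ContinuousOn m (uIcc s t) := by
        rw [uIcc_of_le hst]; exact hm.mono (Icc_subset_Icc has htb)
      have hmem : (m s + m t) / 2 ∈ uIcc (m s) (m t) := by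
        rcases le_total (m s) (m t) with h' | h'
        · rw [uIcc_of_le h']; constructor <;> linarith
        · rw [uIcc_of_ge h']; constructor <;> linarith
      obtain ⟨c, hc, hce⟩ := intermediate_value_uIcc hmst hmem
      rw [uIcc_of_le hst] at hc
      have h1 := ih s c has hc.1 (hc.2.trans htb)
      have h2 := ih c t (has.trans hc.1) hc.2 htb
      rw [hce] at h1 h2
      calc ‖D t - D s‖ = ‖(D t - D c) + (D c - D s)‖ := by congr 1; abel
        _ ≤ ‖D t - D c‖ + ‖D c - D s‖ := norm_add_le _ _
        _ ≤ _ := add_le_add h2 h1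
        _ = _ := by rw [pow_succ]; ring
  have hlim : Tendsto (fun n : ℕ => C * (m b - m a) ^ 2 * (1 / 2 : ℝ) ^ n) atTop (𝓝 0) := by
    simpa using (tendsto_pow_atTop_nhds_zero_of_lt_one (by norm_num : (0 : ℝ) ≤ 1 / 2)
      (by norm_num)).const_mul (C * (m b - m a) ^ 2)
  have : ‖D b - D a‖ ≤ 0 := ge_of_tendsto' hlim fun n => key n a b le_rfl hab le_rfl
  exact sub_eq_zero.1 (norm_le_zero_iff.1 this)

/-- A continuous function that is constant between finitely many exceptional times is constant. -/
lemma eq_of_eq_off_finset {E : Type*} [TopologicalSpace E] [T2Space E] {D : ℝ≥0 → E}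
    {b : ℝ≥0} (J : Finset ℝ≥0) : ∀ {a : ℝ≥0}, a ≤ b → ContinuousOn D (Icc a b) →
    (∀ s t, a ≤ s → s ≤ t → t ≤ b → (∀ u ∈ J, u ∉ Ioc s t) → D t = D s) → D b = D a := by
  induction J using Finset.strongInduction with
  | H J ih =>
    intro a hab hD h
    by_cases hJ : ∀ u ∈ J, u ∉ Ioc a b
    · exact h a b le_rfl hab le_rfl hJ
    push Not at hJ
    obtain ⟨u₀, hu₀J, hu₀⟩ := hJ
    have hne : (J.filter (· ∈ Ioc a b)).Nonempty := ⟨u₀, by simp [hu₀J, hu₀.1, hu₀.2]⟩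
    set u := (J.filter (· ∈ Ioc a b)).min' hne with hu
    have humem := Finset.min'_mem _ hne
    rw [← hu, Finset.mem_filter] at humem
    have hmin : ∀ v ∈ J, v ∈ Ioc a b → u ≤ v := fun v hv hv' =>
      Finset.min'_le _ _ (by rw [Finset.mem_filter]; exact ⟨hv, hv'⟩)
    have hau : a < u := humem.2.1
    have hub : u ≤ b := humem.2.2
    -- `D` is constant on `[a, u[`, as `u` is the first exceptional time; left-continuity at `u`
    -- does the rest.
    have h1 : D u = D a := by
      have hc : Tendsto D (𝓝[<] u) (𝓝 (D u)) := by
        have := hD u ⟨hau.le, hub⟩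
        have h' : Tendsto D (𝓝[Ioo a u] u) (𝓝 (D u)) :=
          this.mono_left (nhdsWithin_mono _ fun x hx => ⟨hx.1.le, hx.2.le.trans hub⟩)
        rwa [nhdsWithin_Ioo_eq_nhdsLT hau] at h'
      have hne' : (𝓝[<] u).NeBot := nhdsLT_neBot_of_exists_lt ⟨a, hau⟩
      refine tendsto_nhds_unique (hc.congr' ?_) tendsto_const_nhds
      filter_upwards [Ioo_mem_nhdsLT hau] with x hx
      refine h a x le_rfl hx.1.le (hx.2.le.trans hub) fun v hv hv' => ?_
      exact absurd (hmin v hv ⟨hv'.1, hv'.2.trans (hx.2.le.trans hub)⟩)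
        (not_le.2 (hv'.2.trans_lt hx.2))
    rw [← h1]
    -- To the right of `u` the intervals `]s, t]` are open on the left, so `u` itself is no longer
    -- exceptional.
    refine ih (J.erase u) (Finset.erase_ssubset humem.1) hub
      (hD.mono (Icc_subset_Icc hau.le le_rfl)) fun s t hus hst htb hno => ?_
    refine h s t (hau.le.trans hus) hst htb fun v hv hv' => ?_
    exact hno v (Finset.mem_erase.2 ⟨(hus.trans_lt hv'.1).ne', hv⟩) hv'

/-! ### Indefinite integrals: product and exponential rules. -/

/-- `f` is on `[a, b]` an indefinite integral of `φ`. -/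
def IsPrimitiveOn (a b : ℝ≥0) (f φ : ℝ≥0 → ℝ) : Prop :=
  IntegrableOn φ (Ioc a b) ∧ ∀ t, a ≤ t → t ≤ b → f t = f a + ∫ s in Ioc a t, φ s

namespace IsPrimitiveOn

variable {a b : ℝ≥0} {f φ g γ : ℝ≥0 → ℝ}

lemma sub_eq (hf : IsPrimitiveOn a b f φ) {s t : ℝ≥0} (hs : a ≤ s) (hst : s ≤ t) (ht : t ≤ b) :
    f t - f s = ∫ u in Ioc s t, φ u := by
  rw [hf.2 t (hs.trans hst) ht, hf.2 s hs (hst.trans ht),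
    setIntegral_Ioc_add hs hst (integrableOn_Ioc_mono hf.1 le_rfl ht)]
  ring

lemma mono (hf : IsPrimitiveOn a b f φ) {a' b' : ℝ≥0} (ha : a ≤ a') (hb : b' ≤ b) :
    IsPrimitiveOn a' b' f φ :=
  ⟨integrableOn_Ioc_mono hf.1 ha hb, fun t hat htb => by
    rw [← hf.sub_eq ha hat (htb.trans hb)]; ring⟩

lemma continuousOn (hf : IsPrimitiveOn a b f φ) : ContinuousOn f (Icc a b) :=
  ((continuousOn_setIntegral_Ioc hf.1).const_add (f a)).congr fun t ht => hf.2 t ht.1 ht.2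

lemma of_integral (hφ : IntegrableOn φ (Ioc a b)) (c : ℝ) :
    IsPrimitiveOn a b (fun t => c + ∫ s in Ioc a t, φ s) φ :=
  ⟨hφ, fun t _ _ => by simp⟩

lemma of_sub (hφ : IntegrableOn φ (Ioc a b))
    (h : ∀ t, a ≤ t → t ≤ b → f t - f a = ∫ u in Ioc a t, φ u) : IsPrimitiveOn a b f φ :=
  ⟨hφ, fun t hat htb => by rw [← h t hat htb]; ring⟩

lemma congr_deriv (hf : IsPrimitiveOn a b f φ) (h : ∀ᵐ s ∂volume.restrict (Ioc a b), φ s = γ s) :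
    IsPrimitiveOn a b f γ := by
  refine ⟨hf.1.congr h, fun t hat htb => ?_⟩
  rw [hf.2 t hat htb]
  congr 1
  exact integral_congr_ae (ae_mono (Measure.restrict_mono (Ioc_subset_Ioc le_rfl htb) le_rfl) h)

lemma congr (hf : IsPrimitiveOn a b f φ) (hab : a ≤ b) (h : ∀ t ∈ Icc a b, f t = g t) :
    IsPrimitiveOn a b g φ :=
  ⟨hf.1, fun t hat htb => by
    rw [← h t ⟨hat, htb⟩, ← h a ⟨le_rfl, hab⟩, hf.2 t hat htb]⟩

lemma sum {ι : Type*} (I : Finset ι) {f φ : ι → ℝ≥0 → ℝ}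
    (h : ∀ i ∈ I, IsPrimitiveOn a b (f i) (φ i)) :
    IsPrimitiveOn a b (fun t => ∑ i ∈ I, f i t) (fun t => ∑ i ∈ I, φ i t) := by
  refine ⟨integrable_finsetSum _ fun i hi => (h i hi).1, fun t hat htb => ?_⟩
  rw [integral_finsetSum _ fun i hi => integrableOn_Ioc_mono (h i hi).1 le_rfl htb,
    ← Finset.sum_add_distrib]
  exact Finset.sum_congr rfl fun i hi => (h i hi).2 t hat htb

lemma abs_sub_le (hf : IsPrimitiveOn a b f φ) {s t : ℝ≥0} (hs : a ≤ s) (hst : s ≤ t)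
    (ht : t ≤ b) : |f t - f s| ≤ ∫ u in Ioc s t, |φ u| := by
  rw [hf.sub_eq hs hst ht]
  exact abs_integral_le_integral_abs

end IsPrimitiveOn

lemma integrableOn_mul_continuousOn {a b : ℝ≥0} {φ g : ℝ≥0 → ℝ} (h : IntegrableOn φ (Ioc a b))
    (hg : ContinuousOn g (Icc a b)) : IntegrableOn (fun s => φ s * g s) (Ioc a b) :=
  h.mul_continuousOn_of_subset hg measurableSet_Ioc isCompact_Icc Ioc_subset_Icc_self

lemma setIntegral_abs_mono {φ : ℝ≥0 → ℝ} {s t s' t' : ℝ≥0} (h : IntegrableOn φ (Ioc s t))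
    (hs : s ≤ s') (ht : t' ≤ t) : ∫ u in Ioc s' t', |φ u| ≤ ∫ u in Ioc s t, |φ u| :=
  setIntegral_mono_set h.abs (ae_of_all _ fun _ => abs_nonneg _)
    (Ioc_subset_Ioc hs ht).eventuallyLE

/-- `∫ φ (h - h(s))` is of second order. -/
lemma abs_setIntegral_mul_le {φ h : ℝ≥0 → ℝ} {s t : ℝ≥0} {C : ℝ}
    (hφ : IntegrableOn φ (Ioc s t)) (hh : ∀ u ∈ Ioc s t, |h u| ≤ C) :
    |∫ u in Ioc s t, φ u * h u| ≤ C * ∫ u in Ioc s t, |φ u| := by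
  rw [← integral_const_mul, ← Real.norm_eq_abs]
  refine norm_integral_le_of_norm_le (hφ.abs.const_mul C) ?_
  filter_upwards [ae_restrict_mem measurableSet_Ioc] with u hu
  rw [Real.norm_eq_abs, abs_mul, mul_comm]
  exact mul_le_mul_of_nonneg_right (hh u hu) (abs_nonneg _)

/-- On `[s, t]` the defect of the product rule is `(f t - f s)(g t - g s) - ∫ φ (g - g s) - ∫ γ (f -
f s)`. Each of the three terms is at most the squared increment of `m = ∫ (|φ| + |γ|)`, whence the
constant 3 and the conclusion by `eq_of_norm_sub_le_sq`. -/
lemma IsPrimitiveOn.mul {a b : ℝ≥0} {f φ g γ : ℝ≥0 → ℝ}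
    (hf : IsPrimitiveOn a b f φ) (hg : IsPrimitiveOn a b g γ) :
    IsPrimitiveOn a b (fun t => f t * g t) (fun t => φ t * g t + γ t * f t) := by
  have hi1 := integrableOn_mul_continuousOn hf.1 hg.continuousOn
  have hi2 := integrableOn_mul_continuousOn hg.1 hf.continuousOn
  have hi : IntegrableOn (fun t => φ t * g t + γ t * f t) (Ioc a b) := hi1.add hi2
  refine ⟨hi, fun t hat htb => ?_⟩
  set k : ℝ≥0 → ℝ := fun s => |φ s| + |γ s| with hk
  have hki : IntegrableOn k (Ioc a b) := hf.1.abs.add hg.1.abs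
  set m : ℝ≥0 → ℝ := fun t => ∫ s in Ioc a t, k s with hmdef
  have hm : ContinuousOn m (Icc a b) := continuousOn_setIntegral_Ioc hki
  have hmsub : ∀ s t, a ≤ s → s ≤ t → t ≤ b → ∫ u in Ioc s t, k u = m t - m s := by
    intro s t has hst htb
    rw [hmdef]
    simp only
    rw [setIntegral_Ioc_add has hst (integrableOn_Ioc_mono hki le_rfl htb)]
    ring
  have hφm : ∀ s t, a ≤ s → s ≤ t → t ≤ b → ∫ u in Ioc s t, |φ u| ≤ m t - m s := by
    intro s t has hst htb
    rw [← hmsub s t has hst htb]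
    exact integral_mono (integrableOn_Ioc_mono hf.1 has htb).abs
      (integrableOn_Ioc_mono hki has htb) fun u => by simp [hk]
  have hγm : ∀ s t, a ≤ s → s ≤ t → t ≤ b → ∫ u in Ioc s t, |γ u| ≤ m t - m s := by
    intro s t has hst htb
    rw [← hmsub s t has hst htb]
    exact integral_mono (integrableOn_Ioc_mono hg.1 has htb).abs
      (integrableOn_Ioc_mono hki has htb) fun u => by simp [hk]
  have hmmono : ∀ s t u, a ≤ s → s ≤ u → u ≤ t → t ≤ b → m u - m s ≤ m t - m s := by
    intro s t u has hsu hut htb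
    have : 0 ≤ ∫ v in Ioc u t, k v :=
      integral_nonneg fun v => add_nonneg (abs_nonneg _) (abs_nonneg _)
    rw [hmsub u t (has.trans hsu) hut htb] at this
    linarith
  have key := eq_of_norm_sub_le_sq (D := fun t => f t * g t -
      ∫ s in Ioc a t, (φ s * g s + γ s * f s)) (m := m) (C := 3) hat
    (hm.mono (Icc_subset_Icc le_rfl htb)) ?_
  · simp only [Ioc_self, setIntegral_empty, sub_zero] at key
    linarith
  intro s t' has hst ht'
  have htb' := ht'.trans htb
  rw [Real.norm_eq_abs]
  have e1 : ∫ u in Ioc s t', φ u * (g u - g s) =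
      (∫ u in Ioc s t', φ u * g u) - (f t' - f s) * g s := by
    rw [hf.sub_eq has hst htb', ← integral_mul_const, ← integral_sub
      (integrableOn_Ioc_mono hi1 has htb')
      ((integrableOn_Ioc_mono hf.1 has htb').mul_const _)]
    simp only [mul_sub]
  have e2 : ∫ u in Ioc s t', γ u * (f u - f s) =
      (∫ u in Ioc s t', γ u * f u) - (g t' - g s) * f s := by
    rw [hg.sub_eq has hst htb', ← integral_mul_const, ← integral_sub
      (integrableOn_Ioc_mono hi2 has htb')
      ((integrableOn_Ioc_mono hg.1 has htb').mul_const _)]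
    simp only [mul_sub]
  have e3 : f t' * g t' - (∫ u in Ioc a t', (φ u * g u + γ u * f u)) -
      (f s * g s - ∫ u in Ioc a s, (φ u * g u + γ u * f u)) =
      (f t' - f s) * (g t' - g s) - (∫ u in Ioc s t', φ u * (g u - g s)) -
        ∫ u in Ioc s t', γ u * (f u - f s) := by
    rw [setIntegral_Ioc_add has hst (integrableOn_Ioc_mono hi le_rfl htb'), e1, e2,
      integral_add (integrableOn_Ioc_mono hi1 has htb') (integrableOn_Ioc_mono hi2 has htb')]
    ring
  rw [e3]
  have hM0 : 0 ≤ m t' - m s := by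
    rw [← hmsub s t' has hst htb']
    exact integral_nonneg fun v => add_nonneg (abs_nonneg _) (abs_nonneg _)
  have b1 : |(f t' - f s) * (g t' - g s)| ≤ (m t' - m s) ^ 2 := by
    rw [abs_mul, sq]
    exact mul_le_mul ((hf.abs_sub_le has hst htb').trans (hφm s t' has hst htb'))
      ((hg.abs_sub_le has hst htb').trans (hγm s t' has hst htb')) (abs_nonneg _) hM0
  have b2 : |∫ u in Ioc s t', φ u * (g u - g s)| ≤ (m t' - m s) ^ 2 := by
    refine (abs_setIntegral_mul_le (C := m t' - m s) (integrableOn_Ioc_mono hf.1 has htb')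
      fun u hu => ?_).trans ?_
    · exact (hg.abs_sub_le has hu.1.le (hu.2.trans htb')).trans
        ((hγm s u has hu.1.le (hu.2.trans htb')).trans (hmmono s t' u has hu.1.le hu.2 htb'))
    · rw [sq]; exact mul_le_mul_of_nonneg_left (hφm s t' has hst htb') hM0
  have b3 : |∫ u in Ioc s t', γ u * (f u - f s)| ≤ (m t' - m s) ^ 2 := by
    refine (abs_setIntegral_mul_le (C := m t' - m s) (integrableOn_Ioc_mono hg.1 has htb')
      fun u hu => ?_).trans ?_
    · exact (hf.abs_sub_le has hu.1.le (hu.2.trans htb')).trans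
        ((hφm s u has hu.1.le (hu.2.trans htb')).trans (hmmono s t' u has hu.1.le hu.2 htb'))
    · rw [sq]; exact mul_le_mul_of_nonneg_left (hγm s t' has hst htb') hM0
  rw [abs_le] at b1 b2 b3 ⊢
  constructor <;> linarith [b1.1, b1.2, b2.1, b2.2, b3.1, b3.2]

lemma abs_exp_sub_one_le_mul_exp (x : ℝ) : |Real.exp x - 1| ≤ |x| * Real.exp |x| := by
  have h1 := Real.add_one_le_exp x
  have h2 := Real.add_one_le_exp (-x)
  have h3 : Real.exp (-x) * Real.exp x = 1 := by rw [← Real.exp_add]; simp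
  have h4 := Real.exp_pos x
  have h5 : 1 ≤ Real.exp |x| := Real.one_le_exp (abs_nonneg x)
  have h6 : Real.exp x ≤ Real.exp |x| := Real.exp_le_exp.2 (le_abs_self x)
  rcases le_total 0 x with hx | hx
  · rw [abs_of_nonneg hx, abs_of_nonneg (by linarith)]
    nlinarith
  · rw [abs_of_nonpos (by linarith [Real.exp_le_one_iff.2 hx] : Real.exp x - 1 ≤ 0)]
    have := abs_of_nonpos hx
    nlinarith [abs_nonneg x]

lemma abs_exp_sub_one_sub_le (x : ℝ) : |Real.exp x - 1 - x| ≤ x ^ 2 * Real.exp |x| := by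
  have h1 := Real.add_one_le_exp x
  have h2 := Real.add_one_le_exp (-x)
  have h3 : Real.exp (-x) * Real.exp x = 1 := by rw [← Real.exp_add]; simp
  have h4 := Real.exp_pos x
  rw [abs_of_nonneg (by linarith)]
  -- This rearranges to `(1 - x) * exp x ≤ 1`, which is `h2` multiplied by `exp x`.
  have h7 : Real.exp x - 1 - x ≤ x * (Real.exp x - 1) := by nlinarith
  refine h7.trans ((le_abs_self _).trans ?_)
  rw [abs_mul, ← sq_abs, sq, mul_assoc]
  exact mul_le_mul_of_nonneg_left (abs_exp_sub_one_le_mul_exp x) (abs_nonneg x)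

/-- With `exp (f s)` factored out, the defect of the chain rule on `[s, t]` is a second-order Taylor
remainder minus `∫ φ (exp f - exp (f s))`. Both are at most `C * exp M` times the squared increment
of `m = ∫ |φ|`, where `C` bounds `exp f` and `M` is the total mass of `|φ|`. -/
lemma IsPrimitiveOn.exp {a b : ℝ≥0} {f φ : ℝ≥0 → ℝ} (hf : IsPrimitiveOn a b f φ) :
    IsPrimitiveOn a b (fun t => Real.exp (f t)) (fun t => φ t * Real.exp (f t)) := by
  have hc : ContinuousOn (fun t => Real.exp (f t)) (Icc a b) := hf.continuousOn.rexp
  have hi := integrableOn_mul_continuousOn hf.1 hc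
  refine ⟨hi, fun t hat htb => ?_⟩
  set m : ℝ≥0 → ℝ := fun t => ∫ s in Ioc a t, |φ s| with hmdef
  have hm : ContinuousOn m (Icc a b) := continuousOn_setIntegral_Ioc hf.1.abs
  have hmsub : ∀ s t, a ≤ s → s ≤ t → t ≤ b → ∫ u in Ioc s t, |φ u| = m t - m s := by
    intro s t has hst htb
    rw [hmdef]
    simp only
    rw [setIntegral_Ioc_add has hst (integrableOn_Ioc_mono hf.1.abs le_rfl htb)]
    ring
  obtain ⟨C, hC⟩ := isCompact_Icc.exists_bound_of_continuousOn hc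
  set M := ∫ u in Ioc a b, |φ u|
  have hfM : ∀ s t, a ≤ s → s ≤ t → t ≤ b → |f t - f s| ≤ M := fun s t has hst htb =>
    (hf.abs_sub_le has hst htb).trans (setIntegral_abs_mono hf.1 has htb)
  have key := eq_of_norm_sub_le_sq (D := fun t => Real.exp (f t) -
      ∫ s in Ioc a t, φ s * Real.exp (f s)) (m := m) (C := 2 * (C * Real.exp M)) hat
    (hm.mono (Icc_subset_Icc le_rfl htb)) ?_
  · simp only [Ioc_self, setIntegral_empty, sub_zero] at key
    linarith
  intro s t' has hst ht'
  have htb' := ht'.trans htb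
  have hsb := hst.trans htb'
  have hCs := hC s ⟨has, hsb⟩
  rw [Real.norm_eq_abs, abs_of_pos (Real.exp_pos _)] at hCs
  have hC0 : 0 ≤ C := (Real.exp_pos _).le.trans hCs
  rw [Real.norm_eq_abs]
  have e1 : ∫ u in Ioc s t', φ u * (Real.exp (f u) - Real.exp (f s)) =
      (∫ u in Ioc s t', φ u * Real.exp (f u)) - (f t' - f s) * Real.exp (f s) := by
    rw [hf.sub_eq has hst htb', ← integral_mul_const, ← integral_sub
      (integrableOn_Ioc_mono hi has htb')
      ((integrableOn_Ioc_mono hf.1 has htb').mul_const _)]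
    simp only [mul_sub]
  have e2 : ∀ u, Real.exp (f u) = Real.exp (f s) * Real.exp (f u - f s) := fun u => by
    rw [← Real.exp_add]; ring_nf
  have e3 : Real.exp (f t') - (∫ u in Ioc a t', φ u * Real.exp (f u)) -
      (Real.exp (f s) - ∫ u in Ioc a s, φ u * Real.exp (f u)) =
      Real.exp (f s) * (Real.exp (f t' - f s) - 1 - (f t' - f s)) -
        ∫ u in Ioc s t', φ u * (Real.exp (f u) - Real.exp (f s)) := by
    rw [setIntegral_Ioc_add has hst (integrableOn_Ioc_mono hi le_rfl htb'), e1, e2 t']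
    ring
  rw [e3]
  have hM0 : 0 ≤ m t' - m s := by
    rw [← hmsub s t' has hst htb']
    exact integral_nonneg fun v => abs_nonneg _
  have hle : ∀ u, s ≤ u → u ≤ t' → |f u - f s| ≤ m t' - m s := fun u hsu hut => by
    rw [← hmsub s t' has hst htb']
    exact (hf.abs_sub_le has hsu (hut.trans htb')).trans
      (setIntegral_abs_mono (integrableOn_Ioc_mono hf.1 has htb') le_rfl hut)
  have hexpM : ∀ u, s ≤ u → u ≤ t' → Real.exp |f u - f s| ≤ Real.exp M := fun u hsu hut =>
    Real.exp_le_exp.2 (hfM s u has hsu (hut.trans htb'))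
  have b1 : |Real.exp (f s) * (Real.exp (f t' - f s) - 1 - (f t' - f s))| ≤
      (C * Real.exp M) * (m t' - m s) ^ 2 := by
    rw [abs_mul, abs_of_pos (Real.exp_pos _), mul_assoc]
    refine mul_le_mul hCs ((abs_exp_sub_one_sub_le _).trans ?_) (abs_nonneg _) hC0
    rw [mul_comm, ← sq_abs (f t' - f s)]
    have := hle t' hst le_rfl
    have := hexpM t' hst le_rfl
    gcongr
  have b2 : |∫ u in Ioc s t', φ u * (Real.exp (f u) - Real.exp (f s))| ≤
      (C * Real.exp M) * (m t' - m s) ^ 2 := by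
    refine (abs_setIntegral_mul_le (C := C * ((m t' - m s) * Real.exp M))
      (integrableOn_Ioc_mono hf.1 has htb') fun u hu => ?_).trans ?_
    · rw [e2 u, show Real.exp (f s) * Real.exp (f u - f s) - Real.exp (f s) =
        Real.exp (f s) * (Real.exp (f u - f s) - 1) by ring, abs_mul,
        abs_of_pos (Real.exp_pos _)]
      refine mul_le_mul hCs ((abs_exp_sub_one_le_mul_exp _).trans ?_) (abs_nonneg _) hC0
      have := hle u hu.1.le hu.2
      have := hexpM u hu.1.le hu.2
      gcongr
    · rw [hmsub s t' has hst htb']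
      exact le_of_eq (by ring)
  rw [abs_le] at b1 b2 ⊢
  constructor <;> linarith [b1.1, b1.2, b2.1, b2.2]

/-! ### Right-continuous functions -/

lemma tendsto_dyadic_right (t : ℝ≥0) :
    Tendsto (fun n : ℕ => ((⌊((n : ℝ≥0) + 1) * t⌋₊ : ℝ≥0) + 1) / ((n : ℝ≥0) + 1)) atTop
      (𝓝[≥] t) := by
  have hlt : ∀ n : ℕ, t ≤ ((⌊((n : ℝ≥0) + 1) * t⌋₊ : ℝ≥0) + 1) / ((n : ℝ≥0) + 1) := fun n => by
    rw [le_div_iff₀ (by positivity), mul_comm]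
    exact (Nat.lt_floor_add_one _).le
  have hle : ∀ n : ℕ, ((⌊((n : ℝ≥0) + 1) * t⌋₊ : ℝ≥0) + 1) / ((n : ℝ≥0) + 1) ≤
      t + 1 / ((n : ℝ≥0) + 1) := fun n => by
    rw [div_le_iff₀ (by positivity), add_mul t, one_div, inv_mul_cancel₀ (by positivity),
      mul_comm t]
    gcongr
    exact Nat.floor_le (by positivity)
  refine tendsto_nhdsWithin_iff.2 ⟨?_, Eventually.of_forall hlt⟩
  refine tendsto_of_tendsto_of_tendsto_of_le_of_le tendsto_const_nhds ?_ hlt hle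
  simpa using (tendsto_one_div_add_atTop_nhds_zero_nat (𝕜 := ℝ≥0)).const_add t

/-- Evaluating at the next point on the right of a grid of mesh `1 / (n + 1)` involves only
countably many times, hence is jointly measurable; right-continuity identifies the pointwise limit.
-/
lemma measurable_uncurry_of_rightCont {Z E : Type*} [MeasurableSpace Z] [TopologicalSpace E]
    [TopologicalSpace.PseudoMetrizableSpace E] [MeasurableSpace E] [BorelSpace E]
    {x : ℝ≥0 → Z → E} (hm : ∀ t, Measurable (x t))
    (hc : ∀ z t, ContinuousWithinAt (fun s => x s z) (Ici t) t) :
    Measurable (fun p : ℝ≥0 × Z => x p.1 p.2) := by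
  refine measurable_of_tendsto_metrizable (f := fun (n : ℕ) (p : ℝ≥0 × Z) =>
    x (((⌊((n : ℝ≥0) + 1) * p.1⌋₊ : ℝ≥0) + 1) / ((n : ℝ≥0) + 1)) p.2) (fun n => ?_) ?_
  · have h1 : Measurable (fun q : ℕ × Z => x (((q.1 : ℝ≥0) + 1) / ((n : ℝ≥0) + 1)) q.2) :=
      measurable_from_prod_countable_right fun k => hm (((k : ℝ≥0) + 1) / ((n : ℝ≥0) + 1))
    have h2 : Measurable (fun p : ℝ≥0 × Z => (⌊((n : ℝ≥0) + 1) * p.1⌋₊, p.2)) :=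
      (Nat.measurable_floor.comp (measurable_fst.const_mul _)).prodMk measurable_snd
    have h3 := h1.comp h2
    simp only [Function.comp_def] at h3
    exact h3
  · rw [tendsto_pi_nhds]
    intro p
    exact (hc p.2 p.1).tendsto.comp (tendsto_dyadic_right p.1)

lemma tendsto_sub_left {t : ℝ≥0} (ht : 0 < t) :
    Tendsto (fun n : ℕ => t - 1 / ((n : ℝ≥0) + 1)) atTop (𝓝[<] t) := by
  refine tendsto_nhdsWithin_iff.2 ⟨?_, Eventually.of_forall fun n => ?_⟩
  · simpa using tendsto_const_nhds.sub (tendsto_one_div_add_atTop_nhds_zero_nat (𝕜 := ℝ≥0))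
  · exact tsub_lt_self ht (by positivity)

/-- Consequently `Function.leftLim` at time `0` is by convention the value at `0`; genuine
statements about left limits need `0 < t`. -/
lemma nhdsLT_zero_time : 𝓝[<] (0 : ℝ≥0) = ⊥ := by simp

lemma nhdsLT_neBot_time {t : ℝ≥0} (ht : 0 < t) : (𝓝[<] t).NeBot :=
  nhdsLT_neBot_of_exists_lt ⟨0, ht⟩

lemma leftLim_eq_time {E : Type*} [TopologicalSpace E] [T2Space E] {x : ℝ≥0 → E} {t : ℝ≥0} {l : E}
    (ht : 0 < t) (h : Tendsto x (𝓝[<] t) (𝓝 l)) : Function.leftLim x t = l :=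
  have := nhdsLT_neBot_time ht
  leftLim_eq_of_tendsto h

lemma leftLim_congr_time {E : Type*} [TopologicalSpace E] [T2Space E] {x x' : ℝ≥0 → E} {t : ℝ≥0}
    (ht : 0 < t) (hl : ∃ l, Tendsto x (𝓝[<] t) (𝓝 l)) (h : ∀ s < t, x s = x' s) :
    Function.leftLim x t = Function.leftLim x' t := by
  obtain ⟨l, hl⟩ := hl
  rw [leftLim_eq_time ht hl, leftLim_eq_time ht (hl.congr' _)]
  filter_upwards [self_mem_nhdsWithin] with s hs using h s hs

lemma leftLim_const_time {E : Type*} [TopologicalSpace E] [T2Space E] (c : E) (t : ℝ≥0) :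
    Function.leftLim (fun _ : ℝ≥0 => c) t = c :=
  continuousWithinAt_const.leftLim_eq

lemma measurable_uncurry_leftLim {Z E : Type*} [MeasurableSpace Z] [TopologicalSpace E] [T2Space E]
    [TopologicalSpace.PseudoMetrizableSpace E] [MeasurableSpace E] [BorelSpace E]
    {x : ℝ≥0 → Z → E} (hm : ∀ t, Measurable (x t))
    (hc : ∀ z, IsCadlag (fun s => x s z)) :
    Measurable (fun p : ℝ≥0 × Z => Function.leftLim (fun s => x s p.2) p.1) := by
  have hx := measurable_uncurry_of_rightCont hm fun z t => (hc z).1 t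
  refine measurable_of_tendsto_metrizable (f := fun (n : ℕ) (p : ℝ≥0 × Z) =>
    x (p.1 - 1 / ((n : ℝ≥0) + 1)) p.2) (fun n => ?_) ?_
  · exact hx.comp ((measurable_fst.sub_const _).prodMk measurable_snd)
  · rw [tendsto_pi_nhds]
    rintro ⟨t, z⟩
    rcases eq_or_lt_of_le (zero_le (a := t)) with rfl | ht
    -- At time `0` the truncated subtraction returns `0`, in agreement with the convention for the
    -- left limit.
    · simp [leftLim_eq_of_eq_bot _ nhdsLT_zero_time]
    · obtain ⟨l, hl⟩ := (hc z).2 t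
      simp only [leftLim_eq_time ht hl]
      exact hl.comp (tendsto_sub_left ht)

namespace IsCadlagOn

variable {E : Type*} [TopologicalSpace E] {T : ℝ≥0} {v : ℝ≥0 → E}

/-- Stopping at `T` makes results on globally càdlàg paths available on `[0, T]`. -/
lemma stopped (h : IsCadlagOn T v) : IsCadlag (fun t => v (min t T)) := by
  constructor
  · intro t
    rcases lt_or_ge t T with ht | ht
    · have h1 := h.1 t ht
      refine (h1.congr_of_eventuallyEq ?_ (by simp [ht.le]))
      have : ∀ᶠ s in 𝓝[≥] t, s < T := nhdsWithin_le_nhds (eventually_lt_nhds ht)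
      filter_upwards [this] with s hs
      simp [hs.le]
    · refine (continuousWithinAt_const (b := v T)).congr_of_eventuallyEq ?_ (by simp [ht])
      filter_upwards [self_mem_nhdsWithin] with s hs
      simp [ht.trans hs]
  · intro t
    rcases le_or_gt t T with ht | ht
    · obtain ⟨l, hl⟩ := h.2 t ht
      refine ⟨l, hl.congr' ?_⟩
      filter_upwards [self_mem_nhdsWithin] with s hs
      have : s ≤ T := (le_of_lt hs).trans ht
      simp [this]
    · refine ⟨v T, tendsto_const_nhds.congr' ?_⟩
      have : ∀ᶠ s in 𝓝[<] t, T < s := nhdsWithin_le_nhds (eventually_gt_nhds ht)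
      filter_upwards [this] with s hs
      simp [hs.le]

lemma exists_bound {v : ℝ≥0 → ℝ} (h : IsCadlagOn T v) : ∃ C, ∀ t ≤ T, |v t| ≤ C := by
  have key : ∃ C, ∀ t ∈ Icc 0 T, |v (min t T)| ≤ C := by
    refine isCompact_Icc.induction_on (p := fun s => ∃ C, ∀ t ∈ s, |v (min t T)| ≤ C)
      ⟨0, by simp⟩ ?_ ?_ ?_
    · rintro s t hst ⟨C, hC⟩
      exact ⟨C, fun x hx => hC x (hst hx)⟩
    · rintro s t ⟨C, hC⟩ ⟨C', hC'⟩
      refine ⟨max C C', fun x hx => ?_⟩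
      rcases hx with hx | hx
      · exact (hC x hx).trans (le_max_left _ _)
      · exact (hC' x hx).trans (le_max_right _ _)
    · intro t _
      obtain ⟨l, hl⟩ := h.stopped.2 t
      have h1 : ∀ᶠ s in 𝓝[<] t, |v (min s T)| ≤ |l| + 1 := by
        filter_upwards [hl.abs.eventually (eventually_lt_nhds (lt_add_one |l|))] with s hs
        exact hs.le
      have h2 : ∀ᶠ s in 𝓝[≥] t, |v (min s T)| ≤ |v (min t T)| + 1 := by
        filter_upwards [(h.stopped.1 t).tendsto.abs.eventually
          (eventually_lt_nhds (lt_add_one |v (min t T)|))] with s hs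
        exact hs.le
      refine ⟨{s | |v (min s T)| ≤ max (|l| + 1) (|v (min t T)| + 1)}, ?_, _, fun x hx => hx⟩
      refine mem_nhdsWithin_of_mem_nhds ?_
      -- The left limit bounds the function on one side of `t` and right-continuity on the other;
      -- compactness makes finitely many local bounds suffice.
      rw [← nhdsLT_sup_nhdsGE, mem_sup]
      constructor
      · filter_upwards [h1] with s hs using hs.trans (le_max_left _ _)
      · filter_upwards [h2] with s hs using hs.trans (le_max_right _ _)
  obtain ⟨C, hC⟩ := key
  exact ⟨C, fun t ht => by simpa [ht] using hC t ⟨zero_le, ht⟩⟩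

end IsCadlagOn

lemma IsCadlag.isCadlagOn {E : Type*} [TopologicalSpace E] {v : ℝ≥0 → E} (h : IsCadlag v)
    (T : ℝ≥0) : IsCadlagOn T v :=
  ⟨fun t _ => h.1 t, fun t _ => h.2 t⟩

lemma IsCadlagOn.measurable_stop {T : ℝ≥0} {v : ℝ≥0 → ℝ} (h : IsCadlagOn T v) :
    Measurable (fun t => v (min t T)) := by
  have := measurable_uncurry_of_rightCont (Z := Unit) (x := fun t _ => v (min t T))
    (fun t => measurable_const) fun _ t => h.stopped.1 t
  exact this.comp (measurable_id.prodMk (measurable_const (a := ())))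

/-! ### Counting paths -/

namespace CountingPath

variable (y : CountingPath)

lemma isCadlag : IsCadlag y.1 :=
  ⟨y.2.2.2.1, fun t => ⟨_, y.2.2.1.tendsto_leftLim t⟩⟩

lemma jump_le_one (s : ℝ≥0) : jump y s ≤ 1 := by
  have := y.2.2.2.2 s
  unfold jump
  omega

lemma jump_ne_zero_iff (s : ℝ≥0) : jump y s ≠ 0 ↔ Function.leftLim y.1 s < y.1 s := by
  unfold jump
  omega

lemma jump_eq_one {s : ℝ≥0} (h : jump y s ≠ 0) : jump y s = 1 := by
  have := jump_le_one y s
  omega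

/-- The path increases strictly at each jump, so it is injective on its jump times, and its values
there are natural numbers not exceeding `y.1 t`. -/
lemma finite_jumps (t : ℝ≥0) : {s ∈ Ioc 0 t | jump y s ≠ 0}.Finite := by
  refine Finite.of_finite_image (f := y.1) ((finite_Iic (y.1 t)).subset ?_) ?_
  · rintro _ ⟨s, hs, rfl⟩
    exact y.2.2.1 hs.1.2
  · intro s hs s' hs' e
    have h1 := (jump_ne_zero_iff y s).1 hs.2
    have h2 := (jump_ne_zero_iff y s').1 hs'.2
    rcases lt_trichotomy s s' with h | h | h
    · have := y.2.2.1.le_leftLim h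
      omega
    · exact h
    · have := y.2.2.1.le_leftLim h
      omega

/-- The jump times of a counting path up to time `t`. -/
def jumpTimes (t : ℝ≥0) : Finset ℝ≥0 := (finite_jumps y t).toFinset

lemma mem_jumpTimes {t s : ℝ≥0} : s ∈ jumpTimes y t ↔ (0 < s ∧ s ≤ t) ∧ jump y s ≠ 0 := by
  simp [jumpTimes, and_assoc]

lemma jumpTimes_eq_filter {s t : ℝ≥0} (hst : s ≤ t) :
    jumpTimes y s = (jumpTimes y t).filter (· ≤ s) := by
  ext u
  simp only [Finset.mem_filter, mem_jumpTimes]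
  constructor
  · rintro ⟨⟨h1, h2⟩, h3⟩
    exact ⟨⟨⟨h1, h2.trans hst⟩, h3⟩, h2⟩
  · rintro ⟨⟨⟨h1, _⟩, h3⟩, h2⟩
    exact ⟨⟨h1, h2⟩, h3⟩

/-- The default value of an infinite `∏ᶠ` never occurs: away from the finitely many jump times the
exponent is 0, and at them it is 1. -/
lemma finprod_pow_jump (f : ℝ≥0 → ℝ) (t : ℝ≥0) :
    ∏ᶠ u ∈ Ioc 0 t, f u ^ jump y u = ∏ u ∈ jumpTimes y t, f u := by
  rw [finprod_mem_eq_prod_of_inter_mulSupport_eq (t := jumpTimes y t)]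
  · refine Finset.prod_congr rfl fun u hu => ?_
    rw [jump_eq_one y ((mem_jumpTimes y).1 hu).2, pow_one]
  · ext u
    simp only [mem_inter_iff, Function.mem_mulSupport, Finset.mem_coe, mem_jumpTimes, mem_Ioc]
    constructor
    · rintro ⟨h, h'⟩
      refine ⟨⟨h, fun h0 => h' (by simp [h0])⟩, h'⟩
    · rintro ⟨⟨h, _⟩, h'⟩
      exact ⟨h, h'⟩

lemma finsum_jump_smul {E : Type*} [AddCommGroup E] [Module ℝ E] (f : ℝ≥0 → E) (t : ℝ≥0) :
    ∑ᶠ u ∈ Ioc 0 t, (jump y u : ℝ) • f u = ∑ u ∈ jumpTimes y t, f u := by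
  rw [finsum_mem_eq_sum_of_inter_support_eq (t := jumpTimes y t)]
  · refine Finset.sum_congr rfl fun u hu => ?_
    rw [jump_eq_one y ((mem_jumpTimes y).1 hu).2, Nat.cast_one, one_smul]
  · ext u
    simp only [mem_inter_iff, Function.mem_support, Finset.mem_coe, mem_jumpTimes, mem_Ioc]
    constructor
    · rintro ⟨h, h'⟩
      refine ⟨⟨h, fun h0 => h' (by simp [h0])⟩, h'⟩
    · rintro ⟨⟨h, _⟩, h'⟩
      exact ⟨h, h'⟩

/-- The time at which a counting path reaches the level `n`. -/
def hit (n : ℕ) : ℝ≥0 := sInf {s | n ≤ y.1 s}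

/-- The infimum is attained because an integer-valued right-continuous path is constant for a while
to the right of every time. -/
lemma le_apply_hit {n : ℕ} (h : ∃ s, n ≤ y.1 s) : n ≤ y.1 (hit y n) := by
  have hc := y.2.2.2.1 (hit y n)
  have hev : ∀ᶠ s in 𝓝[≥] (hit y n), y.1 s = y.1 (hit y n) :=
    hc.tendsto.eventually (p := fun k => k = y.1 (hit y n)) (by simp)
  obtain ⟨c, hc1, hc2⟩ := (mem_nhdsGE_iff_exists_Ico_subset' (lt_add_one (hit y n))).1 hev
  obtain ⟨s, hs, hsc⟩ := exists_lt_of_csInf_lt (s := {s | n ≤ y.1 s}) h (show hit y n < c from hc1)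
  have hle : hit y n ≤ s := csInf_le (OrderBot.bddBelow _) hs
  have : y.1 s = y.1 (hit y n) := hc2 ⟨hle, hsc⟩
  rw [← this]
  exact hs

lemma hit_le_iff {n : ℕ} (h : ∃ s, n ≤ y.1 s) (t : ℝ≥0) : hit y n ≤ t ↔ n ≤ y.1 t :=
  ⟨fun ht => (le_apply_hit y h).trans (y.2.2.1 ht), fun ht => csInf_le (OrderBot.bddBelow _) ht⟩

lemma hit_spec {n : ℕ} {t : ℝ≥0} (h : n + 1 ≤ y.1 t) :
    hit y (n + 1) ∈ jumpTimes y t ∧ y.1 (hit y (n + 1)) = n + 1 := by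
  have hex : ∃ s, n + 1 ≤ y.1 s := ⟨t, h⟩
  have h1 := le_apply_hit y hex
  have hpos : 0 < hit y (n + 1) := by
    rw [pos_iff_ne_zero]
    intro h0
    rw [h0, y.2.1] at h1
    omega
  have hlt : Function.leftLim y.1 (hit y (n + 1)) ≤ n := by
    have := nhdsLT_neBot_time hpos
    refine le_of_tendsto (y.2.2.1.tendsto_leftLim _) ?_
    filter_upwards [self_mem_nhdsWithin] with s hs
    by_contra hcon
    exact absurd ((hit_le_iff y hex s).2 (by omega)) (not_le.2 hs)
  have h2 := y.2.2.2.2 (hit y (n + 1))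
  refine ⟨(mem_jumpTimes y).2 ⟨⟨hpos, (hit_le_iff y hex t).2 h⟩, ?_⟩, by omega⟩
  rw [jump_ne_zero_iff]
  omega

lemma hit_apply {u t : ℝ≥0} (h : u ∈ jumpTimes y t) : 1 ≤ y.1 u ∧ hit y (y.1 u) = u := by
  have h1 := (jump_ne_zero_iff y u).1 ((mem_jumpTimes y).1 h).2
  refine ⟨by omega, ?_⟩
  have hle : hit y (y.1 u) ≤ u := (hit_le_iff y ⟨u, le_rfl⟩ u).2 le_rfl
  rcases eq_or_lt_of_le hle with h2 | h2
  · exact h2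
  · have h3 := y.2.2.1.le_leftLim h2
    have h4 := le_apply_hit y ⟨u, le_refl (y.1 u)⟩
    omega

/-- Indexing the jumps by the level reached replaces a path-dependent set of times by a range of
integers; with `measurable_hit` this makes the product measurable in the path. -/
lemma prod_jumpTimes (f : ℝ≥0 → ℝ) (t : ℝ≥0) :
    ∏ u ∈ jumpTimes y t, f u = ∏ n ∈ Finset.range (y.1 t), f (hit y (n + 1)) := by
  refine Finset.prod_nbij' (fun u => y.1 u - 1) (fun n => hit y (n + 1)) ?_ ?_ ?_ ?_ ?_
  · intro u hu
    have := (hit_apply y hu).1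
    have := y.2.2.1 ((mem_jumpTimes y).1 hu).1.2
    simp only [Finset.mem_range]
    omega
  · intro n hn
    exact (hit_spec y (by simpa using hn)).1
  · intro u hu
    have h := hit_apply y hu
    simp only [Nat.sub_add_cancel h.1, h.2]
  · intro n hn
    simp [(hit_spec y (show n + 1 ≤ y.1 t by simpa using hn)).2]
  · intro u hu
    have h := hit_apply y hu
    simp only [Nat.sub_add_cancel h.1, h.2]

lemma measurable_apply (t : ℝ≥0) : Measurable (fun y : CountingPath => y.1 t) :=
  (measurable_pi_apply t).comp measurable_subtype_coe

lemma measurable_uncurry : Measurable (fun p : ℝ≥0 × CountingPath => p.2.1 p.1) :=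
  measurable_uncurry_of_rightCont (x := fun t (y : CountingPath) => y.1 t) measurable_apply
    fun y t => y.2.2.2.1 t

/-- For a path that never reaches the level `n`, the infimum of the empty set is `0`. Such paths
form the second set of the union below, natural times being enough by monotonicity. -/
lemma measurable_hit (n : ℕ) : Measurable (fun y : CountingPath => hit y n) := by
  refine measurable_of_Iic fun c => ?_
  have : (fun y : CountingPath => hit y n) ⁻¹' Iic c =
      {y : CountingPath | n ≤ y.1 c} ∪ ⋂ k : ℕ, {y : CountingPath | y.1 (k : ℝ≥0) < n} := by
    ext y
    simp only [mem_preimage, mem_Iic, mem_union, mem_ofPred_eq, mem_iInter]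
    by_cases h : ∃ s, n ≤ y.1 s
    · rw [hit_le_iff y h]
      refine ⟨Or.inl, fun h' => h'.elim id fun h' => ?_⟩
      obtain ⟨s, hs⟩ := h
      obtain ⟨k, hk⟩ := exists_nat_ge s
      exact absurd (hs.trans (y.2.2.1 hk)) (not_le.2 (h' k))
    · push Not at h
      have h0 : hit y n = 0 := by
        have : {s | n ≤ y.1 s} = ∅ := by ext s; simp [h s]
        rw [hit, this]; simp
      simp [h0, h]
  rw [this]
  refine MeasurableSet.union (measurableSet_le measurable_const (measurable_apply c))
    (MeasurableSet.iInter fun k => measurableSet_lt (measurable_apply _) measurable_const)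

end CountingPath

lemma StatePath.measurable_apply {N : ℕ} (t : ℝ≥0) :
    Measurable (fun x : StatePath N => x.1 t) :=
  (measurable_pi_apply t).comp measurable_subtype_coe

lemma StatePath.measurable_uncurry {N : ℕ} :
    Measurable (fun p : ℝ≥0 × StatePath N => p.2.1 p.1) :=
  measurable_uncurry_of_rightCont (x := fun t (x : StatePath N) => x.1 t)
    StatePath.measurable_apply fun x t => x.2.1 t

lemma StatePath.measurable_uncurry_leftLim {N : ℕ} :
    Measurable (fun p : ℝ≥0 × StatePath N => Function.leftLim p.2.1 p.1) :=
  SelfExcitingHMM.measurable_uncurry_leftLim (x := fun t (x : StatePath N) => x.1 t)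
    StatePath.measurable_apply fun x => x.2

/-! ### Stopped paths -/

section Stop

variable {E : Type*} [MeasurableSpace E] {p : (ℝ≥0 → E) → Prop}

/-- Stopping a path at time `t`. -/
def stopPath (hp : ∀ x t, p x → p (fun s => x (min s t))) (t : ℝ≥0) (x : {x : ℝ≥0 → E // p x}) :
    {x : ℝ≥0 → E // p x} :=
  ⟨fun s => x.1 (min s t), hp x.1 t x.2⟩

lemma measurable_stopPath (hp : ∀ x t, p x → p (fun s => x (min s t))) (t : ℝ≥0) :
    Measurable[pathFiltration p t] (stopPath hp t) := by
  refine @Measurable.subtype_mk _ _ (pathFiltration p t) _ p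
    (fun x : {x : ℝ≥0 → E // p x} => fun s => x.1 (min s t)) ?_ (fun x => hp x.1 t x.2)
  refine (@measurable_pi_iff _ _ _ (pathFiltration p t) _ _).2 fun s => ?_
  refine Measurable.mono (comap_measurable (fun x : {x : ℝ≥0 → E // p x} => x.1 (min s t)))
    ?_ le_rfl
  exact le_iSup (fun u : Iic t => MeasurableSpace.comap
    (fun x : {x : ℝ≥0 → E // p x} => x.1 u.1) inferInstance) ⟨min s t, mem_Iic.2 (min_le_right _ _)⟩

/-- Together with `measurable_stopPath` this says that the past up to `t` is generated by the
stopping map, so measurability with respect to the past can be tested by invariance under stopping.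
-/
lemma pathFiltration_le_comap_stopPath (hp : ∀ x t, p x → p (fun s => x (min s t))) (t : ℝ≥0) :
    (pathFiltration p t : MeasurableSpace {x : ℝ≥0 → E // p x}) ≤
      MeasurableSpace.comap (stopPath hp t) inferInstance := by
  refine iSup_le fun u => ?_
  have : (fun x : {x : ℝ≥0 → E // p x} => x.1 u.1) =
      (fun x : {x : ℝ≥0 → E // p x} => x.1 u.1) ∘ stopPath hp t := by
    ext x
    have : min u.1 t = u.1 := min_eq_left u.2
    simp [stopPath, this]
  rw [this, ← MeasurableSpace.comap_comp]
  exact MeasurableSpace.comap_mono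
    ((measurable_pi_apply u.1).comp measurable_subtype_coe).comap_le

lemma mem_iff_of_eqOn (hp : ∀ x t, p x → p (fun s => x (min s t))) {t : ℝ≥0}
    {A : Set {x : ℝ≥0 → E // p x}} (hA : MeasurableSet[pathFiltration p t] A)
    {x x' : {x : ℝ≥0 → E // p x}} (h : ∀ s ≤ t, x.1 s = x'.1 s) : x ∈ A ↔ x' ∈ A := by
  obtain ⟨B, _, rfl⟩ := pathFiltration_le_comap_stopPath hp t A hA
  have : stopPath hp t x = stopPath hp t x' :=
    Subtype.ext (funext fun s => h _ (min_le_right _ _))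
  rw [mem_preimage, mem_preimage, this]

end Stop

lemma IsCadlag.comp_min {E : Type*} [TopologicalSpace E] (x : ℝ≥0 → E) (t : ℝ≥0)
    (h : IsCadlag x) : IsCadlag (fun s => x (min s t)) :=
  (h.isCadlagOn t).stopped

lemma IsCountingPath.comp_min (y : ℝ≥0 → ℕ) (t : ℝ≥0) (h : IsCountingPath y) :
    IsCountingPath (fun s => y (min s t)) := by
  have hc : IsCadlag y := CountingPath.isCadlag ⟨y, h⟩
  have hm : Monotone (fun s => y (min s t)) := fun a b hab => h.2.1 (min_le_min_right t hab)
  refine ⟨by simp [h.1], hm, (hc.comp_min y t).1, fun s => ?_⟩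
  rcases eq_or_lt_of_le (zero_le (a := s)) with rfl | hs
  · rw [leftLim_eq_of_eq_bot _ nhdsLT_zero_time]
    exact Nat.le_succ _
  rcases le_or_gt s t with hst | hst
  · rw [← leftLim_congr_time hs (hc.2 s) (x' := fun s => y (min s t)) fun u hu => by
      rw [min_eq_left (hu.le.trans hst)]]
    simpa [hst] using h.2.2.2 s
  · have := hm.le_leftLim hst
    simp only [min_self] at this
    simp only [min_eq_right hst.le]
    omega

/-- Predictable functions depend on the path only through its past. -/
lemma eq_of_isStronglyPredictable {f : ℝ≥0 → CountingPath → ℝ}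
    (hf : IsStronglyPredictable (pathFiltration IsCountingPath) f) {u : ℝ≥0} {y y' : CountingPath}
    (h : ∀ s ≤ u, y.1 s = y'.1 s) : f u y = f u y' := by
  -- The sets that contain both or neither of the points `(u, y)` and `(u, y')` form a σ-algebra. It
  -- contains the generating rectangles, since `]a, ∞[ × A` meets time `u` only if `a < u`, and then
  -- `A` sees the paths only up to `a`.
  have key : ∀ S : Set (ℝ≥0 × CountingPath),
      MeasurableSet[(pathFiltration IsCountingPath).predictable] S →
      ((u, y) ∈ S ↔ (u, y') ∈ S) := by
    intro S hS
    induction S, hS using MeasurableSpace.generateFrom_induction with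
    | hC S hS _ =>
      rcases hS with ⟨A, hA, rfl⟩ | ⟨a, A, hA, rfl⟩
      · simp only [mem_prod, mem_singleton_iff]
        refine and_congr_right fun hu => mem_iff_of_eqOn IsCountingPath.comp_min hA fun s hs => ?_
        exact h s (hs.trans bot_le)
      · simp only [mem_prod, mem_Ioi]
        refine and_congr_right fun hu => mem_iff_of_eqOn IsCountingPath.comp_min hA fun s hs => ?_
        exact h s (hs.trans hu.le)
    | empty => simp
    | compl S _ ih => simpa using not_congr ih
    | iUnion S _ ih => simp only [mem_iUnion]; exact exists_congr ih
  have hm := hf.measurable (measurableSet_singleton (f u y))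
  have := (key _ hm).1 rfl
  exact (this : f u y' = f u y).symm

lemma measurable_uncurry_of_isStronglyPredictable {f : ℝ≥0 → CountingPath → ℝ}
    (hf : IsStronglyPredictable (pathFiltration IsCountingPath) f) :
    Measurable (Function.uncurry f) := by
  refine hf.measurable.mono ?_ le_rfl
  refine measurableSpace_le_predictable_of_measurableSet (fun A hA => ?_) fun i A hA => ?_
  · exact (measurableSet_singleton _).prod ((pathFiltration IsCountingPath).le _ _ hA)
  · exact measurableSet_Ioi.prod ((pathFiltration IsCountingPath).le _ _ hA)

/-! ### The likelihood as a functional of the two paths -/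

section PathLikelihood

variable {N : ℕ} {lam : Fin N → ℝ≥0 → CountingPath → ℝ} {T : ℝ≥0} {y : CountingPath}

/-- The intensity `λ(x_{u-}, u, y)`. -/
def rate (lam : Fin N → ℝ≥0 → CountingPath → ℝ) (x : StatePath N) (y : CountingPath) (u : ℝ≥0) :
    ℝ :=
  lam (Function.leftLim x.1 u) u y

/-- The likelihood process as a functional of the state path and the observation path. -/
def pathLikelihood (lam : Fin N → ℝ≥0 → CountingPath → ℝ) (x : StatePath N) (y : CountingPath)
    (t : ℝ≥0) : ℝ :=
  Real.exp (-∫ u in Ioc 0 t, (rate lam x y u - 1)) * ∏ u ∈ y.jumpTimes t, rate lam x y u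

lemma likelihood_eq {Ω : Type*} (X : Ω → StatePath N) (Y : Ω → CountingPath) (t : ℝ≥0) (ω : Ω) :
    likelihood lam X Y t ω = pathLikelihood lam (X ω) (Y ω) t := by
  rw [likelihood, CountingPath.finprod_pow_jump]
  rfl

/-- The constant path in state `i`. -/
def constPath (i : Fin N) : StatePath N :=
  ⟨fun _ => i, fun _ => continuousWithinAt_const, fun _ => ⟨i, tendsto_const_nhds⟩⟩

@[simp] lemma rate_constPath (i : Fin N) (u : ℝ≥0) : rate lam (constPath i) y u = lam i u y := by
  unfold rate constPath
  rw [leftLim_const_time]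

/-- The diagonal entries of `Γ`. -/
def gam (lam : Fin N → ℝ≥0 → CountingPath → ℝ) (y : CountingPath) (t : ℝ≥0) (i : Fin N) : ℝ :=
  pathLikelihood lam (constPath i) y t

lemma Gam_eq (t : ℝ≥0) : Gam lam y t = Matrix.diagonal (gam lam y t) := by
  unfold Gam
  congr 1
  ext i
  rw [CountingPath.finprod_pow_jump, gam, pathLikelihood]
  simp

/-- The intensities along `y` are integrable on `]0, T]`. -/
def IsGood (lam : Fin N → ℝ≥0 → CountingPath → ℝ) (T : ℝ≥0) (y : CountingPath) : Prop :=
  ∀ i, IntegrableOn (fun s => lam i s y) (Ioc 0 T)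

lemma IsIntensity.rate_pos (hlam : IsIntensity lam) (x : StatePath N) (u : ℝ≥0) :
    0 < rate lam x y u := hlam.pos _ _ _

lemma IsIntensity.measurable_uncurry (hlam : IsIntensity lam) (i : Fin N) :
    Measurable (fun p : ℝ≥0 × CountingPath => lam i p.1 p.2) :=
  measurable_uncurry_of_isStronglyPredictable (hlam.predictable i)

lemma IsIntensity.measurable_rate (hlam : IsIntensity lam) :
    Measurable (fun p : ℝ≥0 × StatePath N × CountingPath => rate lam p.2.1 p.2.2 p.1) := by
  have h1 : Measurable (fun q : Fin N × ℝ≥0 × CountingPath => lam q.1 q.2.1 q.2.2) :=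
    measurable_from_prod_countable_right fun i => hlam.measurable_uncurry i
  have h2 : Measurable (fun p : ℝ≥0 × StatePath N × CountingPath =>
      (Function.leftLim p.2.1.1 p.1, p.1, p.2.2)) :=
    (StatePath.measurable_uncurry_leftLim.comp
      (measurable_fst.prodMk measurable_snd.fst)).prodMk (measurable_fst.prodMk measurable_snd.snd)
  exact h1.comp h2

lemma IsIntensity.measurable_rate_time (hlam : IsIntensity lam) (x : StatePath N)
    (y : CountingPath) : Measurable (rate lam x y) :=
  hlam.measurable_rate.comp (measurable_id.prodMk (measurable_const (a := (x, y))))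

lemma rate_le_sum (hlam : IsIntensity lam) (x : StatePath N) (u : ℝ≥0) :
    rate lam x y u ≤ ∑ j, lam j u y :=
  Finset.single_le_sum (f := fun j => lam j u y) (fun j _ => (hlam.pos j u y).le)
    (Finset.mem_univ _)

lemma IsGood.integrableOn_sum (hy : IsGood lam T y) :
    IntegrableOn (fun u => ∑ j, lam j u y) (Ioc 0 T) :=
  integrable_finsetSum _ fun j _ => hy j

lemma IsGood.integrableOn_rate (hlam : IsIntensity lam) (hy : IsGood lam T y) (x : StatePath N) :
    IntegrableOn (rate lam x y) (Ioc 0 T) := by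
  refine Integrable.mono' hy.integrableOn_sum
    (hlam.measurable_rate_time x y).aestronglyMeasurable (ae_of_all _ fun u => ?_)
  rw [Real.norm_eq_abs, abs_of_pos (hlam.rate_pos x u)]
  exact rate_le_sum hlam x u

lemma IsGood.integrableOn_rate_sub (hlam : IsIntensity lam) (hy : IsGood lam T y)
    (x : StatePath N) : IntegrableOn (fun u => rate lam x y u - 1) (Ioc 0 T) :=
  (hy.integrableOn_rate hlam x).sub (integrableOn_const_time 1 0 T)

lemma pathLikelihood_pos (hlam : IsIntensity lam) (x : StatePath N) (t : ℝ≥0) :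
    0 < pathLikelihood lam x y t :=
  mul_pos (Real.exp_pos _) (Finset.prod_pos fun u _ => hlam.rate_pos x u)

lemma gam_pos (hlam : IsIntensity lam) (t : ℝ≥0) (i : Fin N) : 0 < gam lam y t i :=
  pathLikelihood_pos hlam _ _

/-- The multiplicative increment of the likelihood. -/
lemma pathLikelihood_mul (hlam : IsIntensity lam) (hy : IsGood lam T y) (x : StatePath N)
    {s t : ℝ≥0} (hst : s ≤ t) (ht : t ≤ T) :
    pathLikelihood lam x y t = pathLikelihood lam x y s *
      (Real.exp (-∫ u in Ioc s t, (rate lam x y u - 1)) *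
        ∏ u ∈ (y.jumpTimes t).filter (s < ·), rate lam x y u) := by
  unfold pathLikelihood
  rw [setIntegral_Ioc_add (zero_le (a := s)) hst
    (integrableOn_Ioc_mono (hy.integrableOn_rate_sub hlam x) le_rfl ht), neg_add, Real.exp_add,
    y.jumpTimes_eq_filter hst,
    ← Finset.prod_filter_mul_prod_filter_not (y.jumpTimes t) (· ≤ s)]
  simp only [not_le]
  ring

/-- The rate at `u` reads the state just before `u`; therefore the state has to be known from `s`
on, while `u = s` itself is excluded. -/
lemma rate_eq_of_forall_eq {x : StatePath N} {i : Fin N} {s t : ℝ≥0}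
    (h : ∀ u ∈ Icc s t, x.1 u = i) {u : ℝ≥0} (hu : u ∈ Ioc s t) :
    rate lam x y u = lam i u y := by
  unfold rate
  congr 1
  have hu0 : 0 < u := (zero_le (a := s)).trans_lt hu.1
  refine leftLim_eq_time hu0 ((tendsto_const_nhds (x := i)).congr' ?_)
  filter_upwards [Ioo_mem_nhdsLT hu.1] with v hv
  exact (h v ⟨hv.1.le, hv.2.le.trans hu.2⟩).symm

/-- While the state stays in `i`, likelihood and `Γ_i` are proportional. -/
lemma ratio_eq_of_forall_eq (hlam : IsIntensity lam) (hy : IsGood lam T y) {x : StatePath N}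
    {i : Fin N} {s t : ℝ≥0} (hst : s ≤ t) (ht : t ≤ T) (h : ∀ u ∈ Icc s t, x.1 u = i) :
    pathLikelihood lam x y t / gam lam y t i = pathLikelihood lam x y s / gam lam y s i := by
  have e : Real.exp (-∫ u in Ioc s t, (rate lam x y u - 1)) *
        ∏ u ∈ (y.jumpTimes t).filter (s < ·), rate lam x y u =
      Real.exp (-∫ u in Ioc s t, (rate lam (constPath i) y u - 1)) *
        ∏ u ∈ (y.jumpTimes t).filter (s < ·), rate lam (constPath i) y u := by
    congr 1
    · congr 2
      refine setIntegral_congr_fun measurableSet_Ioc fun u hu => ?_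
      simp only [rate_constPath, rate_eq_of_forall_eq h hu]
    · refine Finset.prod_congr rfl fun u hu => ?_
      rw [Finset.mem_filter, CountingPath.mem_jumpTimes] at hu
      rw [rate_constPath, rate_eq_of_forall_eq h ⟨hu.2, hu.1.1.2⟩]
  have hp : 0 < Real.exp (-∫ u in Ioc s t, (rate lam (constPath i) y u - 1)) *
        ∏ u ∈ (y.jumpTimes t).filter (s < ·), rate lam (constPath i) y u :=
    mul_pos (Real.exp_pos _) (Finset.prod_pos fun u _ => hlam.rate_pos _ u)
  unfold gam
  rw [pathLikelihood_mul hlam hy x hst ht, pathLikelihood_mul hlam hy (constPath i) hst ht, e,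
    mul_div_mul_right _ _ hp.ne']

lemma pathLikelihood_mul_of_forall_notMem (hlam : IsIntensity lam) (hy : IsGood lam T y)
    (x : StatePath N) {s t : ℝ≥0} (hst : s ≤ t) (ht : t ≤ T)
    (hJ : ∀ u ∈ y.jumpTimes T, u ∉ Ioc s t) :
    pathLikelihood lam x y t = pathLikelihood lam x y s *
      Real.exp (-∫ u in Ioc s t, (rate lam x y u - 1)) := by
  have : (y.jumpTimes t).filter (s < ·) = ∅ := by
    rw [Finset.filter_eq_empty_iff]
    intro u hu hsu
    rw [y.jumpTimes_eq_filter ht, Finset.mem_filter] at hu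
    exact hJ u hu.1 ⟨hsu, hu.2⟩
  rw [pathLikelihood_mul hlam hy x hst ht, this, Finset.prod_empty, mul_one]

/-- The likelihood is bounded away from zero and infinity, uniformly over all state paths. -/
lemma exists_pathLikelihood_bounds (hlam : IsIntensity lam) (hy : IsGood lam T y) :
    ∃ c C : ℝ, 0 < c ∧ 0 < C ∧ ∀ (x : StatePath N) (t : ℝ≥0), t ≤ T →
      c ≤ pathLikelihood lam x y t ∧ pathLikelihood lam x y t ≤ C := by
  set J := y.jumpTimes T
  set K := ∫ u in Ioc 0 T, ∑ j, lam j u y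
  -- `hi` and `lo` bound the intensities of all states at once. The added 1 makes `hi ≥ 1` and `lo ≤
  -- 1`, so that the products over the jumps up to `t` can be compared with those over all jumps up
  -- to `T`.
  set hi : ℝ≥0 → ℝ := fun u => 1 + ∑ j, lam j u y
  set lo : ℝ≥0 → ℝ := fun u => (1 + ∑ j, (lam j u y)⁻¹)⁻¹
  have hs1 : ∀ u, 0 ≤ ∑ j, lam j u y := fun u =>
    Finset.sum_nonneg fun j _ => (hlam.pos j u y).le
  have hs2 : ∀ u, 0 ≤ ∑ j, (lam j u y)⁻¹ := fun u =>
    Finset.sum_nonneg fun j _ => (inv_pos.2 (hlam.pos j u y)).le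
  have hhi1 : ∀ u, 1 ≤ hi u := fun u => by simp only [hi]; linarith [hs1 u]
  have hlo0 : ∀ u, 0 < lo u := fun u => inv_pos.2 (by linarith [hs2 u])
  have hlo1 : ∀ u, lo u ≤ 1 := fun u => inv_le_one_of_one_le₀ (by linarith [hs2 u])
  have hrhi : ∀ x u, rate lam x y u ≤ hi u := fun x u => by
    simp only [hi]
    linarith [rate_le_sum (y := y) hlam x u]
  have hrlo : ∀ x u, lo u ≤ rate lam x y u := fun x u => by
    have h1 : (rate lam x y u)⁻¹ ≤ ∑ j, (lam j u y)⁻¹ :=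
      Finset.single_le_sum (f := fun j => (lam j u y)⁻¹)
        (fun j _ => (inv_pos.2 (hlam.pos j u y)).le) (Finset.mem_univ _)
    rw [← inv_inv (rate lam x y u)]
    exact inv_anti₀ (inv_pos.2 (hlam.rate_pos x u)) (by linarith)
  -- The exponent `t - ∫ rate` lies between `-K` and `T`.
  refine ⟨Real.exp (-K) * ∏ u ∈ J, lo u, Real.exp T * ∏ u ∈ J, hi u,
    mul_pos (Real.exp_pos _) (Finset.prod_pos fun u _ => hlo0 u),
    mul_pos (Real.exp_pos _) (Finset.prod_pos fun u _ => zero_lt_one.trans_le (hhi1 u)),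
    fun x t ht => ?_⟩
  have hsub : y.jumpTimes t ⊆ J := by
    rw [y.jumpTimes_eq_filter ht]
    exact Finset.filter_subset _ _
  have hint : ∫ u in Ioc 0 t, (rate lam x y u - 1) = (∫ u in Ioc 0 t, rate lam x y u) - t := by
    rw [integral_sub (integrableOn_Ioc_mono (hy.integrableOn_rate hlam x) le_rfl ht)
      (integrableOn_const_time 1 0 t)]
    simp [measureReal_def, volume_Ioc_time]
  have h0 : 0 ≤ ∫ u in Ioc 0 t, rate lam x y u :=
    integral_nonneg fun u => (hlam.rate_pos x u).le
  have hK : ∫ u in Ioc 0 t, rate lam x y u ≤ K := by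
    refine (integral_mono (integrableOn_Ioc_mono (hy.integrableOn_rate hlam x) le_rfl ht)
      (integrableOn_Ioc_mono hy.integrableOn_sum le_rfl ht)
      fun u => rate_le_sum hlam x u).trans ?_
    exact setIntegral_mono_set hy.integrableOn_sum (ae_of_all _ hs1)
      (Ioc_subset_Ioc le_rfl ht).eventuallyLE
  have htT : (t : ℝ) ≤ T := by exact_mod_cast ht
  have ht0 : (0 : ℝ) ≤ t := t.2
  constructor
  · refine mul_le_mul (Real.exp_le_exp.2 (by rw [hint]; linarith)) ?_
      (Finset.prod_nonneg fun u _ => (hlo0 u).le) (Real.exp_pos _).le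
    refine (Finset.prod_le_prod_of_subset_of_le_one hsub (fun u _ => (hlo0 u).le)
      fun u _ _ => hlo1 u).trans ?_
    exact Finset.prod_le_prod (fun u _ => (hlo0 u).le) fun u _ => hrlo x u
  · refine mul_le_mul (Real.exp_le_exp.2 (by rw [hint]; linarith)) ?_
      (Finset.prod_nonneg fun u _ => (hlam.rate_pos x u).le) (Real.exp_pos _).le
    refine (Finset.prod_le_prod (fun u _ => (hlam.rate_pos x u).le) fun u _ => hrhi x u).trans ?_
    exact Finset.prod_le_prod_of_subset_of_one_le hsub
      (fun u _ => (zero_lt_one.trans_le (hhi1 u)).le) fun u _ _ => hhi1 u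

lemma exists_ratio_bound (hlam : IsIntensity lam) (hy : IsGood lam T y) :
    ∃ C : ℝ, 0 < C ∧ ∀ (x : StatePath N) (t : ℝ≥0) (i : Fin N), t ≤ T →
      |pathLikelihood lam x y t / gam lam y t i| ≤ C := by
  obtain ⟨c, C, hc, hC, h⟩ := exists_pathLikelihood_bounds hlam hy
  refine ⟨C / c, div_pos hC hc, fun x t i ht => ?_⟩
  rw [abs_of_pos (div_pos (pathLikelihood_pos hlam x t) (gam_pos hlam t i))]
  exact div_le_div₀ hC.le (h x t ht).2 hc (h (constPath i) t ht).1

/-- Between the observed jumps, the ratio of likelihood and `Γ_i` changes continuously, uniformly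
over all state paths. -/
lemma exists_ratio_sub_le (hlam : IsIntensity lam) (hy : IsGood lam T y) :
    ∃ C : ℝ, 0 < C ∧ ∀ (x : StatePath N) (s t : ℝ≥0) (i : Fin N), s ≤ t → t ≤ T →
      (∀ u ∈ y.jumpTimes T, u ∉ Ioc s t) →
      |pathLikelihood lam x y t / gam lam y t i - pathLikelihood lam x y s / gam lam y s i| ≤
        C * ∫ u in Ioc s t, ∑ j, lam j u y := by
  obtain ⟨C, hC, hbd⟩ := exists_ratio_bound hlam hy
  set K := ∫ u in Ioc 0 T, ∑ j, lam j u y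
  refine ⟨C * Real.exp K, mul_pos hC (Real.exp_pos _), fun x s t i hst ht hJ => ?_⟩
  have hs1 : ∀ u, 0 ≤ ∑ j, lam j u y := fun u =>
    Finset.sum_nonneg fun j _ => (hlam.pos j u y).le
  set z := ∫ u in Ioc s t, (lam i u y - rate lam x y u) with hz
  set k := ∫ u in Ioc s t, ∑ j, lam j u y with hk
  have hi1 := integrableOn_Ioc_mono (hy.integrableOn_rate_sub hlam x) (zero_le (a := s)) ht
  have hi2 := integrableOn_Ioc_mono (hy.integrableOn_rate_sub hlam (constPath i))
    (zero_le (a := s)) ht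
  have hzk : |z| ≤ k := by
    rw [hz, ← Real.norm_eq_abs]
    refine norm_integral_le_of_norm_le
      (integrableOn_Ioc_mono hy.integrableOn_sum (zero_le (a := s)) ht) (ae_of_all _ fun u => ?_)
    rw [Real.norm_eq_abs, abs_le]
    have h1 := rate_le_sum (y := y) hlam x u
    have h2 := rate_le_sum (y := y) hlam (constPath i) u
    have h3 := hlam.rate_pos (y := y) x u
    have h4 := hlam.pos i u y
    rw [rate_constPath] at h2
    constructor <;> linarith
  have hkK : k ≤ K := setIntegral_mono_set hy.integrableOn_sum (ae_of_all _ hs1)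
      (Ioc_subset_Ioc (zero_le (a := s)) ht).eventuallyLE
  -- Without observed jumps in `]s, t]` only the exponentials change, and `z` is the difference of
  -- their exponents.
  have e : pathLikelihood lam x y t / gam lam y t i =
      pathLikelihood lam x y s / gam lam y s i * Real.exp z := by
    unfold gam
    rw [pathLikelihood_mul_of_forall_notMem hlam hy x hst ht hJ,
      pathLikelihood_mul_of_forall_notMem hlam hy (constPath i) hst ht hJ, mul_div_mul_comm,
      ← Real.exp_sub, neg_sub_neg, ← integral_sub hi2 hi1]
    congr 3
    ext u
    simp
  rw [e, show ∀ a b : ℝ, a * b - a = a * (b - 1) by intros; ring, abs_mul, mul_assoc]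
  refine mul_le_mul (hbd x s i (hst.trans ht)) ((abs_exp_sub_one_le_mul_exp z).trans ?_)
    (abs_nonneg _) hC.le
  rw [mul_comm]
  have : 0 ≤ k := (abs_nonneg _).trans hzk
  gcongr
  exact hzk.trans hkK

lemma measurable_prod_range {Z : Type*} [MeasurableSpace Z] {k : Z → ℕ} {F : ℕ → Z → ℝ}
    (hk : Measurable k) (hF : ∀ n, Measurable (F n)) :
    Measurable (fun z => ∏ n ∈ Finset.range (k z), F n z) := by
  have h1 : Measurable (fun q : ℕ × Z => ∏ n ∈ Finset.range q.1, F n q.2) :=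
    measurable_from_prod_countable_right fun m =>
      Finset.measurable_fun_prod (Finset.range m) fun n _ => hF n
  exact h1.comp (hk.prodMk measurable_id)

/-- Joint measurability of the likelihood in time and both paths. -/
lemma measurable_pathLikelihood (hlam : IsIntensity lam) :
    Measurable (fun p : ℝ≥0 × StatePath N × CountingPath => pathLikelihood lam p.2.1 p.2.2 p.1) := by
  unfold pathLikelihood
  refine Measurable.mul ?_ ?_
  · refine Real.measurable_exp.comp (Measurable.neg ?_)
    have hm : Measurable (fun q : (ℝ≥0 × StatePath N × CountingPath) × ℝ≥0 =>
        (Ioc 0 q.1.1).indicator (fun u => rate lam q.1.2.1 q.1.2.2 u - 1) q.2) := by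
      have hle : MeasurableSet {q : (ℝ≥0 × StatePath N × CountingPath) × ℝ≥0 | q.2 ≤ q.1.1} :=
        measurableSet_le measurable_snd (measurable_fst.comp measurable_fst)
      have hlt : MeasurableSet {q : (ℝ≥0 × StatePath N × CountingPath) × ℝ≥0 | 0 < q.2} :=
        measurableSet_lt measurable_const measurable_snd
      have hr : Measurable (fun q : (ℝ≥0 × StatePath N × CountingPath) × ℝ≥0 =>
          rate lam q.1.2.1 q.1.2.2 q.2 - 1) :=
        (hlam.measurable_rate.comp (measurable_snd.prodMk measurable_fst.snd)).sub_const 1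
      convert hr.indicator (hlt.inter hle) using 1
      ext q
      simp [indicator]
    have := hm.stronglyMeasurable.integral_prod_right' (ν := (volume : Measure ℝ≥0))
    simp only [integral_indicator measurableSet_Ioc] at this
    exact this.measurable
  · simp only [CountingPath.prod_jumpTimes]
    refine measurable_prod_range
      (CountingPath.measurable_uncurry.comp (measurable_fst.prodMk measurable_snd.snd)) fun n => ?_
    have h2 : Measurable (fun p : ℝ≥0 × StatePath N × CountingPath =>
        (p.2.2.hit (n + 1), p.2.1, p.2.2)) :=
      ((CountingPath.measurable_hit (n + 1)).comp measurable_snd.snd).prodMk measurable_snd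
    exact hlam.measurable_rate.comp h2

lemma measurable_gam (hlam : IsIntensity lam) (i : Fin N) :
    Measurable (fun p : ℝ≥0 × CountingPath => gam lam p.2 p.1 i) := by
  have h : Measurable (fun p : ℝ≥0 × CountingPath => (p.1, constPath (N := N) i, p.2)) :=
    measurable_fst.prodMk (measurable_const.prodMk measurable_snd)
  exact (measurable_pathLikelihood hlam).comp h

lemma measurable_gam_time (hlam : IsIntensity lam) (y : CountingPath) (i : Fin N) :
    Measurable (fun t => gam lam y t i) :=
  (measurable_gam hlam i).comp (measurable_id.prodMk measurable_const)

/-- The likelihood at time `t` depends only on the paths up to time `t`. -/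
lemma pathLikelihood_congr (hlam : IsIntensity lam) {x x' : StatePath N} {y y' : CountingPath}
    {t : ℝ≥0} (hx : ∀ s ≤ t, x.1 s = x'.1 s) (hy : ∀ s ≤ t, y.1 s = y'.1 s) :
    pathLikelihood lam x y t = pathLikelihood lam x' y' t := by
  have hr : ∀ u ∈ Ioc 0 t, rate lam x y u = rate lam x' y' u := fun u hu => by
    unfold rate
    rw [leftLim_congr_time hu.1 (x.2.2 u) (x' := x'.1) fun s hs => hx s (hs.le.trans hu.2)]
    exact eq_of_isStronglyPredictable (hlam.predictable _) fun s hs => hy s (hs.trans hu.2)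
  have hj : y.jumpTimes t = y'.jumpTimes t := by
    ext u
    simp only [CountingPath.mem_jumpTimes]
    refine and_congr_right fun hu => ?_
    rw [jump, jump, hy u hu.2,
      leftLim_congr_time hu.1 (y.isCadlag.2 u) (x' := y'.1) fun s hs => hy s (hs.le.trans hu.2)]
  unfold pathLikelihood
  rw [hj]
  congr 1
  · congr 2
    exact setIntegral_congr_fun measurableSet_Ioc fun u hu => by simp only [hr u hu]
  · refine Finset.prod_congr rfl fun u hu => hr u ?_
    exact ((CountingPath.mem_jumpTimes y').1 hu).1

/-- Stopping the observation. -/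
def stopObs (t : ℝ≥0) : CountingPath → CountingPath := stopPath IsCountingPath.comp_min t

/-- Stopping the state path. -/
def stopState (t : ℝ≥0) : StatePath N → StatePath N :=
  stopPath (fun x t => IsCadlag.comp_min x t) t

lemma stopObs_apply {s t : ℝ≥0} (h : s ≤ t) (y : CountingPath) : (stopObs t y).1 s = y.1 s := by
  change y.1 (min s t) = y.1 s
  rw [min_eq_left h]

lemma stopState_apply {s t : ℝ≥0} (h : s ≤ t) (x : StatePath N) :
    (stopState t x).1 s = x.1 s := by
  change x.1 (min s t) = x.1 s
  rw [min_eq_left h]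

end PathLikelihood

/-! ### Increments of the chain -/

section Chain

variable {Ω : Type*} {mΩ : MeasurableSpace Ω} {Q : Measure Ω} [IsProbabilityMeasure Q] {N : ℕ}
  {A : ℝ≥0 → Matrix (Fin N) (Fin N) ℝ} {X : Ω → StatePath N} {hX : Measurable X}
  {Y : Ω → CountingPath} {hY : Measurable Y}

lemma basisVec_apply (k i : Fin N) : basisVec k i = if i = k then 1 else 0 := by
  simp [basisVec, Pi.single_apply]

lemma basisVec_nonneg (k i : Fin N) : 0 ≤ basisVec k i := by
  rw [basisVec_apply]; split_ifs <;> norm_num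

lemma basisVec_le_one (k i : Fin N) : basisVec k i ≤ 1 := by
  rw [basisVec_apply]; split_ifs <;> norm_num

lemma abs_basisVec_le (k i : Fin N) : |basisVec k i| ≤ 1 := by
  rw [abs_of_nonneg (basisVec_nonneg k i)]
  exact basisVec_le_one k i

lemma measurable_basisVec_uncurry (hX : Measurable X) (i : Fin N) :
    Measurable (fun p : ℝ≥0 × Ω => basisVec ((X p.2).1 p.1) i) := by
  have h : Measurable (fun p : ℝ≥0 × Ω => (X p.2).1 p.1) :=
    StatePath.measurable_uncurry.comp (measurable_fst.prodMk (hX.comp measurable_snd))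
  exact (measurable_of_countable (fun k : Fin N => basisVec k i)).comp h

lemma measurable_basisVec (hX : Measurable X) (t : ℝ≥0) (i : Fin N) :
    Measurable (fun ω => basisVec ((X ω).1 t) i) :=
  (measurable_basisVec_uncurry hX i).comp (measurable_const.prodMk measurable_id)

lemma mulVec_basisVec (M : Matrix (Fin N) (Fin N) ℝ) (k i : Fin N) :
    (M *ᵥ basisVec k) i = ∑ j, M i j * basisVec k j := rfl

/-- The sum of the moduli of all rates. -/
def totalRate (A : ℝ≥0 → Matrix (Fin N) (Fin N) ℝ) (u : ℝ≥0) : ℝ := ∑ i, ∑ j, |A u i j|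

lemma totalRate_nonneg (u : ℝ≥0) : 0 ≤ totalRate A u :=
  Finset.sum_nonneg fun _ _ => Finset.sum_nonneg fun _ _ => abs_nonneg _

lemma sum_abs_le_totalRate (u : ℝ≥0) (i : Fin N) : ∑ j, |A u i j| ≤ totalRate A u :=
  Finset.single_le_sum (f := fun i => ∑ j, |A u i j|)
    (fun _ _ => Finset.sum_nonneg fun _ _ => abs_nonneg _) (Finset.mem_univ i)

lemma IsRateMatrix.integrableOn_Ioc (hA : IsRateMatrix A) (i j : Fin N) (s t : ℝ≥0) :
    IntegrableOn (fun u => A u i j) (Ioc s t) :=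
  integrableOn_Ioc_mono (hA.integrable i j t) zero_le le_rfl

lemma IsRateMatrix.integrableOn_totalRate (hA : IsRateMatrix A) (s t : ℝ≥0) :
    IntegrableOn (totalRate A) (Ioc s t) :=
  integrable_finsetSum _ fun i _ => integrable_finsetSum _ fun j _ =>
    (hA.integrableOn_Ioc i j s t).abs

lemma integrable_mul_of_bdd {Q : Measure Ω} {G H : Ω → ℝ} {c : ℝ} (hG : AEStronglyMeasurable G Q)
    (hGc : ∀ ω, |G ω| ≤ c) (hH : Integrable H Q) : Integrable (fun ω => G ω * H ω) Q :=
  hH.bdd_mul hG (ae_of_all _ hGc)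

lemma integrable_basisVec (hX : Measurable X) (t : ℝ≥0) (i : Fin N) :
    Integrable (fun ω => basisVec ((X ω).1 t) i) Q :=
  Integrable.of_bound (measurable_basisVec hX t i).aestronglyMeasurable 1
    (ae_of_all _ fun _ => abs_basisVec_le _ _)

lemma integrableOn_rate_basisVec (hA : IsRateMatrix A) (hX : Measurable X) (i j : Fin N)
    (s t : ℝ≥0) (ω : Ω) :
    IntegrableOn (fun u => A u i j * basisVec ((X ω).1 u) j) (Ioc s t) :=
  (hA.integrableOn_Ioc i j s t).mul_bdd (c := 1)
    ((measurable_basisVec_uncurry hX j).comp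
      (measurable_id.prodMk (measurable_const (a := ω)))).aestronglyMeasurable
    (ae_of_all _ fun _ => abs_basisVec_le _ _)

lemma chainNoise_sub_apply (hA : IsRateMatrix A) (hX : Measurable X) {s t : ℝ≥0} (hst : s ≤ t)
    (ω : Ω) (i : Fin N) :
    chainNoise A X t ω i - chainNoise A X s ω i =
      basisVec ((X ω).1 t) i - basisVec ((X ω).1 s) i -
        ∑ j, ∫ u in Ioc s t, A u i j * basisVec ((X ω).1 u) j := by
  have hint : ∀ (a b : ℝ≥0) (i : Fin N), IntegrableOn
      (fun u => (A u *ᵥ basisVec ((X ω).1 u)) i) (Ioc a b) := fun a b i => by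
    simp only [mulVec_basisVec]
    exact integrable_finsetSum _ fun j _ => integrableOn_rate_basisVec hA hX i j a b ω
  have e : ∀ t, (∫ u in Ioc 0 t, A u *ᵥ basisVec ((X ω).1 u)) i =
      ∫ u in Ioc 0 t, (A u *ᵥ basisVec ((X ω).1 u)) i := fun t =>
    eval_integral (hint 0 t) i
  have hs : ∑ j, ∫ u in Ioc s t, A u i j * basisVec ((X ω).1 u) j =
      ∫ u in Ioc s t, (A u *ᵥ basisVec ((X ω).1 u)) i := by
    simp only [mulVec_basisVec]
    rw [integral_finsetSum _ fun j _ => integrableOn_rate_basisVec hA hX i j s t ω]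
  simp only [chainNoise, Pi.sub_apply]
  rw [e, e, hs, setIntegral_Ioc_add (zero_le (a := s)) hst (hint 0 t i)]
  ring

/-- Increments of the chain, tested against the past. -/
lemma integral_mul_chain_sub (hA : IsRateMatrix A)
    (hM : Martingale (chainNoise A X) (fullFiltration X hX Y hY) Q)
    {s t : ℝ≥0} (hst : s ≤ t) {G : Ω → ℝ} {c : ℝ}
    (hG : StronglyMeasurable[fullFiltration X hX Y hY s] G) (hGc : ∀ ω, |G ω| ≤ c) (i : Fin N) :
    ∫ ω, G ω * (basisVec ((X ω).1 t) i - basisVec ((X ω).1 s) i) ∂Q =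
      ∑ j, ∫ u in Ioc s t, A u i j * ∫ ω, G ω * basisVec ((X ω).1 u) j ∂Q := by
  have hGm : AEStronglyMeasurable G Q :=
    (hG.mono ((fullFiltration X hX Y hY).le s)).aestronglyMeasurable
  have hGi : Integrable G Q := Integrable.of_bound hGm c (ae_of_all _ hGc)
  have hsm : ∀ t, Integrable (G • chainNoise A X t) Q := fun t =>
    (hM.integrable t).bdd_smul c hGm (ae_of_all _ hGc)
  have hce : Q[G • chainNoise A X t | fullFiltration X hX Y hY s] =ᵐ[Q] G • chainNoise A X s :=
    (condExp_smul_of_aestronglyMeasurable_left hG.aestronglyMeasurable (hsm t)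
      (hM.integrable t)).trans ((EventuallyEq.refl _ G).smul (hM.condExp_ae_eq hst))
  have h1 : ∫ ω, (G • chainNoise A X t) ω ∂Q = ∫ ω, (G • chainNoise A X s) ω ∂Q := by
    rw [← integral_condExp ((fullFiltration X hX Y hY).le s)]
    exact integral_congr_ae hce
  have hi : ∀ t i, Integrable (fun ω => (G • chainNoise A X t) ω i) Q := fun t i =>
    (hsm t).eval i
  have h2 : ∫ ω, G ω * (chainNoise A X t ω i - chainNoise A X s ω i) ∂Q = 0 := by
    have h3 := congrFun h1 i
    rw [eval_integral (hi t), eval_integral (hi s)] at h3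
    have h4 := integral_sub (hi t i) (hi s i)
    rw [h3, sub_self] at h4
    rw [← h4]
    congr 1
    ext ω
    simp [mul_sub]
  -- Integrability on the product space, from the bounds on `G` and the indicators and the local
  -- integrability of the rates, allows the time integral and the expectation to be exchanged.
  have hF : ∀ j, Integrable (Function.uncurry fun (ω : Ω) (u : ℝ≥0) =>
      A u i j * (G ω * basisVec ((X ω).1 u) j)) (Q.prod (volume.restrict (Ioc s t))) := fun j => by
    have h5 : Integrable (fun p : Ω × ℝ≥0 => G p.1 * A p.2 i j)
        (Q.prod (volume.restrict (Ioc s t))) := hGi.mul_prod (hA.integrableOn_Ioc i j s t)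
    have h6 := h5.mul_bdd (c := 1)
      ((measurable_basisVec_uncurry hX j).comp measurable_swap).aestronglyMeasurable
      (ae_of_all _ fun _ => abs_basisVec_le _ _)
    refine h6.congr (ae_of_all _ fun p => ?_)
    simp only [Function.uncurry, Function.comp, Prod.fst_swap, Prod.snd_swap]
    ring
  have hinner : ∀ (ω : Ω) (j : Fin N),
      ∫ u in Ioc s t, A u i j * (G ω * basisVec ((X ω).1 u) j) =
        G ω * ∫ u in Ioc s t, A u i j * basisVec ((X ω).1 u) j := fun ω j => by
    rw [← integral_const_mul]
    congr 1
    ext u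
    ring
  have hI : ∀ j, Integrable
      (fun ω => G ω * ∫ u in Ioc s t, A u i j * basisVec ((X ω).1 u) j) Q := fun j => by
    have := (hF j).integral_prod_left
    simpa only [Function.uncurry, hinner] using this
  have h7 : ∀ j, ∫ ω, G ω * ∫ u in Ioc s t, A u i j * basisVec ((X ω).1 u) j ∂volume ∂Q =
      ∫ u in Ioc s t, A u i j * ∫ ω, G ω * basisVec ((X ω).1 u) j ∂Q := fun j => by
    have h8 := integral_integral_swap (hF j)
    simp only [hinner, integral_const_mul] at h8
    exact h8
  have hdiff : Integrable
      (fun ω => G ω * (basisVec ((X ω).1 t) i - basisVec ((X ω).1 s) i)) Q :=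
    integrable_mul_of_bdd hGm hGc ((integrable_basisVec hX t i).sub (integrable_basisVec hX s i))
  simp only [chainNoise_sub_apply hA hX hst, mul_sub (G _) (_ - _), Finset.mul_sum] at h2
  rw [integral_sub hdiff (integrable_finsetSum _ fun j _ => hI j),
    integral_finsetSum _ fun j _ => hI j, sub_eq_zero] at h2
  rw [h2]
  exact Finset.sum_congr rfl fun j _ => h7 j

lemma measurable_basisVec_fullFiltration (hX : Measurable X) (t : ℝ≥0) (i : Fin N) :
    Measurable[fullFiltration X hX Y hY t] (fun ω => basisVec ((X ω).1 t) i) := by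
  have h1 : Measurable[pathFiltration IsCadlag t] (fun x : StatePath N => x.1 t) := by
    refine Measurable.mono (comap_measurable (fun x : StatePath N => x.1 t)) ?_ le_rfl
    exact le_iSup (fun u : Iic t => MeasurableSpace.comap
      (fun x : StatePath N => x.1 u.1) inferInstance) ⟨t, mem_Iic.2 le_rfl⟩
  have h2 : Measurable[fullFiltration X hX Y hY t, pathFiltration IsCadlag t] X :=
    (comap_measurable X).mono le_sup_right le_rfl
  exact (measurable_of_countable (fun k : Fin N => basisVec k i)).comp (h1.comp h2)

/-- The indicator of `X_t ≠ X_s` equals `∑ i, (1 - X_s^i) (X_t^i - X_s^i)`. This is a sum of chain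
increments with weights known at time `s`, to which `integral_mul_chain_sub` applies. -/
lemma measureReal_ne_le (hA : IsRateMatrix A)
    (hM : Martingale (chainNoise A X) (fullFiltration X hX Y hY) Q) {s t : ℝ≥0} (hst : s ≤ t) :
    Q.real {ω | (X ω).1 t ≠ (X ω).1 s} ≤ ∫ u in Ioc s t, totalRate A u := by
  set G : Fin N → Ω → ℝ := fun i ω => 1 - basisVec ((X ω).1 s) i with hGdef
  have hGm : ∀ i, Measurable[fullFiltration X hX Y hY s] (G i) := fun i =>
    (measurable_basisVec_fullFiltration hX s i).const_sub 1
  have hG1 : ∀ i ω, |G i ω| ≤ 1 := fun i ω => by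
    rw [abs_le]
    have := basisVec_nonneg ((X ω).1 s) i
    have := basisVec_le_one ((X ω).1 s) i
    constructor <;> simp only [hGdef] <;> linarith
  have hmeas : MeasurableSet {ω | (X ω).1 t ≠ (X ω).1 s} :=
    (measurableSet_eq_fun ((StatePath.measurable_apply t).comp hX)
      ((StatePath.measurable_apply s).comp hX)).compl
  have hind : ∀ ω, indicator {ω | (X ω).1 t ≠ (X ω).1 s} (fun _ => (1 : ℝ)) ω =
      ∑ i, G i ω * (basisVec ((X ω).1 t) i - basisVec ((X ω).1 s) i) := fun ω => by
    have e : ∀ i, G i ω * (basisVec ((X ω).1 t) i - basisVec ((X ω).1 s) i) =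
        (if i = (X ω).1 s then 0 else 1) * (if i = (X ω).1 t then 1 else 0) := fun i => by
      simp only [hGdef, basisVec_apply]
      split_ifs <;> simp
    simp only [e, mul_ite, mul_one, mul_zero, Finset.sum_ite_eq', Finset.mem_univ, if_true]
    by_cases h : (X ω).1 t = (X ω).1 s <;> simp [h]
  have hi : ∀ i, Integrable
      (fun ω => G i ω * (basisVec ((X ω).1 t) i - basisVec ((X ω).1 s) i)) Q := fun i =>
    integrable_mul_of_bdd
      ((hGm i).mono ((fullFiltration X hX Y hY).le s) le_rfl).aestronglyMeasurable (hG1 i)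
      ((integrable_basisVec hX t i).sub (integrable_basisVec hX s i))
  have h1 : Q.real {ω | (X ω).1 t ≠ (X ω).1 s} =
      ∑ i, ∫ ω, G i ω * (basisVec ((X ω).1 t) i - basisVec ((X ω).1 s) i) ∂Q := by
    rw [← integral_finsetSum _ fun i _ => hi i, ← integral_indicator_one hmeas]
    exact integral_congr_ae (ae_of_all _ hind)
  rw [h1]
  unfold totalRate
  rw [integral_finsetSum _ fun i _ => integrable_finsetSum _ fun j _ =>
    (hA.integrableOn_Ioc i j s t).abs]
  refine Finset.sum_le_sum fun i _ => ?_
  rw [integral_mul_chain_sub hA hM hst (hGm i).stronglyMeasurable (hG1 i),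
    integral_finsetSum _ fun j _ => (hA.integrableOn_Ioc i j s t).abs]
  refine Finset.sum_le_sum fun j _ => ?_
  refine (le_abs_self _).trans ((abs_setIntegral_mul_le (C := 1)
    (hA.integrableOn_Ioc i j s t) fun u _ => ?_).trans_eq (one_mul _))
  refine (abs_integral_le_integral_abs).trans ?_
  refine (integral_mono_of_nonneg (ae_of_all _ fun _ => abs_nonneg _) (integrable_const (1 : ℝ))
    (ae_of_all _ fun ω => ?_)).trans_eq (by simp)
  simp only [abs_mul]
  exact mul_le_one₀ (hG1 i ω) (abs_nonneg _) (abs_basisVec_le _ _)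

/-- Induction on the smallest time `a` of `F`: if the chain leaves its state at `s`, then it has
moved at `a`, or it differs later from its state at `a`. The integrals over `]s, a]` and `]a, t]`
add up, so the bound does not depend on the size of `F`. -/
lemma measureReal_exists_finset_ne_le (hA : IsRateMatrix A)
    (hM : Martingale (chainNoise A X) (fullFiltration X hX Y hY) Q) {t : ℝ≥0} (F : Finset ℝ≥0) :
    ∀ {s : ℝ≥0}, s ≤ t → (∀ u ∈ F, s ≤ u ∧ u ≤ t) →
    Q.real {ω | ∃ u ∈ F, (X ω).1 u ≠ (X ω).1 s} ≤ ∫ u in Ioc s t, totalRate A u := by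
  induction F using Finset.induction_on_min with
  | empty =>
    intro s _ _
    simp only [Finset.notMem_empty, false_and, exists_const]
    refine le_trans (le_of_eq ?_) (integral_nonneg fun u => totalRate_nonneg u)
    exact measureReal_empty
  | insert a F hmin ih =>
    intro s hst hF
    have ha := hF a (Finset.mem_insert_self _ _)
    have hsub : {ω | ∃ u ∈ insert a F, (X ω).1 u ≠ (X ω).1 s} ⊆
        {ω | (X ω).1 a ≠ (X ω).1 s} ∪ {ω | ∃ u ∈ F, (X ω).1 u ≠ (X ω).1 a} := by
      rintro ω ⟨u, hu, hne⟩
      by_cases h : (X ω).1 a = (X ω).1 s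
      · rcases Finset.mem_insert.1 hu with rfl | hu
        · exact absurd h hne
        · exact Or.inr ⟨u, hu, by rw [h]; exact hne⟩
      · exact Or.inl h
    calc _ ≤ _ := measureReal_mono hsub
      _ ≤ _ := measureReal_union_le _ _
      _ ≤ (∫ u in Ioc s a, totalRate A u) + ∫ u in Ioc a t, totalRate A u :=
        add_le_add (measureReal_ne_le hA hM ha.1)
          (ih ha.2 fun u hu => ⟨(hmin u hu).le, (hF u (Finset.mem_insert_of_mem hu)).2⟩)
      _ = _ := (setIntegral_Ioc_add ha.1 ha.2 (hA.integrableOn_totalRate s t)).symm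

/-- The event that the chain moves during `]s, t]`. -/
def moves (X : Ω → StatePath N) (s t : ℝ≥0) : Set Ω := {ω | ∃ u ∈ Ioc s t, (X ω).1 u ≠ (X ω).1 s}

/-- By right-continuity a state taken at some `u < t` persists for a while and is seen at a point of
a dense sequence. The end point `t` leaves no room on its right and is put into every set. The
finite sets do not depend on the process. -/
lemma exists_monotone_finset_moves {s t : ℝ≥0} (hst : s ≤ t) :
    ∃ F : ℕ → Finset ℝ≥0, Monotone F ∧ (∀ n, ∀ u ∈ F n, s ≤ u ∧ u ≤ t) ∧
      ∀ X : Ω → StatePath N, moves X s t = ⋃ n, {ω | ∃ u ∈ F n, (X ω).1 u ≠ (X ω).1 s} := by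
  set d : ℕ → ℝ≥0 := fun k => min t (max s (TopologicalSpace.denseSeq ℝ≥0 k)) with hd
  have hds : ∀ k, s ≤ d k ∧ d k ≤ t := fun k =>
    ⟨le_min hst (le_max_left _ _), min_le_left _ _⟩
  refine ⟨fun n => insert t ((Finset.range n).image d), fun m n hmn => ?_, fun n u hu => ?_,
    fun X => ?_⟩
  · exact Finset.insert_subset_insert _ (Finset.image_subset_image (Finset.range_mono hmn))
  · rcases Finset.mem_insert.1 hu with rfl | hu
    · exact ⟨hst, le_rfl⟩
    · obtain ⟨k, _, rfl⟩ := Finset.mem_image.1 hu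
      exact hds k
  · ext ω
    simp only [mem_iUnion]
    constructor
    · rintro ⟨u, hu, hne⟩
      rcases eq_or_lt_of_le hu.2 with rfl | hut
      · exact ⟨0, u, Finset.mem_insert_self _ _, hne⟩
      have hev : ∀ᶠ v in 𝓝[≥] u, (X ω).1 v = (X ω).1 u :=
        ((X ω).2.1 u).tendsto.eventually (p := fun k => k = (X ω).1 u) (by simp)
      obtain ⟨c, hc1, hc2⟩ := (mem_nhdsGE_iff_exists_Ico_subset' hut).1 hev
      obtain ⟨k, hk⟩ := (TopologicalSpace.denseRange_denseSeq ℝ≥0).exists_mem_open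
        (isOpen_Ioo (a := u) (b := min c t)) (nonempty_Ioo.2 (lt_min hc1 hut))
      refine ⟨k + 1, d k, Finset.mem_insert_of_mem (Finset.mem_image_of_mem d
        (Finset.self_mem_range_succ _)), ?_⟩
      have hdk : d k = TopologicalSpace.denseSeq ℝ≥0 k := by
        rw [hd]
        simp only
        rw [max_eq_right (hu.1.le.trans hk.1.le),
          min_eq_right (hk.2.le.trans (min_le_right _ _))]
      have hck : (X ω).1 (d k) = (X ω).1 u :=
        hc2 (by rw [hdk]; exact ⟨hk.1.le, hk.2.trans_le (min_le_left _ _)⟩)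
      rw [hck]
      exact hne
    · rintro ⟨n, u, hu, hne⟩
      have hu' : s ≤ u ∧ u ≤ t := by
        rcases Finset.mem_insert.1 hu with rfl | hu
        · exact ⟨hst, le_rfl⟩
        · obtain ⟨k, _, rfl⟩ := Finset.mem_image.1 hu
          exact hds k
      refine ⟨u, ⟨lt_of_le_of_ne hu'.1 ?_, hu'.2⟩, hne⟩
      rintro rfl
      exact hne rfl

lemma measurableSet_exists_finset_ne (hX : Measurable X) (F : Finset ℝ≥0) (s : ℝ≥0) :
    MeasurableSet {ω | ∃ u ∈ F, (X ω).1 u ≠ (X ω).1 s} := by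
  have : {ω | ∃ u ∈ F, (X ω).1 u ≠ (X ω).1 s} = ⋃ u ∈ F, {ω | (X ω).1 u ≠ (X ω).1 s} := by
    ext ω; simp
  rw [this]
  exact Finset.measurableSet_biUnion _ fun u _ =>
    (measurableSet_eq_fun ((StatePath.measurable_apply u).comp hX)
      ((StatePath.measurable_apply s).comp hX)).compl

lemma measurableSet_moves (hX : Measurable X) {s t : ℝ≥0} (hst : s ≤ t) :
    MeasurableSet (moves X s t) := by
  obtain ⟨F, _, _, h⟩ := exists_monotone_finset_moves (Ω := Ω) (N := N) hst
  rw [h X]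
  exact MeasurableSet.iUnion fun n => measurableSet_exists_finset_ne hX (F n) s

lemma measureReal_moves_le (hA : IsRateMatrix A)
    (hM : Martingale (chainNoise A X) (fullFiltration X hX Y hY) Q) {s t : ℝ≥0} (hst : s ≤ t) :
    Q.real (moves X s t) ≤ ∫ u in Ioc s t, totalRate A u := by
  obtain ⟨F, hmono, hF, h⟩ := exists_monotone_finset_moves (Ω := Ω) (N := N) hst
  have hm : Monotone fun n => {ω | ∃ u ∈ F n, (X ω).1 u ≠ (X ω).1 s} :=
    fun m n hmn ω ⟨u, hu, hne⟩ => ⟨u, hmono hmn hu, hne⟩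
  have hlim := tendsto_measure_iUnion_atTop (μ := Q) hm
  rw [← h X] at hlim
  have hlim' := (ENNReal.tendsto_toReal (measure_ne_top Q (moves X s t))).comp hlim
  exact le_of_tendsto' hlim' fun n => measureReal_exists_finset_ne_le hA hM (F n) hst (hF n)

end Chain

/-! ### The robust equation for weighted state probabilities -/

section Robust

variable {Ω : Type*} {mΩ : MeasurableSpace Ω} {Q : Measure Ω} [IsProbabilityMeasure Q] {N : ℕ}
  {A : ℝ≥0 → Matrix (Fin N) (Fin N) ℝ} {X : Ω → StatePath N} {hX : Measurable X}
  {Y : Ω → CountingPath} {hY : Measurable Y} {lam : Fin N → ℝ≥0 → CountingPath → ℝ} {T : ℝ≥0}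
  {y : CountingPath}

/-- The quotient of the likelihood and the `i`-th entry of `Γ`. -/
def ratio (lam : Fin N → ℝ≥0 → CountingPath → ℝ) (X : Ω → StatePath N) (y : CountingPath)
    (t : ℝ≥0) (i : Fin N) (ω : Ω) : ℝ :=
  pathLikelihood lam (X ω) y t / gam lam y t i

/-- `E[G Z_t(X, y) 1_{X_t = i}] / Γ_t(y)_i`. -/
def robust (Q : Measure Ω) (lam : Fin N → ℝ≥0 → CountingPath → ℝ) (X : Ω → StatePath N)
    (G : Ω → ℝ) (y : CountingPath) (t : ℝ≥0) (i : Fin N) : ℝ :=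
  ∫ ω, G ω * ratio lam X y t i ω * basisVec ((X ω).1 t) i ∂Q

lemma measurable_pathLikelihood_state (hlam : IsIntensity lam) (y : CountingPath) (t : ℝ≥0) :
    Measurable (fun x : StatePath N => pathLikelihood lam x y t) :=
  (measurable_pathLikelihood hlam).comp
    (measurable_const.prodMk (measurable_id.prodMk measurable_const))

lemma measurable_ratio (hlam : IsIntensity lam) (hX : Measurable X) (y : CountingPath) (t : ℝ≥0)
    (i : Fin N) : Measurable (ratio lam X y t i) :=
  ((measurable_pathLikelihood_state hlam y t).comp hX).div_const _

/-- Since `y` is a fixed path, the likelihood at `t` is a function of the stopped state path alone.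
-/
lemma measurable_ratio_fullFiltration (hlam : IsIntensity lam) (y : CountingPath) (t : ℝ≥0)
    (i : Fin N) : Measurable[fullFiltration X hX Y hY t] (ratio lam X y t i) := by
  have h1 : Measurable[pathFiltration IsCadlag t]
      (fun x : StatePath N => pathLikelihood lam (stopState t x) y t) :=
    (measurable_pathLikelihood_state hlam y t).comp
      (measurable_stopPath (fun x t => IsCadlag.comp_min x t) t)
  have h2 : Measurable[fullFiltration X hX Y hY t, pathFiltration IsCadlag t] X :=
    (comap_measurable X).mono le_sup_right le_rfl
  have h3 := h1.comp h2
  have e : ratio lam X y t i =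
      fun ω => pathLikelihood lam (stopState t (X ω)) y t / gam lam y t i := by
    ext ω
    rw [ratio, pathLikelihood_congr hlam (x' := X ω) (fun s hs => stopState_apply hs _)
      fun s _ => rfl]
  rw [e]
  exact h3.div_const _

lemma setIntegral_mono_Ioc {φ : ℝ≥0 → ℝ} {s t s' t' : ℝ≥0} (h : IntegrableOn φ (Ioc s t))
    (h0 : ∀ u, 0 ≤ φ u) (hs : s ≤ s') (ht : t' ≤ t) :
    ∫ u in Ioc s' t', φ u ≤ ∫ u in Ioc s t, φ u :=
  setIntegral_mono_set h (ae_of_all _ h0) (Ioc_subset_Ioc hs ht).eventuallyLE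

lemma abs_integral_mul_indicator_le {f : Ω → ℝ} {s : Set Ω} (hs : MeasurableSet s) {c : ℝ}
    (hf : ∀ ω, |f ω| ≤ s.indicator (fun _ => c) ω) : |∫ ω, f ω ∂Q| ≤ c * Q.real s := by
  rw [← Real.norm_eq_abs]
  refine (norm_integral_le_of_norm_le ((integrable_const c).indicator hs)
    (ae_of_all _ hf)).trans_eq ?_
  rw [integral_indicator_const _ hs, smul_eq_mul, mul_comm]

/-- The increment over `]s, t]` splits into the chain increment with the ratio frozen at `s`, and a
remainder `R` from the change of the ratio. The remainder vanishes unless the chain moves, since the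
ratio is constant while the chain stays in `i`. Both `R` and the error of unfreezing the ratio in
the compensator are of order `κ s t * α s t`, where `α` controls the moves and `κ` the ratio. The
general `G` serves the duality with the smoother, where it is the indicator of a state at time `r`.
-/
theorem isPrimitiveOn_robust (hA : IsRateMatrix A)
    (hM : Martingale (chainNoise A X) (fullFiltration X hX Y hY) Q) (hlam : IsIntensity lam)
    (hy : IsGood lam T y) {r : ℝ≥0} {G : Ω → ℝ} {c : ℝ}
    (hG : Measurable[fullFiltration X hX Y hY r] G) (hGc : ∀ ω, |G ω| ≤ c) (i : Fin N) :
    IsPrimitiveOn r T (fun t => robust Q lam X G y t i)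
      (fun s => ∑ j, A s i j * (gam lam y s j / gam lam y s i * robust Q lam X G y s j)) := by
  obtain ⟨C, hC, hCb⟩ := exists_ratio_bound hlam hy
  obtain ⟨C', hC', hCi⟩ := exists_ratio_sub_le hlam hy
  have hc : 0 ≤ c := by
    by_contra hneg
    obtain ⟨ω⟩ := Q.nonempty_of_neZero
    exact hneg ((abs_nonneg _).trans (hGc ω))
  have hGm : Measurable G := hG.mono ((fullFiltration X hX Y hY).le r) le_rfl
  set α : ℝ≥0 → ℝ≥0 → ℝ := fun s t => ∫ u in Ioc s t, totalRate A u with hα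
  set κ : ℝ≥0 → ℝ≥0 → ℝ := fun s t => ∫ u in Ioc s t, ∑ j, lam j u y with hκ
  have hsum0 : ∀ u, 0 ≤ ∑ j, lam j u y := fun u =>
    Finset.sum_nonneg fun j _ => (hlam.pos j u y).le
  have hα0 : ∀ s t, 0 ≤ α s t := fun s t => integral_nonneg fun u => totalRate_nonneg u
  have hκ0 : ∀ s t, 0 ≤ κ s t := fun s t => integral_nonneg hsum0
  -- Every weighted probability is bounded.
  have hwint : ∀ t ≤ T, ∀ j, Integrable
      (fun ω => G ω * ratio lam X y t i ω * basisVec ((X ω).1 t) j) Q := fun t ht j => by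
    refine Integrable.of_bound ((hGm.mul (measurable_ratio hlam hX y t i)).mul
      (measurable_basisVec hX t j)).aestronglyMeasurable (c * C) (ae_of_all _ fun ω => ?_)
    rw [Real.norm_eq_abs, abs_mul, abs_mul, ← mul_one (c * C)]
    exact mul_le_mul (mul_le_mul (hGc ω) (hCb _ t i ht) (abs_nonneg _) hc) (abs_basisVec_le _ _)
      (abs_nonneg _) (mul_nonneg hc hC.le)
  -- The factor `Γ_j / Γ_i` turns the normalisation of state `j` into that of `i`, so all terms of
  -- the equation for `i` carry the same ratio.
  have hw : ∀ t j, gam lam y t j / gam lam y t i * robust Q lam X G y t j =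
      ∫ ω, G ω * ratio lam X y t i ω * basisVec ((X ω).1 t) j ∂Q := fun t j => by
    rw [robust, ← integral_const_mul]
    congr 1
    ext ω
    rw [ratio, ratio]
    have h1 := (gam_pos (y := y) hlam t i).ne'
    have h2 := (gam_pos (y := y) hlam t j).ne'
    field_simp
  have hwb : ∀ t ≤ T, ∀ j,
      |gam lam y t j / gam lam y t i * robust Q lam X G y t j| ≤ c * C := fun t ht j => by
    rw [hw]
    refine (abs_integral_mul_indicator_le (c := c * C) MeasurableSet.univ fun ω => ?_).trans_eq
      (by simp)
    rw [indicator_univ, abs_mul, abs_mul, ← mul_one (c * C)]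
    exact mul_le_mul (mul_le_mul (hGc ω) (hCb _ t i ht) (abs_nonneg _) hc) (abs_basisVec_le _ _)
      (abs_nonneg _) (mul_nonneg hc hC.le)
  -- The increments are dominated by the probability that the chain moves.
  have hLip : ∀ j s t, s ≤ t → t ≤ T →
      |robust Q lam X G y t j - robust Q lam X G y s j| ≤ 2 * (c * C) * α s t := by
    intro j s t hst ht
    have hint : ∀ t ≤ T, Integrable
        (fun ω => G ω * ratio lam X y t j ω * basisVec ((X ω).1 t) j) Q := fun t ht => by
      refine Integrable.of_bound ((hGm.mul (measurable_ratio hlam hX y t j)).mul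
        (measurable_basisVec hX t j)).aestronglyMeasurable (c * C) (ae_of_all _ fun ω => ?_)
      rw [Real.norm_eq_abs, abs_mul, abs_mul, ← mul_one (c * C)]
      exact mul_le_mul (mul_le_mul (hGc ω) (hCb _ t j ht) (abs_nonneg _) hc)
        (abs_basisVec_le _ _) (abs_nonneg _) (mul_nonneg hc hC.le)
    have hb : ∀ t ≤ T, ∀ ω, |G ω * ratio lam X y t j ω * basisVec ((X ω).1 t) j| ≤ c * C := by
      intro t ht ω
      rw [abs_mul, abs_mul, ← mul_one (c * C)]
      exact mul_le_mul (mul_le_mul (hGc ω) (hCb _ t j ht) (abs_nonneg _) hc)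
        (abs_basisVec_le _ _) (abs_nonneg _) (mul_nonneg hc hC.le)
    rw [robust, robust, ← integral_sub (hint t ht) (hint s (hst.trans ht))]
    refine (abs_integral_mul_indicator_le (c := 2 * (c * C)) (measurableSet_moves hX hst)
      fun ω => ?_).trans (mul_le_mul_of_nonneg_left (measureReal_moves_le hA hM hst)
        (by positivity))
    by_cases hω : ω ∈ moves X s t
    · rw [indicator_of_mem hω]
      have h1 := abs_le.1 (hb t ht ω)
      have h2 := abs_le.1 (hb s (hst.trans ht) ω)
      rw [abs_le]
      constructor <;> linarith [h1.1, h1.2, h2.1, h2.2]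
    · rw [indicator_of_notMem hω]
      have hconst : ∀ u ∈ Icc s t, (X ω).1 u = (X ω).1 s := fun u hu => by
        rcases eq_or_lt_of_le hu.1 with rfl | hsu
        · rfl
        · by_contra hne
          exact hω ⟨u, ⟨hsu, hu.2⟩, hne⟩
      rw [hconst t ⟨hst, le_rfl⟩]
      by_cases hj : j = (X ω).1 s
      · subst hj
        rw [ratio, ratio, ratio_eq_of_forall_eq hlam hy hst ht hconst]
        simp
      · simp [basisVec_apply, hj]
  have hαc : ContinuousOn (α r) (Icc r T) :=
    continuousOn_setIntegral_Ioc (hA.integrableOn_totalRate r T)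
  have hαsub : ∀ s t, r ≤ s → s ≤ t → α s t = α r t - α r s := fun s t hrs hst => by
    simp only [hα]
    rw [setIntegral_Ioc_add hrs hst (hA.integrableOn_totalRate r t)]
    ring
  have hκsub : ∀ s t, r ≤ s → s ≤ t → t ≤ T → κ s t = κ r t - κ r s := fun s t hrs hst ht => by
    simp only [hκ]
    rw [setIntegral_Ioc_add hrs hst (integrableOn_Ioc_mono hy.integrableOn_sum zero_le ht)]
    ring
  -- The bound `hLip` holds across the jumps of `y` as well, so these leave no trace.
  have hcont : ∀ j, ContinuousOn (fun t => robust Q lam X G y t j) (Icc r T) := by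
    intro j t₀ ht₀
    have h1 : Tendsto (fun t => 2 * (c * C) * |α r t - α r t₀|) (𝓝[Icc r T] t₀) (𝓝 0) := by
      have := (((hαc t₀ ht₀).tendsto.sub_const (α r t₀)).abs).const_mul (2 * (c * C))
      simpa using this
    refine tendsto_iff_norm_sub_tendsto_zero.2 (squeeze_zero_norm' ?_ h1)
    filter_upwards [self_mem_nhdsWithin] with t ht
    rw [norm_norm, Real.norm_eq_abs]
    rcases le_total t₀ t with h | h
    · have h2 := hLip j t₀ t h ht.2
      rw [hαsub t₀ t ht₀.1 h] at h2
      exact h2.trans (mul_le_mul_of_nonneg_left (le_abs_self _) (by positivity))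
    · have h2 := hLip j t t₀ h ht₀.2
      rw [hαsub t t₀ ht.1 h, abs_sub_comm] at h2
      rw [abs_sub_comm (α r t)]
      exact h2.trans (mul_le_mul_of_nonneg_left (le_abs_self _) (by positivity))
  have hbi : ∀ j, IntegrableOn
      (fun s => A s i j * (gam lam y s j / gam lam y s i * robust Q lam X G y s j))
      (Ioc r T) := fun j => by
    refine (hA.integrableOn_Ioc i j r T).mul_bdd (c := c * C) ?_ ?_
    · refine AEStronglyMeasurable.mul ?_
        (((hcont j).mono Ioc_subset_Icc_self).aestronglyMeasurable measurableSet_Ioc)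
      exact ((measurable_gam_time hlam y j).div
        (measurable_gam_time hlam y i)).aestronglyMeasurable
    · filter_upwards [ae_restrict_mem measurableSet_Ioc] with s hs
      exact hwb s hs.2 j
  have hb := integrable_finsetSum Finset.univ fun j _ => hbi j
  refine ⟨hb, fun t hrt htT => ?_⟩
  set b : ℝ≥0 → ℝ :=
    fun s => ∑ j, A s i j * (gam lam y s j / gam lam y s i * robust Q lam X G y s j) with hbdef
  have hbI : IntegrableOn b (Ioc r T) := hb
  set D : ℝ≥0 → ℝ := fun t => robust Q lam X G y t i - ∫ s in Ioc r t, b s with hD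
  have hDc : ContinuousOn D (Icc r t) :=
    ((hcont i).sub (continuousOn_setIntegral_Ioc hbI)).mono (Icc_subset_Icc le_rfl htT)
  set m : ℝ≥0 → ℝ := fun t => α r t + κ r t with hm
  have hmc : ContinuousOn m (Icc r T) :=
    hαc.add (continuousOn_setIntegral_Ioc (integrableOn_Ioc_mono hy.integrableOn_sum zero_le le_rfl))
  -- Continuity of `D` reduces the claim to intervals free of observed jumps, where the quadratic
  -- estimate is available.
  have key : D t = D r := by
    refine eq_of_eq_off_finset (y.jumpTimes T) hrt hDc fun s₀ t₀ hrs₀ hst₀ ht₀ hJ₀ => ?_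
    refine eq_of_norm_sub_le_sq (C := 2 * (c * C')) hst₀
      (hmc.mono (Icc_subset_Icc hrs₀ (ht₀.trans htT))) fun s t hs₀ hst ht => ?_
    have hrs := hrs₀.trans hs₀
    have htT : t ≤ T := ht.trans (ht₀.trans htT)
    have hsT := hst.trans htT
    have hJ : ∀ s' t', s ≤ s' → t' ≤ t → ∀ u ∈ y.jumpTimes T, u ∉ Ioc s' t' :=
      fun s' t' hs' ht' u hu hu' => hJ₀ u hu
        ⟨(hs₀.trans hs').trans_lt hu'.1, (hu'.2.trans ht').trans ht⟩
    -- the frozen weight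
    set H : Ω → ℝ := fun ω => G ω * ratio lam X y s i ω with hH
    have hHm : Measurable[fullFiltration X hX Y hY s] H :=
      (hG.mono ((fullFiltration X hX Y hY).mono hrs) le_rfl).mul
        (measurable_ratio_fullFiltration hlam y s i)
    have hHm' : Measurable H := hHm.mono ((fullFiltration X hX Y hY).le s) le_rfl
    have hHc : ∀ ω, |H ω| ≤ c * C := fun ω => by
      rw [hH, abs_mul]
      exact mul_le_mul (hGc ω) (hCb _ s i hsT) (abs_nonneg _) hc
    have hinc := integral_mul_chain_sub hA hM hst hHm.stronglyMeasurable hHc i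
    have hHdiff : Integrable
        (fun ω => H ω * (basisVec ((X ω).1 t) i - basisVec ((X ω).1 s) i)) Q :=
      integrable_mul_of_bdd hHm'.aestronglyMeasurable hHc
        ((integrable_basisVec hX t i).sub (integrable_basisVec hX s i))
    -- If the chain stays in `i` the difference of ratios is 0; if it stays elsewhere the last
    -- factor is 0.
    set R : Ω → ℝ := fun ω => G ω * (ratio lam X y t i ω - ratio lam X y s i ω) *
      basisVec ((X ω).1 t) i with hR
    have hRb : |∫ ω, R ω ∂Q| ≤ c * (C' * κ s t) * α s t := by
      refine (abs_integral_mul_indicator_le (c := c * (C' * κ s t)) (measurableSet_moves hX hst)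
        fun ω => ?_).trans (mul_le_mul_of_nonneg_left (measureReal_moves_le hA hM hst)
          (mul_nonneg hc (mul_nonneg hC'.le (hκ0 s t))))
      by_cases hω : ω ∈ moves X s t
      · rw [indicator_of_mem hω, hR, abs_mul, abs_mul, ← mul_one (c * (C' * κ s t))]
        exact mul_le_mul (mul_le_mul (hGc ω) (hCi _ s t i hst htT (hJ s t le_rfl le_rfl))
          (abs_nonneg _) hc) (abs_basisVec_le _ _) (abs_nonneg _)
          (mul_nonneg hc (mul_nonneg hC'.le (hκ0 s t)))
      · rw [indicator_of_notMem hω]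
        have hconst : ∀ u ∈ Icc s t, (X ω).1 u = (X ω).1 s := fun u hu => by
          rcases eq_or_lt_of_le hu.1 with rfl | hsu
          · rfl
          · by_contra hne
            exact hω ⟨u, ⟨hsu, hu.2⟩, hne⟩
        rw [hR]
        simp only
        rw [hconst t ⟨hst, le_rfl⟩]
        by_cases hj : i = (X ω).1 s
        · have e := ratio_eq_of_forall_eq hlam hy hst htT (x := X ω) (i := i)
            fun u hu => by rw [hconst u hu, hj]
          rw [ratio, ratio, e]
          simp
        · simp [basisVec_apply, hj]
    have hsplit : robust Q lam X G y t i - robust Q lam X G y s i =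
        (∫ ω, H ω * (basisVec ((X ω).1 t) i - basisVec ((X ω).1 s) i) ∂Q) + ∫ ω, R ω ∂Q := by
      have hRi : Integrable R Q := by
        have h1 : R = fun ω => (G ω * ratio lam X y t i ω * basisVec ((X ω).1 t) i -
            G ω * ratio lam X y s i ω * basisVec ((X ω).1 s) i) -
            H ω * (basisVec ((X ω).1 t) i - basisVec ((X ω).1 s) i) := by
          ext ω
          simp only [hR, hH]
          ring
        rw [h1]
        exact ((hwint t htT i).sub (hwint s hsT i)).sub hHdiff
      rw [robust, robust, ← integral_sub (hwint t htT i) (hwint s hsT i),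
        ← integral_add hHdiff hRi]
      congr 1
      ext ω
      simp only [hR, hH]
      ring
    -- the frozen weight replaced by the running one
    set e : Fin N → ℝ≥0 → ℝ := fun j u => (∫ ω, H ω * basisVec ((X ω).1 u) j ∂Q) -
      gam lam y u j / gam lam y u i * robust Q lam X G y u j with he
    have heb : ∀ j, ∀ u ∈ Ioc s t, |e j u| ≤ c * (C' * κ s t) := by
      intro j u hu
      have huT := hu.2.trans htT
      have hHi : Integrable (fun ω => H ω * basisVec ((X ω).1 u) j) Q :=
        integrable_mul_of_bdd hHm'.aestronglyMeasurable hHc (integrable_basisVec hX u j)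
      simp only [he]
      rw [hw, ← integral_sub hHi (hwint u huT j)]
      refine (abs_integral_mul_indicator_le (c := c * (C' * κ s t)) MeasurableSet.univ
        fun ω => ?_).trans_eq (by simp)
      rw [indicator_univ, hH]
      simp only
      rw [← sub_mul, ← mul_sub, abs_mul, abs_mul, ← mul_one (c * (C' * κ s t))]
      refine mul_le_mul (mul_le_mul (hGc ω) ?_ (abs_nonneg _) hc) (abs_basisVec_le _ _)
        (abs_nonneg _) (mul_nonneg hc (mul_nonneg hC'.le (hκ0 s t)))
      rw [abs_sub_comm]
      refine (hCi _ s u i hu.1.le huT (hJ s u le_rfl hu.2)).trans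
        (mul_le_mul_of_nonneg_left ?_ hC'.le)
      exact setIntegral_mono_Ioc (integrableOn_Ioc_mono hy.integrableOn_sum zero_le htT) hsum0
        le_rfl hu.2
    have hHint : ∀ j, IntegrableOn (fun u => A u i j * ∫ ω, H ω * basisVec ((X ω).1 u) j ∂Q)
        (Ioc s t) := fun j => by
      refine (hA.integrableOn_Ioc i j s t).mul_bdd (c := c * C) ?_ (ae_of_all _ fun u => ?_)
      · have hm : Measurable (fun p : ℝ≥0 × Ω => H p.2 * basisVec ((X p.2).1 p.1) j) :=
          (hHm'.comp measurable_snd).mul (measurable_basisVec_uncurry hX j)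
        exact hm.stronglyMeasurable.integral_prod_right'.aestronglyMeasurable
      · refine (abs_integral_mul_indicator_le (c := c * C) MeasurableSet.univ
          fun ω => ?_).trans_eq (by simp)
        rw [indicator_univ, abs_mul, ← mul_one (c * C)]
        exact mul_le_mul (hHc ω) (abs_basisVec_le _ _) (abs_nonneg _) (mul_nonneg hc hC.le)
    have hdiff : D t - D s = (∑ j, ∫ u in Ioc s t, A u i j * e j u) + ∫ ω, R ω ∂Q := by
      have h1 : D t - D s = robust Q lam X G y t i - robust Q lam X G y s i -
          ∫ u in Ioc s t, b u := by
        simp only [hD]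
        rw [setIntegral_Ioc_add hrs hst (integrableOn_Ioc_mono hbI le_rfl htT)]
        ring
      have h2 : ∫ u in Ioc s t, b u = ∑ j, ∫ u in Ioc s t,
          A u i j * (gam lam y u j / gam lam y u i * robust Q lam X G y u j) :=
        integral_finsetSum _ fun j _ => integrableOn_Ioc_mono (hbi j) hrs htT
      have h3 : ∀ j, ∫ u in Ioc s t, A u i j * e j u =
          (∫ u in Ioc s t, A u i j * ∫ ω, H ω * basisVec ((X ω).1 u) j ∂Q) - ∫ u in Ioc s t,
          A u i j * (gam lam y u j / gam lam y u i * robust Q lam X G y u j) := fun j => by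
        rw [← integral_sub (hHint j) (integrableOn_Ioc_mono (hbi j) hrs htT)]
        simp only [he, mul_sub]
      rw [h1, hsplit, hinc, h2]
      simp only [h3, Finset.sum_sub_distrib]
      ring
    have hEb : |∑ j, ∫ u in Ioc s t, A u i j * e j u| ≤ c * (C' * κ s t) * α s t := by
      refine (Finset.abs_sum_le_sum_abs _ _).trans ?_
      refine (Finset.sum_le_sum fun j _ => abs_setIntegral_mul_le
        (hA.integrableOn_Ioc i j s t) (heb j)).trans ?_
      rw [← Finset.mul_sum, ← integral_finsetSum _ fun j _ => (hA.integrableOn_Ioc i j s t).abs]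
      refine mul_le_mul_of_nonneg_left ?_ (mul_nonneg hc (mul_nonneg hC'.le (hκ0 s t)))
      exact integral_mono (integrable_finsetSum _ fun j _ => (hA.integrableOn_Ioc i j s t).abs)
        (hA.integrableOn_totalRate s t) fun u => sum_abs_le_totalRate u i
    have hmst : m t - m s = α s t + κ s t := by
      rw [hαsub s t hrs hst, hκsub s t hrs hst htT]
      simp only [hm]
      ring
    rw [hdiff, hmst, Real.norm_eq_abs]
    refine (abs_add_le _ _).trans ((add_le_add hEb hRb).trans ?_)
    have h1 := hα0 s t
    have h2 := hκ0 s t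
    have h3 : κ s t * α s t ≤ (α s t + κ s t) ^ 2 := by nlinarith
    calc _ = 2 * (c * C') * (κ s t * α s t) := by ring
      _ ≤ _ := mul_le_mul_of_nonneg_left h3 (by positivity)
  simp only [hD, Ioc_self, setIntegral_empty, sub_zero] at key
  linarith

end Robust

/-! ### Conditional expectations given the observations -/

section CondExp

variable {Ω : Type*} {mΩ : MeasurableSpace Ω} {Q : Measure Ω} [IsProbabilityMeasure Q]

/-- The joint law is a product, so on each set `Y ⁻¹' B` the claim is Fubini's theorem. Conditioning
on a smaller σ-algebra `m₀` is possible as soon as the frozen integral is measurable for it. -/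
lemma condExp_comap_of_indepFun {α β E : Type*} {m₀ : MeasurableSpace β}
    [mα : MeasurableSpace α] [mβ : MeasurableSpace β]
    [NormedAddCommGroup E] [NormedSpace ℝ E] [CompleteSpace E] {X : Ω → α} {Y : Ω → β}
    (hX : Measurable X) (hY : Measurable Y) (hXY : IndepFun X Y Q)
    (hm₀ : m₀ ≤ mβ) {Φ : α × β → E} (hΦ : StronglyMeasurable Φ)
    (hi : Integrable (fun ω => Φ (X ω, Y ω)) Q)
    (hφ : StronglyMeasurable[m₀] fun y => ∫ ω, Φ (X ω, y) ∂Q) :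
    Q[fun ω => Φ (X ω, Y ω) | m₀.comap Y] =ᵐ[Q] fun ω => ∫ ω', Φ (X ω', Y ω) ∂Q := by
  have hprod := (indepFun_iff_map_prod_eq_prod_map_map hX.aemeasurable hY.aemeasurable).1 hXY
  have hle : m₀.comap Y ≤ mΩ := (MeasurableSpace.comap_mono hm₀).trans hY.comap_le
  have : IsProbabilityMeasure (Q.map X) := Measure.isProbabilityMeasure_map hX.aemeasurable
  have : IsProbabilityMeasure (Q.map Y) := Measure.isProbabilityMeasure_map hY.aemeasurable
  have hΦi : Integrable Φ ((Q.map X).prod (Q.map Y)) := by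
    rw [← hprod, integrable_map_measure hΦ.aestronglyMeasurable (hX.prodMk hY).aemeasurable]
    exact hi
  have hφe : ∀ y, ∫ ω, Φ (X ω, y) ∂Q = ∫ x, Φ (x, y) ∂(Q.map X) := fun y =>
    (integral_map hX.aemeasurable
      (hΦ.comp_measurable measurable_prodMk_right).aestronglyMeasurable).symm
  have hφm : StronglyMeasurable fun y => ∫ ω, Φ (X ω, y) ∂Q := hφ.mono hm₀
  have hφi : Integrable (fun ω => ∫ ω', Φ (X ω', Y ω) ∂Q) Q := by
    have h1 := hΦi.integral_prod_right
    simp only [← hφe] at h1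
    exact (integrable_map_measure hφm.aestronglyMeasurable hY.aemeasurable).1 h1
  refine (ae_eq_condExp_of_forall_setIntegral_eq hle hi (fun s _ _ => hφi.integrableOn)
    ?_ ?_).symm
  · rintro s ⟨B, hB, rfl⟩ _
    have hB' : MeasurableSet B := hm₀ B hB
    have h1 : ∫ ω in Y ⁻¹' B, (∫ ω', Φ (X ω', Y ω) ∂Q) ∂Q =
        ∫ y in B, (∫ x, Φ (x, y) ∂(Q.map X)) ∂(Q.map Y) := by
      rw [setIntegral_map hB' (by simpa only [← hφe] using hφm.aestronglyMeasurable)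
        hY.aemeasurable]
      simp only [hφe]
    have h2 : ∫ ω in Y ⁻¹' B, Φ (X ω, Y ω) ∂Q =
        ∫ p in univ ×ˢ B, Φ p ∂((Q.map X).prod (Q.map Y)) := by
      rw [← hprod, setIntegral_map (MeasurableSet.univ.prod hB') hΦ.aestronglyMeasurable
        (hX.prodMk hY).aemeasurable]
      simp [mk_preimage_prod]
    have h3 : Integrable Φ ((Q.map X).prod ((Q.map Y).restrict B)) := by
      have := hΦi.restrict (s := univ ×ˢ B)
      rwa [← Measure.prod_restrict, Measure.restrict_univ] at this
    rw [h1, h2, ← Measure.prod_restrict, Measure.restrict_univ, integral_prod_symm _ h3]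
  · exact (hφ.comp_measurable (comap_measurable Y)).aestronglyMeasurable

variable {N : ℕ} {X : Ω → StatePath N} {Y : Ω → CountingPath}
  {lam : Fin N → ℝ≥0 → CountingPath → ℝ} {T : ℝ≥0}

lemma measurable_pathFiltration_of_congr {E : Type*} [MeasurableSpace E] {f : CountingPath → E}
    (hf : Measurable f) {t : ℝ≥0} (h : ∀ y, f (stopObs t y) = f y) :
    Measurable[pathFiltration IsCountingPath t] f := by
  have := hf.comp (measurable_stopPath IsCountingPath.comp_min t)
  have e : f ∘ stopPath IsCountingPath.comp_min t = f := funext h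
  rwa [e] at this

/-- `E[Z_s(X, y) 1_{X_t = i}]`. -/
def weightedProb (Q : Measure Ω) (lam : Fin N → ℝ≥0 → CountingPath → ℝ) (X : Ω → StatePath N)
    (s t : ℝ≥0) (y : CountingPath) (i : Fin N) : ℝ :=
  ∫ ω, pathLikelihood lam (X ω) y s * basisVec ((X ω).1 t) i ∂Q

lemma integrable_weighted (hlam : IsIntensity lam) (hX : Measurable X) {y : CountingPath}
    (hy : IsGood lam T y) {s : ℝ≥0} (hs : s ≤ T) (t : ℝ≥0) (i : Fin N) :
    Integrable (fun ω => pathLikelihood lam (X ω) y s * basisVec ((X ω).1 t) i) Q := by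
  obtain ⟨c, C, hc, hC, h⟩ := exists_pathLikelihood_bounds hlam hy
  refine integrable_mul_of_bdd ((measurable_pathLikelihood_state hlam y s).comp
    hX).aestronglyMeasurable (c := C) (fun ω => ?_) (integrable_basisVec hX t i)
  rw [abs_of_pos (pathLikelihood_pos hlam _ _)]
  exact (h _ _ hs).2

/-- The time `s` of likelihood and observations is kept apart from the time `t` of the state: `s =
t` gives the filter and `s = T` the smoother. -/
lemma condExp_likelihood_basisVec (hlam : IsIntensity lam) (hX : Measurable X)
    (hY : Measurable Y) (hXY : IndepFun X Y Q)
    (hgood : ∀ᵐ ω ∂Q, IsGood lam T (Y ω)) {s : ℝ≥0} (hs : s ≤ T)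
    (hZ : Integrable (likelihood lam X Y s) Q) (t : ℝ≥0) :
    Q[fun ω => likelihood lam X Y s ω • basisVec ((X ω).1 t) | obsFiltration Y hY s] =ᵐ[Q]
      fun ω => weightedProb Q lam X s t (Y ω) := by
  set Φ : StatePath N × CountingPath → Fin N → ℝ :=
    fun p => pathLikelihood lam p.1 p.2 s • basisVec (p.1.1 t) with hΦdef
  have hΦ : Measurable Φ := by
    have h1 : Measurable (fun p : StatePath N × CountingPath => pathLikelihood lam p.1 p.2 s) :=
      (measurable_pathLikelihood hlam).comp (measurable_const.prodMk measurable_id)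
    have h2 : Measurable (fun p : StatePath N × CountingPath => basisVec (p.1.1 t)) :=
      (measurable_of_countable (fun k : Fin N => basisVec k)).comp
        ((StatePath.measurable_apply t).comp measurable_fst)
    exact h1.smul h2
  have hi : Integrable (fun ω => Φ (X ω, Y ω)) Q := by
    have e : (fun ω => Φ (X ω, Y ω)) =
        fun ω => likelihood lam X Y s ω • basisVec ((X ω).1 t) := by
      ext ω
      simp only [hΦdef, likelihood_eq]
    rw [e]
    refine Integrable.of_eval fun i => ?_
    simp only [Pi.smul_apply, smul_eq_mul]
    exact hZ.mul_bdd (c := 1) (measurable_basisVec hX t i).aestronglyMeasurable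
      (ae_of_all _ fun _ => abs_basisVec_le _ _)
  set φ : CountingPath → Fin N → ℝ := fun y => ∫ ω, Φ (X ω, y) ∂Q with hφdef
  have hφ0 : Measurable φ := by
    have h1 : Measurable (fun p : CountingPath × Ω => Φ (X p.2, p.1)) :=
      hΦ.comp ((hX.comp measurable_snd).prodMk measurable_fst)
    exact h1.stronglyMeasurable.integral_prod_right'.measurable
  have hφs : ∀ y, φ (stopObs s y) = φ y := fun y => by
    simp only [hφdef]
    congr 1
    ext ω
    simp only [hΦdef]
    rw [pathLikelihood_congr hlam (y' := y) (fun _ _ => rfl) fun u hu => stopObs_apply hu y]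
  have hφ : Measurable[pathFiltration IsCountingPath s] φ :=
    measurable_pathFiltration_of_congr hφ0 hφs
  have key := condExp_comap_of_indepFun hX hY hXY ((pathFiltration IsCountingPath).le s)
    hΦ.stronglyMeasurable hi hφ.stronglyMeasurable
  have e : (fun ω => Φ (X ω, Y ω)) =
      fun ω => likelihood lam X Y s ω • basisVec ((X ω).1 t) := by
    ext ω
    simp only [hΦdef, likelihood_eq]
  rw [e] at key
  refine key.trans ?_
  filter_upwards [hgood] with ω hω
  ext i
  -- A vector integral is evaluated by components only if these are integrable, which is where the
  -- path has to be good.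
  rw [eval_integral fun j => ?_]
  · rfl
  · exact integrable_weighted hlam hX hω hs t j

end CondExp

/-! ### Linear integral equations with a measurable parameter -/

section Linear

variable {N : ℕ} {D : Type*} [MeasurableSpace D] {T : ℝ≥0}

/-- The terms of the Neumann series for `V_t = w + ∫_{]t,T]} k_s V_s ds`. -/
def neumannTerm (T : ℝ≥0) (k : ℝ≥0 → D → Matrix (Fin N) (Fin N) ℝ) (w : D → Fin N → ℝ) :
    ℕ → ℝ≥0 → D → Fin N → ℝ
  | 0, _, y, i => w y i
  | n + 1, t, y, i => ∫ s in Ioc t T, ∑ j, k s y i j * neumannTerm T k w n s y j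

lemma measurable_neumannTerm {k : ℝ≥0 → D → Matrix (Fin N) (Fin N) ℝ} {w : D → Fin N → ℝ}
    (hk : ∀ i j, Measurable (fun p : ℝ≥0 × D => k p.1 p.2 i j))
    (hw : ∀ i, Measurable (fun y => w y i)) (n : ℕ) :
    ∀ i, Measurable (fun p : ℝ≥0 × D => neumannTerm T k w n p.1 p.2 i) := by
  induction n with
  | zero => exact fun i => (hw i).comp measurable_snd
  | succ n ih =>
    intro i
    have hset : MeasurableSet {q : (ℝ≥0 × D) × ℝ≥0 | q.1.1 < q.2 ∧ q.2 ≤ T} := by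
      have h1 : MeasurableSet {q : (ℝ≥0 × D) × ℝ≥0 | q.1.1 < q.2} :=
        measurableSet_lt (measurable_fst.comp measurable_fst) measurable_snd
      have h2 : MeasurableSet {q : (ℝ≥0 × D) × ℝ≥0 | q.2 ≤ T} :=
        measurableSet_le measurable_snd measurable_const
      exact h1.inter h2
    have hf : Measurable (fun q : (ℝ≥0 × D) × ℝ≥0 =>
        ∑ j, k q.2 q.1.2 i j * neumannTerm T k w n q.2 q.1.2 j) := by
      have hp : Measurable (fun q : (ℝ≥0 × D) × ℝ≥0 => (q.2, q.1.2)) :=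
        measurable_snd.prodMk (measurable_snd.comp measurable_fst)
      exact Finset.measurable_fun_sum Finset.univ fun j _ =>
        ((hk i j).comp hp).mul ((ih j).comp hp)
    have hm : Measurable (fun q : (ℝ≥0 × D) × ℝ≥0 => (Ioc q.1.1 T).indicator
        (fun s => ∑ j, k s q.1.2 i j * neumannTerm T k w n s q.1.2 j) q.2) := by
      convert hf.indicator hset using 1
      ext q
      simp [indicator]
    have := hm.stronglyMeasurable.integral_prod_right' (ν := (volume : Measure ℝ≥0))
    simp only [integral_indicator measurableSet_Ioc] at this
    exact this.measurable

/-- Linear terminal value problems with integrable coefficients have solutions that depend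
measurably on a parameter. -/
theorem exists_measurable_solution {k : ℝ≥0 → D → Matrix (Fin N) (Fin N) ℝ} {w : D → Fin N → ℝ}
    (hk : ∀ i j, Measurable (fun p : ℝ≥0 × D => k p.1 p.2 i j))
    (hw : ∀ i, Measurable (fun y => w y i)) :
    ∃ V : ℝ≥0 → D → Fin N → ℝ, (∀ t ≤ T, ∀ i, Measurable fun y => V t y i) ∧
      ∀ y, (∀ i j, IntegrableOn (fun s => k s y i j) (Ioc 0 T)) →
        (∀ i, V T y i = w y i) ∧ ∀ i, IsPrimitiveOn 0 T (fun t => V t y i)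
          (fun s => -∑ j, k s y i j * V s y j) := by
  set V' := neumannTerm T k w with hV'
  have hV'm := fun n => measurable_neumannTerm (T := T) hk hw n
  set good : Set D := {y | ∀ i j, IntegrableOn (fun s => k s y i j) (Ioc 0 T)} with hgood
  have hgoodm : MeasurableSet good := by
    have : good = ⋂ i, ⋂ j, {y | Integrable (fun s => k s y i j) (volume.restrict (Ioc 0 T))} := by
      ext y; simp [hgood, IntegrableOn]
    rw [this]
    refine MeasurableSet.iInter fun i => MeasurableSet.iInter fun j => ?_
    have h1 : StronglyMeasurable (Function.uncurry fun (y : D) (s : ℝ≥0) => k s y i j) :=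
      ((hk i j).comp measurable_swap).stronglyMeasurable
    exact measurableSet_integrable h1
  -- bounds for the terms of the series
  have hbound : ∀ y ∈ good, ∃ W : ℝ, 0 ≤ W ∧ ∀ n, ∀ t ≤ T, ∀ i, |V' n t y i| ≤ W * (1 / 2) ^ n := by
    intro y hy
    set κ : ℝ≥0 → ℝ := fun s => ∑ i, ∑ j, |k s y i j| with hκ
    have hκi : IntegrableOn κ (Ioc 0 T) :=
      integrable_finsetSum _ fun i _ => integrable_finsetSum _ fun j _ => (hy i j).abs
    have hκ0 : ∀ s, 0 ≤ κ s := fun s =>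
      Finset.sum_nonneg fun _ _ => Finset.sum_nonneg fun _ _ => abs_nonneg _
    -- Measured against the weight `exp K`, the integral operator contracts by 1/2: `exp K` has the
    -- derivative `-2 κ exp K`, so `∫ κ exp K` over `]t, T]` is at most `exp (K t) / 2`.
    set K : ℝ≥0 → ℝ := fun t => 0 + ∫ s in Ioc 0 t, -(2 * κ s) with hK
    have hKp : IsPrimitiveOn 0 T K (fun s => -(2 * κ s)) :=
      IsPrimitiveOn.of_integral (hκi.const_mul 2).neg 0
    have hE := hKp.exp
    have hKle : ∀ t, K t ≤ 0 := fun t => by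
      simp only [hK, zero_add]
      exact integral_nonpos fun s => by simpa using hκ0 s
    -- As `K` decreases, this `W` gives `|w| ≤ W * exp (K t)` for all `t ≤ T`, the start of the
    -- induction.
    set W := (∑ i, |w y i|) * Real.exp (-K T) with hW
    have hW0 : 0 ≤ W := mul_nonneg (Finset.sum_nonneg fun _ _ => abs_nonneg _) (Real.exp_pos _).le
    have main : ∀ n, ∀ t ≤ T, ∀ i, |V' n t y i| ≤ W * (1 / 2) ^ n * Real.exp (K t) := by
      intro n
      induction n with
      | zero =>
        intro t ht i
        have h1 : |w y i| ≤ ∑ i, |w y i| :=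
          Finset.single_le_sum (f := fun i => |w y i|) (fun _ _ => abs_nonneg _)
            (Finset.mem_univ i)
        have h2 : K T ≤ K t := by
          have := hKp.sub_eq (zero_le (a := t)) ht le_rfl
          have h3 : ∫ u in Ioc t T, -(2 * κ u) ≤ 0 :=
            integral_nonpos fun s => by simpa using hκ0 s
          linarith
        have h3 : 1 ≤ Real.exp (-K T) * Real.exp (K t) := by
          rw [← Real.exp_add]
          exact Real.one_le_exp (by linarith)
        rw [hW, pow_zero, mul_one, mul_assoc]
        refine h1.trans ?_
        exact le_mul_of_one_le_right (Finset.sum_nonneg fun _ _ => abs_nonneg _) h3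
      | succ n ih =>
        intro t ht i
        have hEi : IntegrableOn (fun s => κ s * Real.exp (K s)) (Ioc t T) :=
          integrableOn_Ioc_mono (integrableOn_mul_continuousOn hκi hKp.continuousOn.rexp)
            zero_le le_rfl
        have h1 : |V' (n + 1) t y i| ≤
            ∫ s in Ioc t T, W * (1 / 2) ^ n * (κ s * Real.exp (K s)) := by
          rw [← Real.norm_eq_abs]
          refine norm_integral_le_of_norm_le (hEi.const_mul _) ?_
          filter_upwards [ae_restrict_mem measurableSet_Ioc] with s hs
          rw [Real.norm_eq_abs]
          refine (Finset.abs_sum_le_sum_abs _ _).trans ?_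
          have h2 : ∀ j, |k s y i j * V' n s y j| ≤
              |k s y i j| * (W * (1 / 2) ^ n * Real.exp (K s)) := fun j => by
            rw [abs_mul]
            exact mul_le_mul_of_nonneg_left (ih s hs.2 j) (abs_nonneg _)
          refine (Finset.sum_le_sum fun j _ => h2 j).trans ?_
          rw [← Finset.sum_mul]
          have h3 : ∑ j, |k s y i j| ≤ κ s :=
            Finset.single_le_sum (f := fun i => ∑ j, |k s y i j|)
              (fun _ _ => Finset.sum_nonneg fun _ _ => abs_nonneg _) (Finset.mem_univ i)
          have h4 : 0 ≤ W * (1 / 2) ^ n * Real.exp (K s) := by positivity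
          calc _ ≤ κ s * (W * (1 / 2) ^ n * Real.exp (K s)) := mul_le_mul_of_nonneg_right h3 h4
            _ = _ := by ring
        have h5 : ∫ s in Ioc t T, κ s * Real.exp (K s) ≤ 1 / 2 * Real.exp (K t) := by
          have h6 := hE.sub_eq (zero_le (a := t)) ht le_rfl
          have h7 : ∫ u in Ioc t T, -(2 * κ u) * Real.exp (K u) =
              -2 * ∫ u in Ioc t T, κ u * Real.exp (K u) := by
            rw [← integral_const_mul]
            congr 1
            ext u
            ring
          rw [h7] at h6
          have := Real.exp_pos (K T)
          linarith
        refine h1.trans ?_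
        rw [integral_const_mul, pow_succ]
        calc _ ≤ W * (1 / 2) ^ n * (1 / 2 * Real.exp (K t)) :=
              mul_le_mul_of_nonneg_left h5 (by positivity)
          _ = _ := by ring
    refine ⟨W, hW0, fun n t ht i => (main n t ht i).trans ?_⟩
    exact mul_le_of_le_one_right (by positivity) (Real.exp_le_one_iff.2 (hKle t))
  have hgeo : ∀ W : ℝ, Summable fun n : ℕ => W * (1 / 2 : ℝ) ^ n := fun W =>
    (summable_geometric_of_lt_one (by norm_num) (by norm_num)).mul_left W
  have hsum : ∀ y ∈ good, ∀ t ≤ T, ∀ i, Summable fun n => V' n t y i := by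
    intro y hy t ht i
    obtain ⟨W, _, h⟩ := hbound y hy
    exact Summable.of_norm_bounded (hgeo W) fun n => h n t ht i
  -- The series is cut to zero off the measurable set of good parameters, where its convergence is
  -- not known; this keeps `V` a pointwise limit of measurable functions.
  refine ⟨fun t y i => good.indicator (fun y => ∑' n, V' n t y i) y, fun t ht i => ?_,
    fun y hy => ?_⟩
  · refine measurable_of_tendsto_metrizable
      (f := fun (n : ℕ) y => good.indicator (fun y => ∑ m ∈ Finset.range n, V' m t y i) y)
      (fun n => ?_) ?_
    · refine Measurable.indicator ?_ hgoodm
      exact Finset.measurable_fun_sum _ fun m _ =>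
        (hV'm m i).comp (measurable_const.prodMk measurable_id)
    · rw [tendsto_pi_nhds]
      intro y
      by_cases hy : y ∈ good
      · simp only [indicator_of_mem hy]
        exact (hsum y hy t ht i).hasSum.tendsto_sum_nat
      · simp only [indicator_of_notMem hy]
        exact tendsto_const_nhds
  · have hyg : y ∈ good := hy
    simp only [indicator_of_mem hyg]
    obtain ⟨W, hW0, hW⟩ := hbound y hyg
    set V : ℝ≥0 → Fin N → ℝ := fun t i => ∑' n, V' n t y i with hV
    have hVb : ∀ t ≤ T, ∀ i, |V t i| ≤ ∑' n : ℕ, W * (1 / 2 : ℝ) ^ n := fun t ht i =>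
      tsum_of_norm_bounded (f := fun n => V' n t y i) (hgeo W).hasSum fun n => hW n t ht i
    have hVt : ∀ n, Measurable fun t => V' n t y := fun n => by
      refine measurable_pi_iff.2 fun i => ?_
      exact (hV'm n i).comp (measurable_id.prodMk measurable_const)
    have hVm : ∀ i, AEStronglyMeasurable (fun t => V t i) (volume.restrict (Ioc 0 T)) := fun i => by
      refine aestronglyMeasurable_of_tendsto_ae atTop
        (f := fun (n : ℕ) t => ∑ m ∈ Finset.range n, V' m t y i) (fun n => ?_) ?_
      · exact (Finset.measurable_fun_sum _ fun m _ =>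
          (measurable_pi_iff.1 (hVt m) i)).aestronglyMeasurable
      · filter_upwards [ae_restrict_mem measurableSet_Ioc] with t ht
        exact (hsum y hyg t ht.2 i).hasSum.tendsto_sum_nat
    have hkV : ∀ i j, IntegrableOn (fun s => k s y i j * V s j) (Ioc 0 T) := fun i j => by
      refine (hy i j).mul_bdd (hVm j) (c := ∑' n : ℕ, W * (1 / 2 : ℝ) ^ n) ?_
      filter_upwards [ae_restrict_mem measurableSet_Ioc] with t ht
      exact hVb t ht.2 j
    have hkV' : ∀ n i j, IntegrableOn (fun s => k s y i j * V' n s y j) (Ioc 0 T) :=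
      fun n i j => by
        refine (hy i j).mul_bdd (measurable_pi_iff.1 (hVt n) j).aestronglyMeasurable
          (c := W * (1 / 2 : ℝ) ^ n) ?_
        filter_upwards [ae_restrict_mem measurableSet_Ioc] with t ht
        exact hW n t ht.2 j
    have hsol : ∀ t ≤ T, ∀ i, V t i = w y i + ∫ s in Ioc t T, ∑ j, k s y i j * V s j := by
      intro t ht i
      have h1 : V t i = w y i + ∑' n, V' (n + 1) t y i := by
        simp only [hV]
        rw [(hsum y hyg t ht i).tsum_eq_zero_add]
        rfl
      have h2 : ∀ n, IntegrableOn (fun s => ∑ j, k s y i j * V' n s y j) (Ioc t T) := fun n =>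
        integrable_finsetSum _ fun j _ => integrableOn_Ioc_mono (hkV' n i j) zero_le le_rfl
      have hκi : IntegrableOn (fun s => ∑ j, |k s y i j|) (Ioc t T) :=
        integrable_finsetSum _ fun j _ => (integrableOn_Ioc_mono (hy i j) zero_le le_rfl).abs
      have h3 : ∑' n, V' (n + 1) t y i =
          ∫ s in Ioc t T, ∑' n, ∑ j, k s y i j * V' n s y j := by
        refine integral_tsum_of_summable_integral_norm h2 ?_
        refine Summable.of_nonneg_of_le (fun n => integral_nonneg fun s => norm_nonneg _)
          (fun n => ?_) (hgeo ((∫ s in Ioc t T, ∑ j, |k s y i j|) * W))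
        rw [mul_assoc, ← integral_mul_const]
        refine integral_mono_ae (h2 n).norm (hκi.mul_const _) ?_
        filter_upwards [ae_restrict_mem measurableSet_Ioc] with s hs
        rw [Real.norm_eq_abs, Finset.sum_mul]
        refine (Finset.abs_sum_le_sum_abs _ _).trans (Finset.sum_le_sum fun j _ => ?_)
        rw [abs_mul]
        exact mul_le_mul_of_nonneg_left (hW n s hs.2 j) (abs_nonneg _)
      rw [h1, h3]
      congr 1
      refine setIntegral_congr_fun measurableSet_Ioc fun s hs => ?_
      have h4 : ∀ j, Summable fun n => k s y i j * V' n s y j := fun j =>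
        (hsum y hyg s hs.2 j).mul_left _
      change ∑' n, ∑ j, k s y i j * V' n s y j = ∑ j, k s y i j * V s j
      rw [Summable.tsum_finsetSum fun j _ => h4 j]
      exact Finset.sum_congr rfl fun j _ => tsum_mul_left
    have hI : ∀ i, IntegrableOn (fun s => ∑ j, k s y i j * V s j) (Ioc 0 T) := fun i =>
      integrable_finsetSum _ fun j _ => hkV i j
    refine ⟨fun i => ?_, fun i => IsPrimitiveOn.of_sub (hI i).neg fun t _ ht => ?_⟩
    · have := hsol T le_rfl i
      simpa using this
    · have h1 := hsol t ht i
      have h2 := hsol 0 zero_le i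
      rw [setIntegral_Ioc_add zero_le ht (hI i)] at h2
      rw [integral_neg]
      change V t i - V 0 i = _
      linarith

end Linear

/-! ### Linear equations with jumps -/

section Jumps

variable {T : ℝ≥0}

lemma IsPrimitiveOn.const_mul {a b : ℝ≥0} {f φ : ℝ≥0 → ℝ} (hf : IsPrimitiveOn a b f φ) (c : ℝ) :
    IsPrimitiveOn a b (fun t => c * f t) (fun t => c * φ t) :=
  ⟨hf.1.const_mul c, fun t hat htb => by
    rw [integral_const_mul]
    have h1 := hf.2 t hat htb
    simp only
    rw [h1]
    ring⟩

lemma tendsto_left_of_continuousOn {E : Type*} [TopologicalSpace E] {h : ℝ≥0 → E}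
    (hh : ContinuousOn h (Icc 0 T)) {t : ℝ≥0} (ht : t ≤ T) : Tendsto h (𝓝[<] t) (𝓝 (h t)) :=
  (hh t ⟨zero_le, ht⟩).tendsto.mono_left
    (nhdsWithin_mono _ fun _ hs => ⟨zero_le, (le_of_lt hs).trans ht⟩)

lemma continuousWithinAt_right_of_continuousOn {E : Type*} [TopologicalSpace E] {h : ℝ≥0 → E}
    (hh : ContinuousOn h (Icc 0 T)) {t : ℝ≥0} (ht : t < T) : ContinuousWithinAt h (Ici t) t := by
  refine (hh t ⟨zero_le, ht.le⟩).mono_of_mem_nhdsWithin ?_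
  filter_upwards [Ico_mem_nhdsGE ht] with s hs using ⟨zero_le, hs.2.le⟩

lemma continuousOn_Icc_of_left_of_right {E : Type*} [TopologicalSpace E] {h : ℝ≥0 → E}
    (hr : ∀ t < T, ContinuousWithinAt h (Ici t) t)
    (hl : ∀ t, 0 < t → t ≤ T → Tendsto h (𝓝[<] t) (𝓝 (h t))) : ContinuousOn h (Icc 0 T) := by
  intro t ht
  have h1 : ContinuousWithinAt h (Iio t) t := by
    rcases eq_or_lt_of_le ht.1 with h0 | h0
    · rw [← h0]
      simp [ContinuousWithinAt]
    · exact hl t h0 ht.2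
  have h2 : ContinuousWithinAt h (Icc t T) t := by
    rcases eq_or_lt_of_le ht.2 with h0 | h0
    · rw [h0, Icc_self]
      exact continuousWithinAt_singleton
    · exact (hr t h0).mono Icc_subset_Ici_self
  refine (h1.union h2).mono fun s hs => ?_
  rcases lt_or_ge s t with h | h
  · exact Or.inl h
  · exact Or.inr ⟨h, hs.2⟩

lemma eventually_filter_le_right (J : Finset ℝ≥0) (t : ℝ≥0) :
    ∀ᶠ s in 𝓝[≥] t, J.filter (· ≤ s) = J.filter (· ≤ t) := by
  have h : ∀ᶠ s in 𝓝[≥] t, ∀ u ∈ J, (u ≤ s ↔ u ≤ t) := by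
    rw [Filter.eventually_all_finset]
    intro u _
    rcases le_or_gt u t with hu | hu
    · filter_upwards [self_mem_nhdsWithin] with s hs
      exact ⟨fun _ => hu, fun _ => hu.trans hs⟩
    · filter_upwards [Ico_mem_nhdsGE hu] with s hs
      exact ⟨fun h => absurd hs.2 (not_lt.2 h), fun h => absurd hu (not_lt.2 h)⟩
  filter_upwards [h] with s hs
  exact Finset.filter_congr hs

lemma eventually_filter_le_left (J : Finset ℝ≥0) (t : ℝ≥0) :
    ∀ᶠ s in 𝓝[<] t, J.filter (· ≤ s) = J.filter (· < t) := by
  have h : ∀ᶠ s in 𝓝[<] t, ∀ u ∈ J, (u ≤ s ↔ u < t) := by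
    rw [Filter.eventually_all_finset]
    intro u _
    rcases lt_or_ge u t with hu | hu
    · filter_upwards [Ioo_mem_nhdsLT hu] with s hs
      exact ⟨fun _ => hu, fun _ => hs.1.le⟩
    · filter_upwards [self_mem_nhdsWithin] with s hs
      exact ⟨fun h => absurd (h.trans_lt hs) (not_lt.2 hu), fun h => absurd h (not_lt.2 hu)⟩
  filter_upwards [h] with s hs
  exact Finset.filter_congr hs

lemma filter_le_of_mem {J : Finset ℝ≥0} {t : ℝ≥0} (h : t ∈ J) :
    J.filter (· ≤ t) = insert t (J.filter (· < t)) := by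
  ext u
  simp only [Finset.mem_filter, Finset.mem_insert, le_iff_eq_or_lt]
  grind

lemma filter_le_of_notMem {J : Finset ℝ≥0} {t : ℝ≥0} (h : t ∉ J) :
    J.filter (· ≤ t) = J.filter (· < t) := by
  ext u
  simp only [Finset.mem_filter, le_iff_eq_or_lt]
  grind

lemma filter_le_eq_of_forall_notMem {J : Finset ℝ≥0} {s t : ℝ≥0} (hst : s ≤ t)
    (h : ∀ u ∈ J, u ∉ Ioc s t) : J.filter (· ≤ t) = J.filter (· ≤ s) := by
  refine Finset.filter_congr fun u hu => ⟨fun hut => ?_, fun hus => hus.trans hst⟩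
  by_contra hsu
  exact h u hu ⟨not_le.1 hsu, hut⟩

/-- The function `exp(-∫_{]0,t]} α) ∏_{u ∈ J, u ≤ t} c_u`. -/
def stepExp (α : ℝ≥0 → ℝ) (J : Finset ℝ≥0) (c : ℝ≥0 → ℝ) (t : ℝ≥0) : ℝ :=
  Real.exp (-∫ s in Ioc 0 t, α s) * ∏ u ∈ J.filter (· ≤ t), c u

/-- The left limits of `stepExp`. -/
def stepExpLeft (α : ℝ≥0 → ℝ) (J : Finset ℝ≥0) (c : ℝ≥0 → ℝ) (t : ℝ≥0) : ℝ :=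
  Real.exp (-∫ s in Ioc 0 t, α s) * ∏ u ∈ J.filter (· < t), c u

variable {α : ℝ≥0 → ℝ} {J : Finset ℝ≥0} {c : ℝ≥0 → ℝ}

lemma stepExp_of_mem {t : ℝ≥0} (h : t ∈ J) : stepExp α J c t = stepExpLeft α J c t * c t := by
  rw [stepExp, stepExpLeft, filter_le_of_mem h, Finset.prod_insert (by simp)]
  ring

lemma stepExp_of_notMem {t : ℝ≥0} (h : t ∉ J) : stepExp α J c t = stepExpLeft α J c t := by
  rw [stepExp, stepExpLeft, filter_le_of_notMem h]

/-- The class is closed under inversion, so dividing by such a function is multiplying by another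
one. -/
lemma stepExp_inv (t : ℝ≥0) :
    (stepExp α J c t)⁻¹ = stepExp (fun s => -α s) J (fun u => (c u)⁻¹) t := by
  rw [stepExp, stepExp, mul_inv, ← Real.exp_neg, Finset.prod_inv_distrib, integral_neg]

lemma continuousOn_exp_neg (hα : IntegrableOn α (Ioc 0 T)) :
    ContinuousOn (fun t => Real.exp (-∫ s in Ioc 0 t, α s)) (Icc 0 T) :=
  (continuousOn_setIntegral_Ioc hα).neg.rexp

lemma continuousWithinAt_stepExp (hα : IntegrableOn α (Ioc 0 T)) {t : ℝ≥0} (ht : t < T) :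
    ContinuousWithinAt (stepExp α J c) (Ici t) t := by
  have h1 := continuousWithinAt_right_of_continuousOn (continuousOn_exp_neg hα) ht
  refine (h1.mul (continuousWithinAt_const (b := ∏ u ∈ J.filter (· ≤ t), c u))).congr_of_eventuallyEq
    ?_ rfl
  filter_upwards [eventually_filter_le_right J t] with s hs
  rw [stepExp, hs]
  rfl

lemma tendsto_stepExp_left (hα : IntegrableOn α (Ioc 0 T)) {t : ℝ≥0} (ht : t ≤ T) :
    Tendsto (stepExp α J c) (𝓝[<] t) (𝓝 (stepExpLeft α J c t)) := by
  have h1 := tendsto_left_of_continuousOn (continuousOn_exp_neg hα) ht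
  refine (h1.mul_const (∏ u ∈ J.filter (· < t), c u)).congr' ?_
  filter_upwards [eventually_filter_le_left J t] with s hs
  rw [stepExp, hs]

lemma isCadlagOn_stepExp (hα : IntegrableOn α (Ioc 0 T)) : IsCadlagOn T (stepExp α J c) :=
  ⟨fun _ ht => continuousWithinAt_stepExp hα ht, fun _ ht => ⟨_, tendsto_stepExp_left hα ht⟩⟩

lemma isPrimitiveOn_stepExp (hα : IntegrableOn α (Ioc 0 T)) {s t : ℝ≥0} (hst : s ≤ t) (ht : t ≤ T)
    (hJ : ∀ u ∈ J, u ∉ Ioc s t) :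
    IsPrimitiveOn s t (stepExp α J c) (fun u => -α u * stepExp α J c u) := by
  have h1 : IsPrimitiveOn 0 T (fun t => 0 + ∫ s in Ioc 0 t, -α s) (fun s => -α s) :=
    IsPrimitiveOn.of_integral hα.neg 0
  have h2 := ((h1.mono (zero_le (a := s)) ht).exp).const_mul (∏ u ∈ J.filter (· ≤ s), c u)
  have e : ∀ u ∈ Icc s t, (∏ u ∈ J.filter (· ≤ s), c u) *
      Real.exp (0 + ∫ s in Ioc 0 u, -α s) = stepExp α J c u := fun u hu => by
    rw [stepExp, filter_le_eq_of_forall_notMem hu.1 fun v hv hv' =>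
      hJ v hv ⟨hv'.1, hv'.2.trans hu.2⟩, integral_neg, zero_add, mul_comm]
  refine (h2.congr hst e).congr_deriv ?_
  filter_upwards [ae_restrict_mem measurableSet_Ioc] with u hu
  rw [← e u (Ioc_subset_Icc_self hu)]
  ring

lemma IsCadlagOn.integrableOn_mul {φ f : ℝ≥0 → ℝ} (hφ : IntegrableOn φ (Ioc 0 T))
    (hf : IsCadlagOn T f) : IntegrableOn (fun s => φ s * f s) (Ioc 0 T) := by
  obtain ⟨C, hC⟩ := hf.exists_bound
  refine hφ.mul_bdd (c := C) ?_ ?_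
  · refine hf.measurable_stop.aestronglyMeasurable.congr ?_
    filter_upwards [ae_restrict_mem measurableSet_Ioc] with s hs
    rw [min_eq_left hs.2]
  · filter_upwards [ae_restrict_mem measurableSet_Ioc] with s hs
    exact hC s hs.2

lemma IsCadlagOn.mul {f g : ℝ≥0 → ℝ} (hf : IsCadlagOn T f) (hg : IsCadlagOn T g) :
    IsCadlagOn T (fun t => f t * g t) :=
  ⟨fun t ht => (hf.1 t ht).mul (hg.1 t ht), fun t ht => by
    obtain ⟨l, hl⟩ := hf.2 t ht
    obtain ⟨l', hl'⟩ := hg.2 t ht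
    exact ⟨_, hl.mul hl'⟩⟩

lemma isCadlagOn_of_continuousOn {f : ℝ≥0 → ℝ} (hf : ContinuousOn f (Icc 0 T)) : IsCadlagOn T f :=
  ⟨fun _ ht => continuousWithinAt_right_of_continuousOn hf ht,
    fun _ ht => ⟨_, tendsto_left_of_continuousOn hf ht⟩⟩

/-! ### Removing and creating jumps by an integrating factor. -/

/-- The sum of an absolutely continuous function and finitely many jumps. -/
structure IsJumpPrimitive (T : ℝ≥0) (J : Finset ℝ≥0) (f φ β : ℝ≥0 → ℝ) : Prop where
  integrableOn : IntegrableOn φ (Ioc 0 T)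
  eq : ∀ t ≤ T, f t = f 0 + (∫ s in Ioc 0 t, φ s) + ∑ u ∈ J.filter (· ≤ t), β u

namespace IsJumpPrimitive

variable {f φ β : ℝ≥0 → ℝ}

lemma continuousWithinAt (h : IsJumpPrimitive T J f φ β) {t : ℝ≥0} (ht : t < T) :
    ContinuousWithinAt f (Ici t) t := by
  have h1 := continuousWithinAt_right_of_continuousOn
    (continuousOn_setIntegral_Ioc h.integrableOn) ht
  refine (((continuousWithinAt_const (b := f 0)).add h1).add
    (continuousWithinAt_const (b := ∑ u ∈ J.filter (· ≤ t), β u))).congr_of_eventuallyEq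
    ?_ (h.eq t ht.le)
  filter_upwards [eventually_filter_le_right J t, Ico_mem_nhdsGE ht] with s hs hsT
  rw [h.eq s hsT.2.le, hs]
  rfl

lemma tendsto_left (h : IsJumpPrimitive T J f φ β) {t : ℝ≥0} (ht : t ≤ T) :
    Tendsto f (𝓝[<] t) (𝓝 (if t ∈ J then f t - β t else f t)) := by
  have h1 := tendsto_left_of_continuousOn (continuousOn_setIntegral_Ioc h.integrableOn) ht
  have h2 := (h1.const_add (f 0)).add_const (∑ u ∈ J.filter (· < t), β u)
  have e : (if t ∈ J then f t - β t else f t) =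
      f 0 + (∫ s in Ioc 0 t, φ s) + ∑ u ∈ J.filter (· < t), β u := by
    split_ifs with hJ
    · rw [h.eq t ht, filter_le_of_mem hJ, Finset.sum_insert (by simp)]
      ring
    · rw [h.eq t ht, filter_le_of_notMem hJ]
  rw [e]
  refine h2.congr' ?_
  filter_upwards [eventually_filter_le_left J t, self_mem_nhdsWithin] with s hs hst
  rw [h.eq s ((le_of_lt hst).trans ht), hs]

lemma leftLim_eq (h : IsJumpPrimitive T J f φ β) {t : ℝ≥0} (ht0 : 0 < t) (ht : t ≤ T) :
    Function.leftLim f t = if t ∈ J then f t - β t else f t :=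
  leftLim_eq_time ht0 (h.tendsto_left ht)

lemma isCadlagOn (h : IsJumpPrimitive T J f φ β) : IsCadlagOn T f :=
  ⟨fun _ ht => h.continuousWithinAt ht, fun _ ht => ⟨_, h.tendsto_left ht⟩⟩

lemma isPrimitiveOn (h : IsJumpPrimitive T J f φ β) {s t : ℝ≥0} (hst : s ≤ t) (ht : t ≤ T)
    (hJ : ∀ u ∈ J, u ∉ Ioc s t) : IsPrimitiveOn s t f φ := by
  refine IsPrimitiveOn.of_sub (integrableOn_Ioc_mono h.integrableOn zero_le ht)
    fun u hsu hut => ?_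
  rw [h.eq u (hut.trans ht), h.eq s (hst.trans ht), filter_le_eq_of_forall_notMem hsu
    fun v hv hv' => hJ v hv ⟨hv'.1, hv'.2.trans hut⟩, setIntegral_Ioc_add zero_le hsu
    (integrableOn_Ioc_mono h.integrableOn le_rfl (hut.trans ht))]
  ring

/-- Multiplication by `stepExp` removes the jumps of a solution of a linear equation. -/
theorem isPrimitiveOn_stepExp_mul (hα : IntegrableOn α (Ioc 0 T)) (hc : ∀ u, c u ≠ 0)
    (h : IsJumpPrimitive T J f φ (fun u => ((c u)⁻¹ - 1) * Function.leftLim f u)) :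
    IsPrimitiveOn 0 T (fun t => stepExp α J c t * f t)
      (fun s => stepExp α J c s * (φ s - α s * f s)) := by
  have hg := isCadlagOn_stepExp (c := c) (J := J) hα
  have hf := h.isCadlagOn
  set ψ : ℝ≥0 → ℝ := fun s => stepExp α J c s * (φ s - α s * f s) with hψ
  have hψi : IntegrableOn ψ (Ioc 0 T) := by
    have h1 := IsCadlagOn.integrableOn_mul (h.integrableOn.sub (hf.integrableOn_mul hα)) hg
    refine h1.congr (ae_of_all _ fun s => ?_)
    simp only [hψ, Pi.sub_apply]
    ring
  set D : ℝ≥0 → ℝ := fun t => stepExp α J c t * f t - ∫ s in Ioc 0 t, ψ s with hD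
  have hDc : ContinuousOn D (Icc 0 T) := by
    have hIc := continuousOn_setIntegral_Ioc hψi
    refine continuousOn_Icc_of_left_of_right (fun t ht => ?_) fun t ht0 ht => ?_
    · exact ((hg.1 t ht).mul (hf.1 t ht)).sub (continuousWithinAt_right_of_continuousOn hIc ht)
    · have h1 := ((tendsto_stepExp_left (J := J) (c := c) hα ht).mul (h.tendsto_left ht)).sub
        (tendsto_left_of_continuousOn hIc ht)
      convert h1 using 2
      simp only [hD]
      congr 1
      have h2 := h.leftLim_eq ht0 ht
      split_ifs with hmem
      · rw [if_pos hmem] at h2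
        -- At a jump `f` is multiplied by `(c t)⁻¹` and `stepExp` by `c t`, so the product is
        -- continuous.
        have h3 : f t = (c t)⁻¹ * Function.leftLim f t := by linear_combination -h2
        have h4 := hc t
        rw [stepExp_of_mem hmem, h3, ← mul_assoc, mul_assoc (stepExpLeft α J c t),
          mul_inv_cancel₀ h4, mul_one]
        ring
      · rw [stepExp_of_notMem hmem]
  refine IsPrimitiveOn.of_sub hψi fun t _ ht => ?_
  have key : D t = D 0 := by
    refine eq_of_eq_off_finset J zero_le (hDc.mono (Icc_subset_Icc le_rfl ht))
      fun s u _ hsu hut hno => ?_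
    have huT := hut.trans ht
    have h1 := (isPrimitiveOn_stepExp (c := c) hα hsu huT hno).mul (h.isPrimitiveOn hsu huT hno)
    have h2 := h1.sub_eq le_rfl hsu le_rfl
    have h3 : ∫ v in Ioc s u, (-α v * stepExp α J c v * f v + φ v * stepExp α J c v) =
        ∫ v in Ioc s u, ψ v := by
      congr 1
      ext v
      simp only [hψ]
      ring
    rw [h3] at h2
    simp only [hD]
    rw [setIntegral_Ioc_add zero_le hsu (integrableOn_Ioc_mono hψi le_rfl huT)]
    linarith
  simp only [hD, Ioc_self, setIntegral_empty, sub_zero] at key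
  linarith

end IsJumpPrimitive

/-- Division by `stepExp` introduces the jumps of a linear equation. -/
theorem IsPrimitiveOn.isJumpPrimitive_div_stepExp {F ψ : ℝ≥0 → ℝ} (hF : IsPrimitiveOn 0 T F ψ)
    (hα : IntegrableOn α (Ioc 0 T)) (hJ : ∀ u ∈ J, 0 < u) :
    IsJumpPrimitive T J (fun t => F t / stepExp α J c t)
      (fun s => ψ s / stepExp α J c s + α s * (F s / stepExp α J c s))
      (fun u => ((c u)⁻¹ - 1) * Function.leftLim (fun t => F t / stepExp α J c t) u) := by
  set S : ℝ≥0 → ℝ := stepExp (fun s => -α s) J (fun u => (c u)⁻¹) with hS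
  simp only [div_eq_mul_inv, stepExp_inv, ← hS]
  have hα' : IntegrableOn (fun s => -α s) (Ioc 0 T) := hα.neg
  have hSc : IsCadlagOn T S := isCadlagOn_stepExp hα'
  have hFc := hF.continuousOn
  have hfc : IsCadlagOn T (fun t => F t * S t) := (isCadlagOn_of_continuousOn hFc).mul hSc
  set SL : ℝ≥0 → ℝ := stepExpLeft (fun s => -α s) J (fun u => (c u)⁻¹) with hSL
  have hleft : ∀ t ≤ T, Tendsto (fun t => F t * S t) (𝓝[<] t) (𝓝 (F t * SL t)) := fun t ht =>
    (tendsto_left_of_continuousOn hFc ht).mul (tendsto_stepExp_left hα' ht)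
  set φ : ℝ≥0 → ℝ := fun s => ψ s * S s + α s * (F s * S s) with hφ
  have hφi : IntegrableOn φ (Ioc 0 T) := (hSc.integrableOn_mul hF.1).add (hfc.integrableOn_mul hα)
  set β : ℝ≥0 → ℝ := fun u => ((c u)⁻¹ - 1) * Function.leftLim (fun t => F t * S t) u with hβ
  refine ⟨hφi, fun t ht => ?_⟩
  -- The subtracted jumps are exactly those of `F * S`, so `D` is continuous; between jumps the
  -- product rule makes it constant.
  set D : ℝ≥0 → ℝ := fun t => F t * S t - (∫ s in Ioc 0 t, φ s) - ∑ u ∈ J.filter (· ≤ t), β u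
    with hD
  have hIc := continuousOn_setIntegral_Ioc hφi
  have hDc : ContinuousOn D (Icc 0 T) := by
    refine continuousOn_Icc_of_left_of_right (fun t ht => ?_) fun t ht0 ht => ?_
    · refine (((hfc.1 t ht).sub (continuousWithinAt_right_of_continuousOn hIc ht)).sub
        (continuousWithinAt_const (b := ∑ u ∈ J.filter (· ≤ t), β u))).congr_of_eventuallyEq
        ?_ rfl
      filter_upwards [eventually_filter_le_right J t] with s hs
      simp only [hD]
      rw [hs]
      rfl
    · have h1 := ((hleft t ht).sub (tendsto_left_of_continuousOn hIc ht)).sub_const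
        (∑ u ∈ J.filter (· < t), β u)
      have h2 : D t = F t * SL t - (∫ s in Ioc 0 t, φ s) - ∑ u ∈ J.filter (· < t), β u := by
        simp only [hD]
        by_cases hmem : t ∈ J
        · rw [filter_le_of_mem hmem, Finset.sum_insert (by simp), hS, stepExp_of_mem hmem, ← hSL,
            hβ]
          simp only
          rw [leftLim_eq_time ht0 (hleft t ht)]
          ring
        · rw [filter_le_of_notMem hmem, hS, stepExp_of_notMem hmem]
      rw [h2]
      refine h1.congr' ?_
      filter_upwards [eventually_filter_le_left J t] with s hs
      simp only [hD]
      rw [hs]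
  have key : D t = D 0 := by
    refine eq_of_eq_off_finset J zero_le (hDc.mono (Icc_subset_Icc le_rfl ht))
      fun s u _ hsu hut hno => ?_
    have huT := hut.trans ht
    have h1 := (hF.mono (zero_le (a := s)) huT).mul (isPrimitiveOn_stepExp
      (c := fun u => (c u)⁻¹) hα' hsu huT hno)
    have h2 := h1.sub_eq le_rfl hsu le_rfl
    have h3 : ∫ v in Ioc s u, (ψ v * stepExp (fun s => -α s) J (fun u => (c u)⁻¹) v +
        - -α v * stepExp (fun s => -α s) J (fun u => (c u)⁻¹) v * F v) =
        ∫ v in Ioc s u, φ v := by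
      congr 1
      ext v
      simp only [hφ, hS]
      ring
    rw [h3] at h2
    simp only [hD]
    rw [filter_le_eq_of_forall_notMem hsu hno,
      setIntegral_Ioc_add zero_le hsu (integrableOn_Ioc_mono hφi le_rfl huT)]
    simp only [hS]
    linarith
  -- Positivity of the points of `J` enters here: a jump placed at `0` would be counted in the sum
  -- at time `0`.
  have h0 : J.filter (· ≤ 0) = ∅ := by
    rw [Finset.filter_eq_empty_iff]
    exact fun u hu hu0 => absurd (hJ u hu) (not_lt.2 hu0)
  simp only [hD, Ioc_self, setIntegral_empty, sub_zero, h0, Finset.sum_empty] at key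
  linarith

end Jumps

/-! ### The smoother equation and the robust equation along a fixed path -/

section Pathwise

variable {N : ℕ} {lam : Fin N → ℝ≥0 → CountingPath → ℝ} {T : ℝ≥0} {y : CountingPath}
  {A : ℝ≥0 → Matrix (Fin N) (Fin N) ℝ}

lemma isCadlagOn_pi {v : ℝ≥0 → Fin N → ℝ} :
    IsCadlagOn T v ↔ ∀ i, IsCadlagOn T (fun t => v t i) := by
  constructor
  · intro h i
    refine ⟨fun t ht => continuousWithinAt_pi.1 (h.1 t ht) i, fun t ht => ?_⟩
    obtain ⟨l, hl⟩ := h.2 t ht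
    exact ⟨l i, tendsto_pi_nhds.1 hl i⟩
  · intro h
    refine ⟨fun t ht => continuousWithinAt_pi.2 fun i => (h i).1 t ht, fun t ht => ?_⟩
    choose l hl using fun i => (h i).2 t ht
    exact ⟨l, tendsto_pi_nhds.2 hl⟩

lemma IsCadlagOn.leftLim_apply {v : ℝ≥0 → Fin N → ℝ} (h : IsCadlagOn T v) {t : ℝ≥0} (ht0 : 0 < t)
    (ht : t ≤ T) (i : Fin N) :
    Function.leftLim v t i = Function.leftLim (fun s => v s i) t := by
  obtain ⟨l, hl⟩ := h.2 t ht
  rw [leftLim_eq_time ht0 hl, leftLim_eq_time ht0 (tendsto_pi_nhds.1 hl i)]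

lemma IsCadlagOn.integrableOn_mul_leftLim {φ f : ℝ≥0 → ℝ} (hφ : IntegrableOn φ (Ioc 0 T))
    (hf : IsCadlagOn T f) : IntegrableOn (fun s => φ s * Function.leftLim f s) (Ioc 0 T) := by
  obtain ⟨C, hC⟩ := hf.exists_bound
  have hm : Measurable (fun t => Function.leftLim (fun s => f (min s T)) t) :=
    (measurable_uncurry_leftLim (Z := Unit) (x := fun t _ => f (min t T))
      (fun _ => measurable_const) fun _ => hf.stopped).comp
      (measurable_id.prodMk (measurable_const (a := ())))
  refine hφ.mul_bdd (c := C) (hm.aestronglyMeasurable.congr ?_) ?_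
  · filter_upwards [ae_restrict_mem measurableSet_Ioc] with s hs
    exact (leftLim_congr_time hs.1 (hf.2 s hs.2) fun u hu => by
      rw [min_eq_left (hu.le.trans hs.2)]).symm
  · filter_upwards [ae_restrict_mem measurableSet_Ioc] with s hs
    obtain ⟨l, hl⟩ := hf.2 s hs.2
    rw [leftLim_eq_time hs.1 hl]
    have := nhdsLT_neBot_time hs.1
    refine le_of_tendsto hl.norm ?_
    filter_upwards [self_mem_nhdsWithin] with u hu
    exact hC u ((le_of_lt hu).trans hs.2)

/-- Vector form of a system of scalar integral equations. -/
lemma IsPrimitiveOn.pi {a b : ℝ≥0} {f φ : ℝ≥0 → Fin N → ℝ}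
    (h : ∀ i, IsPrimitiveOn a b (fun t => f t i) (fun t => φ t i)) :
    IntegrableOn φ (Ioc a b) ∧ ∀ t, a ≤ t → t ≤ b → f t = f a + ∫ s in Ioc a t, φ s := by
  refine ⟨Integrable.of_eval fun i => (h i).1, fun t hat htb => ?_⟩
  ext i
  rw [Pi.add_apply, eval_integral fun i => integrableOn_Ioc_mono (h i).1 le_rfl htb]
  exact (h i).2 t hat htb

lemma gam_eq_stepExp {t : ℝ≥0} (ht : t ≤ T) (i : Fin N) :
    gam lam y t i = stepExp (fun u => lam i u y - 1) (y.jumpTimes T) (fun u => lam i u y) t := by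
  rw [gam, pathLikelihood, stepExp, y.jumpTimes_eq_filter ht]
  simp only [rate_constPath]

lemma IsGood.integrableOn_sub_one (hy : IsGood lam T y) (i : Fin N) :
    IntegrableOn (fun u => lam i u y - 1) (Ioc 0 T) :=
  (hy i).sub (integrableOn_const_time 1 0 T)

lemma isCadlagOn_gam (hy : IsGood lam T y) (i : Fin N) :
    IsCadlagOn T (fun t => gam lam y t i) := by
  have h := isCadlagOn_stepExp (J := y.jumpTimes T) (c := fun u => lam i u y)
    (hy.integrableOn_sub_one i)
  refine ⟨fun t ht => ((h.1 t ht).congr_of_eventuallyEq ?_ (gam_eq_stepExp ht.le i)),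
    fun t ht => ?_⟩
  · filter_upwards [Ico_mem_nhdsGE ht] with s hs using gam_eq_stepExp hs.2.le i
  · obtain ⟨l, hl⟩ := h.2 t ht
    refine ⟨l, hl.congr' ?_⟩
    filter_upwards [self_mem_nhdsWithin] with s hs
    exact (gam_eq_stepExp ((le_of_lt hs).trans ht) i).symm

lemma Gam_inv (hlam : IsIntensity lam) (t : ℝ≥0) :
    (Gam lam y t)⁻¹ = Matrix.diagonal fun i => (gam lam y t i)⁻¹ := by
  refine Matrix.inv_eq_right_inv ?_
  rw [Gam_eq, Matrix.diagonal_mul_diagonal, ← Matrix.diagonal_one]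
  congr 1
  ext i
  exact mul_inv_cancel₀ (gam_pos hlam t i).ne'

lemma Lam_inv (hlam : IsIntensity lam) (t : ℝ≥0) :
    (Lam lam y t)⁻¹ = Matrix.diagonal fun i => (lam i t y)⁻¹ := by
  refine Matrix.inv_eq_right_inv ?_
  rw [Lam, Matrix.diagonal_mul_diagonal, ← Matrix.diagonal_one]
  congr 1
  ext i
  exact mul_inv_cancel₀ (hlam.pos i t y).ne'

lemma Gam_inv_mul_mul_mulVec (hlam : IsIntensity lam) (s : ℝ≥0) (M : Matrix (Fin N) (Fin N) ℝ)
    (w : Fin N → ℝ) (i : Fin N) :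
    (((Gam lam y s)⁻¹ * M * Gam lam y s) *ᵥ w) i =
      ∑ j, M i j * (gam lam y s j / gam lam y s i * w j) := by
  rw [Gam_inv hlam, Gam_eq, Matrix.mulVec, dotProduct]
  refine Finset.sum_congr rfl fun j _ => ?_
  rw [Matrix.mul_diagonal, Matrix.diagonal_mul]
  ring

/-- The coefficient of the robust smoother equation. -/
def backwardRate (A : ℝ≥0 → Matrix (Fin N) (Fin N) ℝ) (lam : Fin N → ℝ≥0 → CountingPath → ℝ)
    (y : CountingPath) (s : ℝ≥0) (w : Fin N → ℝ) (i : Fin N) : ℝ :=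
  ∑ j, gam lam y s i * A s j i / gam lam y s j * w j

lemma Gam_mul_mul_inv_mulVec (hlam : IsIntensity lam) (s : ℝ≥0) (w : Fin N → ℝ) (i : Fin N) :
    ((Gam lam y s * (A s)ᵀ * (Gam lam y s)⁻¹) *ᵥ w) i = backwardRate A lam y s w i := by
  rw [Gam_inv hlam, Gam_eq, Matrix.mulVec, dotProduct]
  refine Finset.sum_congr rfl fun j _ => ?_
  rw [Matrix.mul_diagonal, Matrix.diagonal_mul, Matrix.transpose_apply]
  ring

lemma Gam_mulVec (t : ℝ≥0) (w : Fin N → ℝ) (i : Fin N) :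
    (Gam lam y t *ᵥ w) i = gam lam y t i * w i := by
  rw [Gam_eq, Matrix.mulVec_diagonal]

lemma smootherDrift_apply (s : ℝ≥0) (w : Fin N → ℝ) (i : Fin N) :
    (((A s)ᵀ - Lam lam y s + 1) *ᵥ w) i = ∑ j, A s j i * w j - (lam i s y - 1) * w i := by
  rw [Matrix.add_mulVec, Matrix.sub_mulVec, Matrix.one_mulVec, Lam, Pi.add_apply, Pi.sub_apply,
    Matrix.mulVec_diagonal, Matrix.mulVec, dotProduct]
  simp only [Matrix.transpose_apply]
  ring

lemma smootherJump_apply (hlam : IsIntensity lam) (s : ℝ≥0) (w : Fin N → ℝ) (i : Fin N) :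
    (((Lam lam y s)⁻¹ - 1) *ᵥ w) i = ((lam i s y)⁻¹ - 1) * w i := by
  rw [Matrix.sub_mulVec, Matrix.one_mulVec, Lam_inv hlam]
  simp only [Pi.sub_apply, Matrix.mulVec_diagonal]
  ring

/-- The smoother equation componentwise. -/
lemma solvesSmootherEq_iff (hA : IsRateMatrix A) (hlam : IsIntensity lam) (hy : IsGood lam T y)
    {v : ℝ≥0 → Fin N → ℝ} (hv : IsCadlagOn T v) :
    SolvesSmootherEq A T lam y v ↔ v T = 1 ∧ ∀ i,
      IsJumpPrimitive T (y.jumpTimes T) (fun t => v t i)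
        (fun s => -(∑ j, A s j i * Function.leftLim (fun t => v t j) s) +
          (lam i s y - 1) * Function.leftLim (fun t => v t i) s)
        (fun u => ((lam i u y)⁻¹ - 1) * Function.leftLim (fun t => v t i) u) := by
  have hvi := isCadlagOn_pi.1 hv
  -- `SolvesSmootherEq` does not demand integrability of its drift. It follows from the boundedness
  -- of càdlàg paths and allows the vector integral to be read by components.
  have hint : ∀ i, IntegrableOn (fun s => -(∑ j, A s j i * Function.leftLim (fun t => v t j) s) +
      (lam i s y - 1) * Function.leftLim (fun t => v t i) s) (Ioc 0 T) := fun i =>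
    (integrable_finsetSum _ fun j _ =>
      IsCadlagOn.integrableOn_mul_leftLim (hA.integrable j i T) (hvi j)).neg.add
      (IsCadlagOn.integrableOn_mul_leftLim (hy.integrableOn_sub_one i) (hvi i))
  have hdrift : ∀ i, ∀ s ∈ Ioc 0 T, (((A s)ᵀ - Lam lam y s + 1) *ᵥ Function.leftLim v s) i =
      -(-(∑ j, A s j i * Function.leftLim (fun t => v t j) s) +
        (lam i s y - 1) * Function.leftLim (fun t => v t i) s) := fun i s hs => by
    rw [smootherDrift_apply]
    simp only [hv.leftLim_apply hs.1 hs.2]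
    ring
  have hdint : ∀ i, IntegrableOn
      (fun s => (((A s)ᵀ - Lam lam y s + 1) *ᵥ Function.leftLim v s) i) (Ioc 0 T) := fun i => by
    refine (hint i).neg.congr ?_
    filter_upwards [ae_restrict_mem measurableSet_Ioc] with s hs
    rw [hdrift i s hs]
    rfl
  have key : ∀ t ≤ T, ∀ i,
      (v 0 - (∫ s in Ioc 0 t, ((A s)ᵀ - Lam lam y s + 1) *ᵥ Function.leftLim v s) +
        ∑ᶠ s ∈ Ioc 0 t, (jump y s : ℝ) • (((Lam lam y s)⁻¹ - 1) *ᵥ Function.leftLim v s) :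
        Fin N → ℝ) i =
      v 0 i + (∫ s in Ioc 0 t, (-(∑ j, A s j i * Function.leftLim (fun t => v t j) s) +
          (lam i s y - 1) * Function.leftLim (fun t => v t i) s)) +
        ∑ u ∈ (y.jumpTimes T).filter (· ≤ t),
          ((lam i u y)⁻¹ - 1) * Function.leftLim (fun t => v t i) u := by
    intro t ht i
    rw [Pi.add_apply, Pi.sub_apply,
      eval_integral fun i => integrableOn_Ioc_mono (hdint i) le_rfl ht,
      CountingPath.finsum_jump_smul, Finset.sum_apply, y.jumpTimes_eq_filter ht,
      setIntegral_congr_fun measurableSet_Ioc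
        fun s hs => hdrift i s ⟨hs.1, hs.2.trans ht⟩, integral_neg, sub_neg_eq_add]
    congr 1
    refine Finset.sum_congr rfl fun u hu => ?_
    have hu' := (y.mem_jumpTimes).1 (Finset.mem_filter.1 hu).1
    rw [smootherJump_apply hlam, hv.leftLim_apply hu'.1.1 hu'.1.2]
  refine and_congr_right fun _ => ⟨fun h i => ⟨hint i, fun t ht => ?_⟩, fun h t ht => ?_⟩
  · rw [← key t ht i, ← h t ht]
  · ext i
    rw [key t ht i]
    exact (h i).eq t ht

lemma IsJumpPrimitive.ae_leftLim_eq {J : Finset ℝ≥0} {f φ β : ℝ≥0 → ℝ}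
    (h : IsJumpPrimitive T J f φ β) :
    ∀ᵐ s ∂volume.restrict (Ioc 0 T), Function.leftLim f s = f s := by
  have hJ : ∀ᵐ s ∂(volume : Measure ℝ≥0), s ∉ J :=
    measure_eq_zero_iff_ae_notMem.1 (J.finite_toSet.measure_zero volume)
  filter_upwards [ae_restrict_mem measurableSet_Ioc, ae_restrict_of_ae hJ] with s hs hsJ
  rw [h.leftLim_eq hs.1 hs.2, if_neg hsJ]

lemma backwardRate_gam_mul (hlam : IsIntensity lam) (s : ℝ≥0) (w : Fin N → ℝ) (i : Fin N) :
    backwardRate A lam y s (fun j => gam lam y s j * w j) i =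
      gam lam y s i * ∑ j, A s j i * w j := by
  rw [backwardRate, Finset.mul_sum]
  refine Finset.sum_congr rfl fun j _ => ?_
  have := (gam_pos hlam (y := y) s j).ne'
  field_simp

/-- The transformation to robust form removes the jumps of the smoother equation. -/
theorem SolvesSmootherEq.isPrimitiveOn (hA : IsRateMatrix A) (hlam : IsIntensity lam)
    (hy : IsGood lam T y) {v : ℝ≥0 → Fin N → ℝ} (hv : IsCadlagOn T v)
    (h : SolvesSmootherEq A T lam y v) (i : Fin N) :
    IsPrimitiveOn 0 T (fun t => gam lam y t i * v t i)
      (fun s => -backwardRate A lam y s (fun j => gam lam y s j * v s j) i) := by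
  have hJ := ((solvesSmootherEq_iff hA hlam hy hv).1 h).2
  -- With `α = λ_i - 1` and `c = λ_i` the integrating factor is `Γ_i` on `[0, T]`, and the diagonal
  -- drift `(λ_i - 1) v_i` cancels; only the rates remain.
  have h1 := (hJ i).isPrimitiveOn_stepExp_mul (hy.integrableOn_sub_one i)
    (fun u => (hlam.pos i u y).ne')
  refine (h1.congr zero_le fun t ht => by rw [gam_eq_stepExp ht.2]).congr_deriv ?_
  have hae : ∀ᵐ s ∂volume.restrict (Ioc 0 T), ∀ j,
      Function.leftLim (fun t => v t j) s = v s j := ae_all_iff.2 fun j => (hJ j).ae_leftLim_eq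
  filter_upwards [ae_restrict_mem measurableSet_Ioc, hae] with s hs hs'
  rw [backwardRate_gam_mul hlam, gam_eq_stepExp hs.2]
  simp only [hs']
  ring

/-- A solution of the robust equation yields a solution of the smoother equation. -/
theorem solvesSmootherEq_of_isPrimitiveOn (hA : IsRateMatrix A) (hlam : IsIntensity lam)
    (hy : IsGood lam T y) {v : ℝ≥0 → Fin N → ℝ} (hvT : v T = 1)
    (h : ∀ i, IsPrimitiveOn 0 T (fun t => gam lam y t i * v t i)
      (fun s => -backwardRate A lam y s (fun j => gam lam y s j * v s j) i)) :
    IsCadlagOn T v ∧ SolvesSmootherEq A T lam y v := by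
  set S : Fin N → ℝ≥0 → ℝ :=
    fun i => stepExp (fun u => lam i u y - 1) (y.jumpTimes T) (fun u => lam i u y) with hS
  have hS0 : ∀ i t, S i t ≠ 0 := fun i t =>
    mul_ne_zero (Real.exp_ne_zero _) (Finset.prod_ne_zero_iff.2 fun u _ => (hlam.pos i u y).ne')
  have hJ : ∀ i, IsJumpPrimitive T (y.jumpTimes T) (fun t => v t i)
      (fun s => -backwardRate A lam y s (fun j => gam lam y s j * v s j) i / S i s +
        (lam i s y - 1) * v s i)
      (fun u => ((lam i u y)⁻¹ - 1) * Function.leftLim (fun t => v t i) u) := fun i => by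
    have h1 : IsPrimitiveOn 0 T (fun t => S i t * v t i)
        (fun s => -backwardRate A lam y s (fun j => gam lam y s j * v s j) i) :=
      (h i).congr zero_le fun t ht => by rw [gam_eq_stepExp ht.2]
    have h2 := h1.isJumpPrimitive_div_stepExp (hy.integrableOn_sub_one i)
      (J := y.jumpTimes T) (c := fun u => lam i u y) fun u hu => (y.mem_jumpTimes.1 hu).1.1
    have e : ∀ t, S i t * v t i / stepExp (fun u => lam i u y - 1) (y.jumpTimes T)
        (fun u => lam i u y) t = v t i := fun t => mul_div_cancel_left₀ _ (hS0 i t)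
    simp only [e] at h2
    exact h2
  have hv : IsCadlagOn T v := isCadlagOn_pi.2 fun i => (hJ i).isCadlagOn
  refine ⟨hv, (solvesSmootherEq_iff hA hlam hy hv).2 ⟨hvT, fun i => ?_⟩⟩
  have hae : ∀ᵐ s ∂volume.restrict (Ioc 0 T), ∀ j,
      Function.leftLim (fun t => v t j) s = v s j := ae_all_iff.2 fun j => (hJ j).ae_leftLim_eq
  have hae2 : ∀ᵐ s ∂volume.restrict (Ioc 0 T),
      -backwardRate A lam y s (fun j => gam lam y s j * v s j) i / S i s +
        (lam i s y - 1) * v s i =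
      -(∑ j, A s j i * Function.leftLim (fun t => v t j) s) +
          (lam i s y - 1) * Function.leftLim (fun t => v t i) s := by
    filter_upwards [ae_restrict_mem measurableSet_Ioc, hae] with s hs hs'
    have h0 := hS0 i s
    rw [backwardRate_gam_mul hlam, gam_eq_stepExp hs.2]
    simp only [hs']
    change -(S i s * _) / S i s + _ = _
    rw [neg_div, mul_div_cancel_left₀ _ h0]
  refine ⟨(hJ i).integrableOn.congr hae2, fun t ht => ?_⟩
  rw [(hJ i).eq t ht, integral_congr_ae
    (ae_mono (Measure.restrict_mono (Ioc_subset_Ioc le_rfl ht) le_rfl) hae2)]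

end Pathwise

/-! ### The filter and smoothing vectors -/

section Smoothing

variable {Ω : Type*} {mΩ : MeasurableSpace Ω} {Q : Measure Ω} [IsProbabilityMeasure Q] {N : ℕ}
  {A : ℝ≥0 → Matrix (Fin N) (Fin N) ℝ} {X : Ω → StatePath N} {hX : Measurable X}
  {Y : Ω → CountingPath} {hY : Measurable Y} {lam : Fin N → ℝ≥0 → CountingPath → ℝ} {T : ℝ≥0}
  {y : CountingPath}

/-- Càdlàg modifications on an upward closed set of times are indistinguishable. -/
lemma ae_forall_eq_of_forall_ae_eq {Q : Measure Ω} {E : Type*} [TopologicalSpace E] [T2Space E]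
    {f g : ℝ≥0 → Ω → E} (hf : ∀ᵐ ω ∂Q, IsCadlagOn T (fun t => f t ω))
    (hg : ∀ᵐ ω ∂Q, IsCadlagOn T (fun t => g t ω)) {S : Set ℝ≥0}
    (hS : ∀ s ∈ S, ∀ t, s ≤ t → t ≤ T → t ∈ S) (hST : ∀ t ∈ S, t ≤ T)
    (h : ∀ t ∈ S, f t =ᵐ[Q] g t) : ∀ᵐ ω ∂Q, ∀ t ∈ S, f t ω = g t ω := by
  -- The time `T` is treated apart, since `IsCadlagOn` says nothing about the right of `T`.
  have h1 : ∀ᵐ ω ∂Q, T ∈ S → f T ω = g T ω := by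
    by_cases hT : T ∈ S
    · filter_upwards [h T hT] with ω hω _ using hω
    · exact ae_of_all _ fun _ hT' => absurd hT' hT
  have h2 : ∀ᵐ ω ∂Q, ∀ n, TopologicalSpace.denseSeq ℝ≥0 n ∈ S →
      f (TopologicalSpace.denseSeq ℝ≥0 n) ω = g (TopologicalSpace.denseSeq ℝ≥0 n) ω := by
    refine ae_all_iff.2 fun n => ?_
    by_cases hn : TopologicalSpace.denseSeq ℝ≥0 n ∈ S
    · filter_upwards [h _ hn] with ω hω _ using hω
    · exact ae_of_all _ fun _ hn' => absurd hn' hn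
  filter_upwards [hf, hg, h1, h2] with ω hfω hgω hω1 hω2 t ht
  rcases eq_or_lt_of_le (hST t ht) with rfl | htT
  · exact hω1 ht
  by_contra hne
  -- A difference at `t` would persist to the right and reach a dense time, which lies in `S`
  -- because `S` is upward closed.
  have hev : ∀ᶠ s in 𝓝[≥] t, f s ω ≠ g s ω :=
    ((hfω.1 t htT).tendsto.prodMk_nhds (hgω.1 t htT).tendsto).eventually
      (isClosed_diagonal.isOpen_compl.mem_nhds hne)
  obtain ⟨c, hc1, hc2⟩ := (mem_nhdsGE_iff_exists_Ico_subset' htT).1 hev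
  obtain ⟨n, hs⟩ := (TopologicalSpace.denseRange_denseSeq ℝ≥0).exists_mem_open
    (isOpen_Ioo (a := t) (b := min c T)) (nonempty_Ioo.2 (lt_min hc1 htT))
  exact hc2 ⟨hs.1.le, hs.2.trans_le (min_le_left _ _)⟩
    (hω2 n (hS t ht _ hs.1.le (hs.2.le.trans (min_le_right _ _))))

lemma gam_mul_robust {Q : Measure Ω} (hlam : IsIntensity lam) (G : Ω → ℝ) (t : ℝ≥0) (i : Fin N) :
    gam lam y t i * robust Q lam X G y t i =
      ∫ ω, G ω * (pathLikelihood lam (X ω) y t * basisVec ((X ω).1 t) i) ∂Q := by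
  rw [robust, ← integral_const_mul]
  congr 1
  ext ω
  have := (gam_pos hlam (y := y) t i).ne'
  rw [ratio]
  field_simp

lemma gam_mul_robust_one {Q : Measure Ω} (hlam : IsIntensity lam) (t : ℝ≥0) (i : Fin N) :
    gam lam y t i * robust Q lam X (fun _ => 1) y t i = weightedProb Q lam X t t y i := by
  rw [gam_mul_robust hlam]
  simp only [one_mul]
  rfl

lemma weightedProb_nonneg {Q : Measure Ω} (hlam : IsIntensity lam) (s t : ℝ≥0) (i : Fin N) :
    0 ≤ weightedProb Q lam X s t y i :=
  integral_nonneg fun _ => mul_nonneg (pathLikelihood_pos hlam _ _).le (basisVec_nonneg _ _)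

/-- The likelihood is strictly positive, so whether a component of the filter vanishes is decided by
the law of the chain and not by the observation. -/
lemma weightedProb_pos_iff (hlam : IsIntensity lam) (hX : Measurable X) (hy : IsGood lam T y)
    {t : ℝ≥0} (ht : t ≤ T) (i : Fin N) :
    0 < weightedProb Q lam X t t y i ↔ Q {ω | (X ω).1 t = i} ≠ 0 := by
  rw [weightedProb, integral_pos_iff_support_of_nonneg
    (fun _ => mul_nonneg (pathLikelihood_pos hlam _ _).le (basisVec_nonneg _ _))
    (integrable_weighted hlam hX hy ht t i), pos_iff_ne_zero]
  have : (Function.support fun ω => pathLikelihood lam (X ω) y t * basisVec ((X ω).1 t) i) =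
      {ω | (X ω).1 t = i} := by
    ext ω
    rw [Function.mem_support, mul_ne_zero_iff_left (pathLikelihood_pos hlam _ _).ne',
      basisVec_apply, mem_ofPred_eq, ite_ne_right_iff, eq_comm]
    simp
  rw [this]

lemma robust_pos_iff (hlam : IsIntensity lam) (hX : Measurable X) (hy : IsGood lam T y)
    {t : ℝ≥0} (ht : t ≤ T) (i : Fin N) :
    0 < robust Q lam X (fun _ => 1) y t i ↔ Q {ω | (X ω).1 t = i} ≠ 0 := by
  rw [← weightedProb_pos_iff hlam hX hy ht, ← gam_mul_robust_one hlam,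
    mul_pos_iff_of_pos_left (gam_pos hlam t i)]

lemma robust_nonneg {Q : Measure Ω} (hlam : IsIntensity lam) (t : ℝ≥0) (i : Fin N) :
    0 ≤ robust Q lam X (fun _ => 1) y t i := by
  have h := weightedProb_nonneg (Q := Q) (X := X) (y := y) hlam t t i
  rw [← gam_mul_robust_one hlam] at h
  exact nonneg_of_mul_nonneg_right h (gam_pos hlam t i)

lemma isPrimitiveOn_robust_one (hA : IsRateMatrix A)
    (hM : Martingale (chainNoise A X) (fullFiltration X hX Y hY) Q) (hlam : IsIntensity lam)
    (hy : IsGood lam T y) (i : Fin N) :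
    IsPrimitiveOn 0 T (fun t => robust Q lam X (fun _ => 1) y t i)
      (fun s => ∑ j, A s i j * (gam lam y s j / gam lam y s i *
        robust Q lam X (fun _ => 1) y s j)) :=
  isPrimitiveOn_robust hA hM hlam hy (c := 1) measurable_const (fun _ => by simp) i

/-- The filter has a càdlàg version. -/
lemma isCadlagOn_weightedProb (hA : IsRateMatrix A)
    (hM : Martingale (chainNoise A X) (fullFiltration X hX Y hY) Q) (hlam : IsIntensity lam)
    (hy : IsGood lam T y) : IsCadlagOn T (fun t => weightedProb Q lam X t t y) := by
  refine isCadlagOn_pi.2 fun i => ?_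
  simp only [← gam_mul_robust_one hlam]
  exact (isCadlagOn_gam hy i).mul
    (isCadlagOn_of_continuousOn (isPrimitiveOn_robust_one hA hM hlam hy i).continuousOn)

/-- Solutions of the robust smoother equation are in duality with conditional expectations. -/
theorem weightedProb_eq_mul (hA : IsRateMatrix A)
    (hM : Martingale (chainNoise A X) (fullFiltration X hX Y hY) Q) (hlam : IsIntensity lam)
    (hy : IsGood lam T y) {V : ℝ≥0 → Fin N → ℝ} (hVT : ∀ i, V T i = gam lam y T i)
    (hV : ∀ i, IsPrimitiveOn 0 T (fun t => V t i) (fun s => -backwardRate A lam y s (V s) i))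
    {r : ℝ≥0} (hr : r ≤ T) (i : Fin N) :
    weightedProb Q lam X T r y i = V r i / gam lam y r i * weightedProb Q lam X r r y i := by
  -- This weight starts the forward equation at time `r` with all its mass in state `i`.
  set G : Ω → ℝ := fun ω => basisVec ((X ω).1 r) i with hG
  have hGi : ∀ t ≤ T, ∀ j, Integrable
      (fun ω => G ω * (pathLikelihood lam (X ω) y t * basisVec ((X ω).1 t) j)) Q := fun t ht j =>
    integrable_mul_of_bdd (c := 1) (measurable_basisVec hX r i).aestronglyMeasurable
      (fun _ => abs_basisVec_le _ _) (integrable_weighted hlam hX hy ht t j)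
  have hu := fun j => isPrimitiveOn_robust hA hM hlam hy (G := G) (c := 1)
    (measurable_basisVec_fullFiltration hX r i) (fun _ => abs_basisVec_le _ _) j
  have h1 := IsPrimitiveOn.sum Finset.univ fun j _ =>
    ((hV j).mono (zero_le (a := r)) le_rfl).mul (hu j)
  -- The forward and backward matrices are transposes of each other, so the pairing of the two
  -- solutions has derivative zero.
  have h2 : ∀ s, ∑ j, (-backwardRate A lam y s (V s) j * robust Q lam X G y s j +
      (∑ k, A s j k * (gam lam y s k / gam lam y s j * robust Q lam X G y s k)) * V s j) = 0 := by
    intro s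
    simp only [backwardRate, neg_mul, Finset.sum_add_distrib, Finset.sum_neg_distrib,
      Finset.sum_mul]
    rw [neg_add_eq_zero, Finset.sum_comm]
    exact Finset.sum_congr rfl fun j _ => Finset.sum_congr rfl fun k _ => by ring
  have h3 := h1.2 T hr le_rfl
  simp only [h2, integral_zero, add_zero] at h3
  have hT : ∑ j, V T j * robust Q lam X G y T j = weightedProb Q lam X T r y i := by
    simp only [hVT, gam_mul_robust hlam]
    rw [← integral_finsetSum _ fun j _ => hGi T le_rfl j, weightedProb]
    congr 1
    ext ω
    rw [← Finset.mul_sum, ← Finset.mul_sum]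
    simp [basisVec_apply, hG, mul_comm]
  have hr' : ∑ j, V r j * robust Q lam X G y r j =
      V r i / gam lam y r i * weightedProb Q lam X r r y i := by
    rw [Finset.sum_eq_single i]
    · have e : gam lam y r i * robust Q lam X G y r i = weightedProb Q lam X r r y i := by
        rw [gam_mul_robust hlam, weightedProb]
        congr 1
        ext ω
        simp only [hG, basisVec_apply]
        split_ifs <;> ring
      rw [← e]
      have := (gam_pos hlam (y := y) r i).ne'
      field_simp
    · intro j _ hj
      have e : robust Q lam X G y r j = 0 := by
        rw [robust]
        refine integral_eq_zero_of_ae (ae_of_all _ fun ω => ?_)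
        simp only [hG, basisVec_apply, Pi.zero_apply]
        split_ifs with h h' <;> first | exact absurd (h'.trans h.symm) hj | simp
      rw [e, mul_zero]
    · simp
  rw [← hT, h3, hr']

lemma IsPrimitiveOn.backward {a b : ℝ≥0} {f φ : ℝ≥0 → ℝ}
    (h : IsPrimitiveOn a b f (fun s => -φ s)) :
    IntegrableOn φ (Ioc a b) ∧ ∀ t, a ≤ t → t ≤ b →
      f t = f a - (∫ s in Ioc a t, φ s) ∧ f t = f b + ∫ s in Ioc t b, φ s := by
  refine ⟨by simpa using h.1.neg, fun t hat htb => ⟨?_, ?_⟩⟩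
  · rw [h.2 t hat htb, integral_neg, sub_eq_add_neg]
  · have := h.sub_eq hat htb le_rfl
    rw [integral_neg] at this
    linarith

lemma gam_stopObs (hlam : IsIntensity lam) {t : ℝ≥0} (ht : t ≤ T) (y : CountingPath) (i : Fin N) :
    gam lam (stopObs T y) t i = gam lam y t i :=
  pathLikelihood_congr hlam (fun _ _ => rfl) fun _ hs => stopObs_apply (hs.trans ht) y

lemma IsGood.stopObs (hlam : IsIntensity lam) (hy : IsGood lam T y) :
    IsGood lam T (stopObs T y) := fun i =>
  (hy i).congr_fun (fun _ hs => eq_of_isStronglyPredictable (hlam.predictable i)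
    fun _ hu => (stopObs_apply (hu.trans hs.2) y).symm) measurableSet_Ioc

lemma measurable_gam_pathFiltration (hlam : IsIntensity lam) {t : ℝ≥0} (ht : t ≤ T) (i : Fin N) :
    Measurable[pathFiltration IsCountingPath T] (fun y => gam lam y t i) :=
  measurable_pathFiltration_of_congr ((measurable_gam hlam i).comp
    (measurable_const.prodMk measurable_id)) fun y => gam_stopObs hlam ht y i

/-- The robust smoother equation has a solution which depends measurably on the observations. -/
theorem exists_robust_smoother (hA : IsRateMatrix A) (hlam : IsIntensity lam) (T : ℝ≥0) :
    ∃ V : ℝ≥0 → CountingPath → Fin N → ℝ,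
      (∀ t ≤ T, ∀ i, Measurable[pathFiltration IsCountingPath T] fun y => V t y i) ∧
      ∀ y, IsGood lam T y → (∀ i, V T y i = gam lam y T i) ∧
        ∀ i, IsPrimitiveOn 0 T (fun t => V t y i)
          (fun s => -backwardRate A lam y s (V s y) i) := by
  -- Integrability makes the rates measurable only up to null sets, whereas the parametrised
  -- solution needs jointly measurable coefficients.
  set A' : Fin N → Fin N → ℝ≥0 → ℝ := fun i j => (hA.integrable i j T).1.mk with hA'
  have hA'm : ∀ i j, Measurable (A' i j) := fun i j =>
    (hA.integrable i j T).1.stronglyMeasurable_mk.measurable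
  have hA'e : ∀ i j, ∀ᵐ s ∂volume.restrict (Ioc 0 T), A s i j = A' i j s := fun i j =>
    (hA.integrable i j T).1.ae_eq_mk
  set k : ℝ≥0 → CountingPath → Matrix (Fin N) (Fin N) ℝ := fun s y => Matrix.of fun i j =>
    A' j i s * (gam lam y s i / gam lam y s j) with hk
  have hkm : ∀ i j, Measurable (fun p : ℝ≥0 × CountingPath => k p.1 p.2 i j) := fun i j =>
    ((hA'm j i).comp measurable_fst).mul ((measurable_gam hlam i).div (measurable_gam hlam j))
  obtain ⟨V, hVm, hV⟩ := exists_measurable_solution (T := T) hkm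
    (w := fun y i => gam lam y T i)
    fun i => (measurable_gam hlam i).comp (measurable_const.prodMk measurable_id)
  -- Stopping the observation at `T` makes the solution measurable for the past up to `T`, without
  -- changing the coefficients on `]0, T]`.
  refine ⟨fun t y => V t (stopObs T y),
    fun t ht i => (hVm t ht i).comp (measurable_stopPath IsCountingPath.comp_min T),
    fun y hy => ?_⟩
  obtain ⟨c, C, hc, hC, hb⟩ := exists_pathLikelihood_bounds hlam (hy.stopObs hlam)
  obtain ⟨h1, h2⟩ := hV (stopObs T y) fun i j => by
    refine (((hA.integrable j i T).congr (hA'e j i))).mul_bdd (c := C / c)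
      ((measurable_gam_time hlam _ i).div (measurable_gam_time hlam _ j)).aestronglyMeasurable ?_
    filter_upwards [ae_restrict_mem measurableSet_Ioc] with s hs
    rw [Real.norm_eq_abs, abs_of_pos (div_pos (gam_pos hlam s i) (gam_pos hlam s j))]
    exact div_le_div₀ hC.le (hb _ s hs.2).2 hc (hb _ s hs.2).1
  refine ⟨fun i => (h1 i).trans (gam_stopObs hlam le_rfl y i), fun i =>
    (h2 i).congr_deriv ?_⟩
  filter_upwards [ae_restrict_mem measurableSet_Ioc, ae_all_iff.2 fun j => hA'e j i] with s hs hs'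
  rw [backwardRate]
  refine congrArg _ (Finset.sum_congr rfl fun j _ => ?_)
  simp only [hk, Matrix.of_apply, gam_stopObs hlam hs.2, hs']
  ring

/-! ### Occupied and unoccupied states. -/

/-- A component of a nonnegative solution of a quasi-monotone linear system stays positive. -/
lemma pos_of_isPrimitiveOn {B : ℝ≥0 → Matrix (Fin N) (Fin N) ℝ} {u : ℝ≥0 → Fin N → ℝ} {i : Fin N}
    (hu : ∀ t j, 0 ≤ u t j) (hB : ∀ t j, i ≠ j → 0 ≤ B t i j)
    (hBi : IntegrableOn (fun s => B s i i) (Ioc 0 T))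
    (h : IsPrimitiveOn 0 T (fun t => u t i) (fun s => ∑ j, B s i j * u s j)) {r t : ℝ≥0}
    (hrt : r ≤ t) (ht : t ≤ T) (hr : 0 < u r i) : 0 < u t i := by
  -- The factor `exp (-∫ B i i)` removes the diagonal term. What is left of the derivative is
  -- nonnegative, so the product does not decrease.
  have h1 := (IsPrimitiveOn.of_integral hBi.neg 0).exp.mul h
  have h2 := h1.sub_eq zero_le hrt ht
  have h3 : 0 ≤ Real.exp (0 + ∫ s in Ioc 0 t, -B s i i) * u t i -
      Real.exp (0 + ∫ s in Ioc 0 r, -B s i i) * u r i := by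
    refine h2.symm ▸ integral_nonneg fun s => ?_
    have e : ∑ j, B s i j * u s j = B s i i * u s i +
        ∑ j ∈ Finset.univ.erase i, B s i j * u s j :=
      (Finset.add_sum_erase _ _ (Finset.mem_univ i)).symm
    have h4 : 0 ≤ ∑ j ∈ Finset.univ.erase i, B s i j * u s j := Finset.sum_nonneg fun j hj =>
      mul_nonneg (hB s j (Finset.ne_of_mem_erase hj).symm) (hu s j)
    have h5 := mul_nonneg h4 (Real.exp_pos (0 + ∫ s in Ioc 0 s, -B s i i)).le
    simp only [e, Pi.zero_apply, Pi.neg_apply]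
    linarith
  have h6 := mul_pos (Real.exp_pos (0 + ∫ s in Ioc 0 r, -B s i i)) hr
  exact (mul_pos_iff_of_pos_left (Real.exp_pos (0 + ∫ s in Ioc 0 t, -B s i i))).1 (by linarith)

/-- The rates from occupied into unoccupied components vanish. -/
lemma ae_rate_eq_zero {B : ℝ≥0 → Matrix (Fin N) (Fin N) ℝ} {u : ℝ≥0 → Fin N → ℝ} {j : Fin N}
    (hu : ∀ t i, 0 ≤ u t i) (hB : ∀ t i, j ≠ i → 0 ≤ B t j i)
    (hBj : IntegrableOn (fun s => B s j j) (Ioc 0 T))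
    (h : IsPrimitiveOn 0 T (fun t => u t j) (fun s => ∑ i, B s j i * u s i)) :
    ∀ᵐ s ∂volume.restrict (Ioc 0 T), u s j = 0 → ∀ i, 0 < u s i → B s j i = 0 := by
  set Z : Set ℝ≥0 := Icc 0 T ∩ (fun t => u t j) ⁻¹' {0} with hZ
  rcases Z.eq_empty_or_nonempty with hZe | hZn
  · filter_upwards [ae_restrict_mem measurableSet_Ioc] with s hs hs0
    have : s ∈ Z := ⟨Ioc_subset_Icc_self hs, hs0⟩
    simp [hZe] at this
  have hZc : IsCompact Z := isCompact_Icc.of_isClosed_subset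
    (h.continuousOn.preimage_isClosed_of_isClosed isClosed_Icc isClosed_singleton)
    inter_subset_left
  obtain ⟨ρ, ⟨⟨hρ0, hρT⟩, hρ⟩, hρmax⟩ := hZc.exists_isGreatest hZn
  -- Here `ρ` is the last zero of `u j`. As positivity persists, `u j` vanishes on all of `[0, ρ]`,
  -- so the inflow into `j` has integral zero there; its summands are nonnegative and hence vanish
  -- almost everywhere.
  have hρ' : u ρ j = 0 := hρ
  have hzero : ∀ s ≤ ρ, u s j = 0 := fun s hs => by
    by_contra hne
    have := pos_of_isPrimitiveOn hu hB hBj h hs hρT ((hu s j).lt_of_ne' hne)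
    exact this.ne' hρ'
  have hnn : ∀ s ≤ ρ, ∀ i, 0 ≤ B s j i * u s i := fun s hs i => by
    rcases eq_or_ne j i with rfl | hji
    · rw [hzero s hs, mul_zero]
    · exact mul_nonneg (hB s i hji) (hu s i)
  have h1 := h.sub_eq le_rfl hρ0 hρT
  rw [hρ', hzero 0 hρ0, sub_zero, eq_comm, setIntegral_eq_zero_iff_of_nonneg_ae ?_
    (integrableOn_Ioc_mono h.1 le_rfl hρT)] at h1
  · have h2 := (ae_restrict_iff' measurableSet_Ioc).1 h1
    filter_upwards [ae_restrict_mem measurableSet_Ioc, ae_restrict_of_ae h2] with s hs hs2 hs0 i hi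
    have hsρ : s ≤ ρ := hρmax ⟨Ioc_subset_Icc_self hs, hs0⟩
    have h3 := hs2 ⟨hs.1, hsρ⟩
    have h4 := (Finset.sum_eq_zero_iff_of_nonneg fun i _ => hnn s hsρ i).1 h3 i (Finset.mem_univ i)
    exact (mul_eq_zero.1 h4).resolve_right hi.ne'
  · filter_upwards [ae_restrict_mem measurableSet_Ioc] with s hs
    exact Finset.sum_nonneg fun i _ => hnn s hs.2 i

end Smoothing

/-! ### The three assertions for the random observation path. -/

section Main

variable {Ω : Type*} {mΩ : MeasurableSpace Ω} {Q : Measure Ω} [IsProbabilityMeasure Q] {N : ℕ}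
  {A : ℝ≥0 → Matrix (Fin N) (Fin N) ℝ} {X : Ω → StatePath N} {hX : Measurable X}
  {Y : Ω → CountingPath} {hY : Measurable Y} {lam : Fin N → ℝ≥0 → CountingPath → ℝ} {T : ℝ≥0}

lemma integrable_likelihood {Q : Measure Ω}
    (hZ : Martingale (fun t => likelihood lam X Y (min t T)) (fullFiltration X hX Y hY) Q)
    {t : ℝ≥0} (ht : t ≤ T) : Integrable (likelihood lam X Y t) Q := by
  have := hZ.integrable t
  rwa [min_eq_left ht] at this

lemma isUnnormalisedFilter_weightedProb (hQ : IsReferenceModel Q A X hX Y hY)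
    (hlam : IsIntensity lam) (hgood : ∀ᵐ ω ∂Q, IsGood lam T (Y ω))
    (hZ : Martingale (fun t => likelihood lam X Y (min t T)) (fullFiltration X hX Y hY) Q) :
    IsUnnormalisedFilter Q T lam X Y hY fun t ω => weightedProb Q lam X t t (Y ω) := fun t ht =>
  (condExp_likelihood_basisVec hlam hX hY hQ.indep hgood ht (integrable_likelihood hZ ht) t).symm

/-- Every càdlàg version of the filter solves the robust filter equation. -/
theorem robust_filter (hA : IsRateMatrix A) (hQ : IsReferenceModel Q A X hX Y hY)
    (hlam : IsIntensity lam) (hgood : ∀ᵐ ω ∂Q, IsGood lam T (Y ω))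
    (hZ : Martingale (fun t => likelihood lam X Y (min t T)) (fullFiltration X hX Y hY) Q)
    {q : ℝ≥0 → Ω → Fin N → ℝ} (hq : IsUnnormalisedFilter Q T lam X Y hY q)
    (hqc : ∀ᵐ ω ∂Q, IsCadlagOn T (fun t => q t ω)) :
    ∀ᵐ ω ∂Q, ∀ i, IsPrimitiveOn 0 T (fun t => ((Gam lam (Y ω) t)⁻¹ *ᵥ q t ω) i)
      (fun s => (((Gam lam (Y ω) s)⁻¹ * A s * Gam lam (Y ω) s) *ᵥ
        ((Gam lam (Y ω) s)⁻¹ *ᵥ q s ω)) i) := by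
  have hq' := isUnnormalisedFilter_weightedProb hQ hlam hgood hZ
  have hc : ∀ᵐ ω ∂Q, IsCadlagOn T (fun t => weightedProb Q lam X t t (Y ω)) := by
    filter_upwards [hgood] with ω hω using isCadlagOn_weightedProb hA hQ.chain hlam hω
  -- Two càdlàg versions are indistinguishable on `[0, T]`, so the explicit version may stand for
  -- any `q`.
  have heq := ae_forall_eq_of_forall_ae_eq hqc hc (S := Iic T) (fun _ _ _ _ h => h)
    (fun _ h => h) fun t ht => (hq t ht).trans (hq' t ht).symm
  filter_upwards [hgood, heq] with ω hω hω' i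
  have e : ∀ t ≤ T, (Gam lam (Y ω) t)⁻¹ *ᵥ q t ω = robust Q lam X (fun _ => 1) (Y ω) t := by
    intro t ht
    ext j
    rw [Gam_inv hlam, Matrix.mulVec_diagonal, hω' t ht, ← gam_mul_robust_one hlam,
      inv_mul_cancel_left₀ (gam_pos hlam t j).ne']
  refine ((isPrimitiveOn_robust_one hA hQ.chain hlam hω i).congr zero_le fun t ht => by
    rw [e t ht.2]).congr_deriv ?_
  filter_upwards [ae_restrict_mem measurableSet_Ioc] with s hs
  rw [Gam_inv_mul_mul_mulVec hlam, e s hs.2]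

/-- A measurable solution of the robust equation determines a smoothing vector. -/
theorem isSmoothingVector_div_gam (hA : IsRateMatrix A) (hQ : IsReferenceModel Q A X hX Y hY)
    (hlam : IsIntensity lam) (hgood : ∀ᵐ ω ∂Q, IsGood lam T (Y ω))
    (hZ : Martingale (fun t => likelihood lam X Y (min t T)) (fullFiltration X hX Y hY) Q)
    {V : ℝ≥0 → CountingPath → Fin N → ℝ}
    (hVm : ∀ t ≤ T, ∀ i, Measurable[pathFiltration IsCountingPath T] fun y => V t y i)
    (hV : ∀ y, IsGood lam T y → (∀ i, V T y i = gam lam y T i) ∧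
        ∀ i, IsPrimitiveOn 0 T (fun t => V t y i) (fun s => -backwardRate A lam y s (V s y) i)) :
    IsSmoothingVector Q T lam X Y hY fun t ω i => V t (Y ω) i / gam lam (Y ω) t i := by
  intro t ht
  refine ⟨?_, ?_⟩
  · refine (@measurable_pi_iff _ _ _ (obsFiltration Y hY T) _ _).2 fun i => ?_
    have h1 : Measurable[pathFiltration IsCountingPath T] fun y => V t y i / gam lam y t i :=
      Measurable.div (hVm t ht i) (measurable_gam_pathFiltration hlam ht i)
    exact h1.comp (comap_measurable Y)
  · filter_upwards [hgood,
      condExp_likelihood_basisVec hlam hX hY hQ.indep hgood le_rfl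
        (integrable_likelihood hZ le_rfl) t,
      condExp_likelihood_basisVec hlam hX hY hQ.indep hgood ht (integrable_likelihood hZ ht) t]
      with ω hω h1 h2
    rw [h1, h2]
    ext i
    rw [Matrix.mulVec_diagonal]
    exact weightedProb_eq_mul hA hQ.chain hlam hω (hV _ hω).1 (hV _ hω).2 ht i

/-- There are smoothing vectors which solve the smoother equation. -/
theorem exists_smoothingVector (hA : IsRateMatrix A) (hQ : IsReferenceModel Q A X hX Y hY)
    (hlam : IsIntensity lam) (hgood : ∀ᵐ ω ∂Q, IsGood lam T (Y ω))
    (hZ : Martingale (fun t => likelihood lam X Y (min t T)) (fullFiltration X hX Y hY) Q) :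
    ∃ v : ℝ≥0 → Ω → Fin N → ℝ, IsSmoothingVector Q T lam X Y hY v ∧
      ∀ᵐ ω ∂Q, IsCadlagOn T (fun t => v t ω) ∧ SolvesSmootherEq A T lam (Y ω) (fun t => v t ω) := by
  obtain ⟨V, hVm, hV⟩ := exists_robust_smoother hA hlam T
  refine ⟨_, isSmoothingVector_div_gam hA hQ hlam hgood hZ hVm hV, ?_⟩
  filter_upwards [hgood] with ω hω
  obtain ⟨h1, h2⟩ := hV _ hω
  have e : ∀ s i, gam lam (Y ω) s i * (V s (Y ω) i / gam lam (Y ω) s i) = V s (Y ω) i :=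
    fun s i => mul_div_cancel₀ _ (gam_pos hlam s i).ne'
  refine solvesSmootherEq_of_isPrimitiveOn hA hlam hω ?_ fun i => ?_
  · ext i
    rw [h1, div_self (gam_pos hlam T i).ne', Pi.one_apply]
  · simp only [e]
    exact h2 i

/-- Smoothing vectors are unique in those components in which the filter is positive. -/
theorem IsSmoothingVector.ae_eq (hQ : IsReferenceModel Q A X hX Y hY)
    (hlam : IsIntensity lam) (hgood : ∀ᵐ ω ∂Q, IsGood lam T (Y ω))
    (hZ : Martingale (fun t => likelihood lam X Y (min t T)) (fullFiltration X hX Y hY) Q)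
    {v w : ℝ≥0 → Ω → Fin N → ℝ} (hv : IsSmoothingVector Q T lam X Y hY v)
    (hw : IsSmoothingVector Q T lam X Y hY w) {t : ℝ≥0} (ht : t ≤ T) {i : Fin N}
    (hi : Q {ω | (X ω).1 t = i} ≠ 0) : (fun ω => v t ω i) =ᵐ[Q] fun ω => w t ω i := by
  filter_upwards [hgood, (hv t ht).2, (hw t ht).2,
    condExp_likelihood_basisVec hlam hX hY hQ.indep hgood ht (integrable_likelihood hZ ht) t]
    with ω hω h1 h2 h3
  have h4 := congrFun (h1.symm.trans h2) i
  rw [h3, Matrix.mulVec_diagonal, Matrix.mulVec_diagonal] at h4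
  exact mul_right_cancel₀ ((weightedProb_pos_iff hlam hX hω ht i).2 hi).ne' h4

/-- Smoothing vectors solve the robust equation in the components of positive probability. -/
theorem IsSmoothingVector.isPrimitiveOn (hA : IsRateMatrix A)
    (hQ : IsReferenceModel Q A X hX Y hY)
    (hlam : IsIntensity lam) (hgood : ∀ᵐ ω ∂Q, IsGood lam T (Y ω))
    (hZ : Martingale (fun t => likelihood lam X Y (min t T)) (fullFiltration X hX Y hY) Q)
    {v : ℝ≥0 → Ω → Fin N → ℝ} (hv : IsSmoothingVector Q T lam X Y hY v)
    (hvc : ∀ᵐ ω ∂Q, IsCadlagOn T (fun t => v t ω)) :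
    ∀ᵐ ω ∂Q, ∀ r ≤ T, ∀ i, Q {ω' | (X ω').1 r = i} ≠ 0 →
      gam lam (Y ω) T i * v T ω i = gam lam (Y ω) T i ∧
      IsPrimitiveOn r T (fun t => gam lam (Y ω) t i * v t ω i)
        (fun s => -backwardRate A lam (Y ω) s (fun j => gam lam (Y ω) s j * v s ω j) i) := by
  obtain ⟨w, hw, hwc⟩ := exists_smoothingVector hA hQ hlam hgood hZ
  have hB : ∀ (y : CountingPath) t i j, i ≠ j →
      0 ≤ A t i j * (gam lam y t j / gam lam y t i) := fun y t i j hij =>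
    mul_nonneg (hA.nonneg t i j hij) (div_pos (gam_pos hlam t j) (gam_pos hlam t i)).le
  have hBi : ∀ (y : CountingPath) i,
      IntegrableOn (fun s => A s i i * (gam lam y s i / gam lam y s i)) (Ioc 0 T) := fun y i => by
    simpa only [div_self (gam_pos hlam _ i).ne', mul_one] using hA.integrable i i T
  have hu : ∀ y, IsGood lam T y → ∀ i,
      IsPrimitiveOn 0 T (fun t => robust Q lam X (fun _ => 1) y t i)
        (fun s => ∑ j, A s i j * (gam lam y s j / gam lam y s i) *
          robust Q lam X (fun _ => 1) y s j) := fun y hy i => by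
    simpa only [mul_assoc] using isPrimitiveOn_robust_one hA hQ.chain hlam hy i
  -- The statement involves no observation, so a single good path is enough to translate it into
  -- persistence of positivity for `robust`.
  have hup : ∀ r t i, r ≤ t → t ≤ T → Q {ω | (X ω).1 r = i} ≠ 0 → Q {ω | (X ω).1 t = i} ≠ 0 := by
    intro r t i hrt ht hr
    obtain ⟨ω, hω⟩ := hgood.exists
    rw [← robust_pos_iff hlam hX hω (hrt.trans ht)] at hr
    rw [← robust_pos_iff hlam hX hω ht]
    exact pos_of_isPrimitiveOn (B := fun s => Matrix.of fun i j =>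
      A s i j * (gam lam (Y ω) s j / gam lam (Y ω) s i))
      (robust_nonneg hlam) (fun s j => hB _ s i j) (hBi _ i) (hu _ hω i) hrt ht hr
  -- By `hup` the set of times at which `v` is determined in component `i` is upward closed, so one
  -- null set serves all of them.
  have heq : ∀ᵐ ω ∂Q, ∀ i, ∀ t ∈ {t | t ≤ T ∧ Q {ω | (X ω).1 t = i} ≠ 0}, v t ω i = w t ω i := by
    refine ae_all_iff.2 fun i => ae_forall_eq_of_forall_ae_eq ?_ ?_
      (fun s hs t hst ht => ⟨ht, hup s t i hst ht hs.2⟩) (fun t ht => ht.1)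
      fun t ht => hv.ae_eq hQ hlam hgood hZ hw ht.1 ht.2
    · filter_upwards [hvc] with ω hω using isCadlagOn_pi.1 hω i
    · filter_upwards [hwc] with ω hω using isCadlagOn_pi.1 hω.1 i
  filter_upwards [hgood, hwc, heq] with ω hω hωw hωe r hr i hri
  have hwp := hωw.2.isPrimitiveOn hA hlam hω hωw.1
  have heqr : ∀ t, r ≤ t → t ≤ T → v t ω i = w t ω i := fun t hrt ht =>
    hωe i t ⟨ht, hup r t i hrt ht hri⟩
  have hwT : w T ω = 1 := hωw.2.1
  refine ⟨by rw [heqr T hr le_rfl, hwT, Pi.one_apply, mul_one], ?_⟩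
  refine (((hwp i).mono zero_le le_rfl).congr hr fun t ht => by
    rw [heqr t ht.1 ht.2]).congr_deriv ?_
  have hz : ∀ᵐ s ∂volume.restrict (Ioc r T), ∀ j, robust Q lam X (fun _ => 1) (Y ω) s j = 0 →
      ∀ i, 0 < robust Q lam X (fun _ => 1) (Y ω) s i →
        A s j i * (gam lam (Y ω) s i / gam lam (Y ω) s j) = 0 :=
    ae_mono (Measure.restrict_mono (Ioc_subset_Ioc_left zero_le) le_rfl) <| ae_all_iff.2 fun j =>
      ae_rate_eq_zero (B := fun s => Matrix.of fun i j =>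
        A s i j * (gam lam (Y ω) s j / gam lam (Y ω) s i))
        (robust_nonneg hlam) (fun s i => hB _ s j i) (hBi _ j) (hu _ hω j)
  filter_upwards [ae_restrict_mem measurableSet_Ioc, hz] with s hs hs'
  simp only [backwardRate]
  refine congrArg _ (Finset.sum_congr rfl fun j _ => ?_)
  -- The vectors `v` and `w` may differ in an unoccupied component `j`, but by `hz` it carries the
  -- coefficient zero, as `i` is occupied from time `r` on.
  by_cases hj : Q {ω | (X ω).1 s = j} = 0
  · have h1 : robust Q lam X (fun _ => 1) (Y ω) s j = 0 := by
      by_contra hne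
      exact (robust_pos_iff hlam hX hω hs.2 j).1 ((robust_nonneg hlam s j).lt_of_ne' hne) hj
    have h2 := hs' j h1 i
      ((robust_pos_iff hlam hX hω hs.2 i).2 (hup r s i hs.1.le hs.2 hri))
    rw [mul_div_assoc', mul_comm, ← mul_div_assoc'] at h2
    have h3 : gam lam (Y ω) s i * A s j i / gam lam (Y ω) s j = 0 := by
      rw [mul_div_assoc]
      exact h2
    rw [h3, zero_mul, zero_mul]
  · rw [hωe j s ⟨hs.2, hj⟩]

end Main

end SelfExcitingHMM

end

/-! ### The theorem, in vector form. -/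

theorem mainTheorem3 {Ω : Type*} [mΩ : MeasurableSpace Ω] (Q : Measure Ω) [IsProbabilityMeasure Q]
    (N : ℕ) (A : ℝ≥0 → Matrix (Fin N) (Fin N) ℝ) (hA : SelfExcitingHMM.IsRateMatrix A)
    (X : Ω → SelfExcitingHMM.StatePath N) (hX : Measurable X)
    (Y : Ω → SelfExcitingHMM.CountingPath) (hY : Measurable Y)
    (hQ : SelfExcitingHMM.IsReferenceModel Q A X hX Y hY)
    (lam : Fin N → ℝ≥0 → SelfExcitingHMM.CountingPath → ℝ)
    (hlam : SelfExcitingHMM.IsIntensity lam) (T : ℝ≥0)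
    (hint : ∀ᵐ ω ∂Q, ∀ i, IntegrableOn (fun s => lam i s (Y ω)) (Ioc 0 T))
    (hZ : Martingale (fun t => SelfExcitingHMM.likelihood lam X Y (min t T))
      (SelfExcitingHMM.fullFiltration X hX Y hY) Q) :
    let Γ : ℝ≥0 → Ω → Matrix (Fin N) (Fin N) ℝ := fun t ω => SelfExcitingHMM.Gam lam (Y ω) t
    -- the filter has a càdlàg version, and every càdlàg version satisfies the robust equation
    (∃ q : ℝ≥0 → Ω → Fin N → ℝ, SelfExcitingHMM.IsUnnormalisedFilter Q T lam X Y hY q ∧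
      ∀ᵐ ω ∂Q, SelfExcitingHMM.IsCadlagOn T (fun t => q t ω)) ∧
    (∀ q : ℝ≥0 → Ω → Fin N → ℝ, SelfExcitingHMM.IsUnnormalisedFilter Q T lam X Y hY q →
      (∀ᵐ ω ∂Q, SelfExcitingHMM.IsCadlagOn T (fun t => q t ω)) →
      let qbar : ℝ≥0 → Ω → Fin N → ℝ := fun t ω => (Γ t ω)⁻¹ *ᵥ q t ω
      ∀ᵐ ω ∂Q,
        IntegrableOn (fun s => ((Γ s ω)⁻¹ * A s * Γ s ω) *ᵥ qbar s ω) (Ioc 0 T) ∧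
        ∀ t ≤ T, qbar t ω =
          qbar 0 ω + ∫ s in Ioc 0 t, ((Γ s ω)⁻¹ * A s * Γ s ω) *ᵥ qbar s ω) ∧
    -- there are smoothing vectors which solve the smoother equation, and every càdlàg solution of
    -- the smoother equation satisfies the robust equation
    (∃ v : ℝ≥0 → Ω → Fin N → ℝ, SelfExcitingHMM.IsSmoothingVector Q T lam X Y hY v ∧
      ∀ᵐ ω ∂Q, SelfExcitingHMM.IsCadlagOn T (fun t => v t ω) ∧
        SelfExcitingHMM.SolvesSmootherEq A T lam (Y ω) (fun t => v t ω)) ∧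
    (∀ v : ℝ≥0 → Ω → Fin N → ℝ,
      (∀ᵐ ω ∂Q, SelfExcitingHMM.IsCadlagOn T (fun t => v t ω) ∧
        SelfExcitingHMM.SolvesSmootherEq A T lam (Y ω) (fun t => v t ω)) →
      let vbar : ℝ≥0 → Ω → Fin N → ℝ := fun t ω => Γ t ω *ᵥ v t ω
      ∀ᵐ ω ∂Q,
        IntegrableOn (fun s => (Γ s ω * (A s)ᵀ * (Γ s ω)⁻¹) *ᵥ vbar s ω) (Ioc 0 T) ∧
        ∀ t ≤ T,
          vbar t ω = vbar 0 ω - (∫ s in Ioc 0 t, (Γ s ω * (A s)ᵀ * (Γ s ω)⁻¹) *ᵥ vbar s ω) ∧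
          vbar t ω = Γ T ω *ᵥ 1 + ∫ s in Ioc t T, (Γ s ω * (A s)ᵀ * (Γ s ω)⁻¹) *ᵥ vbar s ω) ∧
    -- every càdlàg family of smoothing vectors satisfies the robust equation in those components
    -- which it determines, that is, from the time on at which the state has positive probability
    (∀ v : ℝ≥0 → Ω → Fin N → ℝ, SelfExcitingHMM.IsSmoothingVector Q T lam X Y hY v →
      (∀ᵐ ω ∂Q, SelfExcitingHMM.IsCadlagOn T (fun t => v t ω)) →
      let vbar : ℝ≥0 → Ω → Fin N → ℝ := fun t ω => Γ t ω *ᵥ v t ω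
      ∀ᵐ ω ∂Q, ∀ r ≤ T, ∀ i, Q {ω' | (X ω').1 r = i} ≠ 0 →
        IntegrableOn (fun s => ((Γ s ω * (A s)ᵀ * (Γ s ω)⁻¹) *ᵥ vbar s ω) i) (Ioc r T) ∧
        ∀ t, r ≤ t → t ≤ T →
          vbar t ω i = vbar r ω i -
            (∫ s in Ioc r t, ((Γ s ω * (A s)ᵀ * (Γ s ω)⁻¹) *ᵥ vbar s ω) i) ∧
          vbar t ω i = (Γ T ω *ᵥ 1) i +
            ∫ s in Ioc t T, ((Γ s ω * (A s)ᵀ * (Γ s ω)⁻¹) *ᵥ vbar s ω) i) := by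
  have hgood : ∀ᵐ ω ∂Q, SelfExcitingHMM.IsGood lam T (Y ω) := hint
  refine ⟨⟨_, SelfExcitingHMM.isUnnormalisedFilter_weightedProb hQ hlam hgood hZ, ?_⟩, ?_,
    SelfExcitingHMM.exists_smoothingVector hA hQ hlam hgood hZ, ?_, ?_⟩
  · filter_upwards [hgood] with ω hω
    exact SelfExcitingHMM.isCadlagOn_weightedProb hA hQ.chain hlam hω
  · intro q hq hqc
    filter_upwards [SelfExcitingHMM.robust_filter hA hQ hlam hgood hZ hq hqc] with ω hω
    obtain ⟨h1, h2⟩ := SelfExcitingHMM.IsPrimitiveOn.pi hω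
    exact ⟨h1, fun t ht => h2 t zero_le ht⟩
  · intro v hv
    filter_upwards [hgood, hv] with ω hω hvω
    have h := fun i => (hvω.2.isPrimitiveOn hA hlam hω hvω.1 i).backward
    simp only [← SelfExcitingHMM.Gam_mulVec, ← SelfExcitingHMM.Gam_mul_mul_inv_mulVec hlam] at h
    have hv1 : v T ω = 1 := hvω.2.1
    refine ⟨Integrable.of_eval fun i => (h i).1, fun t ht => ⟨?_, ?_⟩⟩
    · ext i
      rw [Pi.sub_apply, eval_integral fun i =>
        SelfExcitingHMM.integrableOn_Ioc_mono (h i).1 le_rfl ht]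
      exact ((h i).2 t zero_le ht).1
    · ext i
      rw [Pi.add_apply, eval_integral fun i =>
        SelfExcitingHMM.integrableOn_Ioc_mono (h i).1 zero_le le_rfl, ← hv1]
      exact ((h i).2 t zero_le ht).2
  · intro v hv hvc
    filter_upwards [hv.isPrimitiveOn hA hQ hlam hgood hZ hvc] with ω hω r hr i hi
    obtain ⟨hT, hp⟩ := hω r hr i hi
    have h := hp.backward
    rw [hT] at h
    simp only [← SelfExcitingHMM.Gam_mulVec, ← SelfExcitingHMM.Gam_mul_mul_inv_mulVec hlam] at h
    rw [SelfExcitingHMM.Gam_mulVec T 1 i, Pi.one_apply, mul_one]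
    exact h
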